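/- Let $a>0$, let $\mathcal L_0=\mathbb Z(1/a,0)\oplus\mathbb Z(0,a)$, let $\mathbb T^2=\mathbb R^2/2\pi\mathcal L_0$, and let $\mathcal L=\{(ma,n/a):m,n\in\mathbb Z\}$ be the dual lattice, so that the spectrum of $-\Delta$ on $\mathbb T^2$ is $\sigma(-\Delta)=\{|\xi|^2:\xi\in\mathcal L\}$. Let $x_0\in\mathbb T^2$ and $\phi\in(-\pi,\pi)$, and let $-\Delta_\phi$ be the following self-adjoint extension of $-\Delta|_{C_c^\infty(\mathbb T^2\setminus\{x_0\})}$ in $L^2(\mathbb T^2)$: its domain consists of the functions $g+cG_{i}+ce^{i\phi}G_{-i}$, where $c\in\mathbb C$, $g$ is in the domain of the closure of $-\Delta|_{C_c^\infty(\mathbb T^2\setminus\{x_0\})}$, and $$G_{z}(x)=-\frac1{4\pi^2}\sum_{\xi\in\mathcal L}\frac{e^{i\langle\xi,x-x_0\rangle}}{|\xi|^2-z}$$ is the Green's function; and $-\Delta_\phi$ maps such a function to $-\Delta g+ciG_i-ce^{i\phi}iG_{-i}$ (with $-\Delta g$ understood as the closure applied to $g$). Let $\Lambda$ be the set of perturbed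 eigenvalues, that is, of the eigenvalues of $-\Delta_\phi$ that are not in $\sigma(-\Delta)$. Let $\theta\ge\frac14$ be an exponent for the remainder term in Weyl's law, i.e. $$\#\{\xi\in\mathcal L:|\xi|^2\le x\}=\pi x+O(x^\theta)\qquad(x\to\infty),$$ and let $\delta\in(\frac\theta2,\frac12-\theta)$. For $0\ne\zeta\in\mathcal L$ put $$S_\zeta=\{\eta\in\mathcal L:|\langle\eta,\zeta\rangle|\le|\eta|^{2\delta}\},\qquad A(\lambda,L)=\{\xi\in\mathcal L:\bigl||\xi|^2-\lambda\bigr|<L\},$$ $$\Lambda_\zeta=\{\lambda\in\Lambda:A(\lambda,|\lambda|^\delta)\cap S_\zeta=\emptyset\},\qquad B_\zeta=\Lambda\setminus\Lambda_\zeta .$$ Then $\{\lambda\in\Lambda:\lambda\le X\}$ is finite for every real $X$, and for every $0\ne\zeta\in\mathcal L$ the set $\Lambda_\zeta$ has density one in $\Lambda$ and the set $B_\zeta$ of exceptional eigenvalues has density zero in $\Lambda$, i.e. $$\frac{\#\{\lambda\in\Lambda_\zeta:\lambda\le X\}}{\#\{\lambda\in\Lambda:\lambda\le X\}}\to1,\qquad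 \frac{\#\{\lambda\in B_\zeta:\lambda\le X\}}{\#\{\lambda\in\Lambda:\lambda\le X\}}\to0\qquad(X\to\infty).$$ Moreover, with $\delta'=\frac12-\theta-\delta>0$, there is a constant $C$, depending on $a,x_0,\phi,\theta,\delta$ but not on $\zeta$, such that for every $0\ne\zeta\in\mathcal L$ there is $X_0(\zeta)$ with $$\#\{\lambda\in B_\zeta:\lambda\le X\}\le C\,\frac{X^{1-\delta'}}{|\zeta|}\qquad\text{for all }X\ge X_0(\zeta).$$ -/

import Mathlib

open Filter Topology MeasureTheory
open scoped ContDiff ENNReal InnerProductSpace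

noncomputable section

namespace PointScatterer

/-- The Euclidean plane. -/
abbrev Plane : Type := EuclideanSpace ℝ (Fin 2)

/-! ### The dual lattice -/

/-- The vector `(n₁ a, n₂ / a)`. -/
def latVec (a : ℝ) (n : Fin 2 → ℤ) : Plane := !₂[(n 0 : ℝ) * a, (n 1 : ℝ) / a]

/-- The lattice `𝓛 = {(m a, n / a) : m, n ∈ ℤ}` dual to `𝓛₀ = ℤ (1/a, 0) ⊕ ℤ (0, a)`. -/
def dualLattice (a : ℝ) : Set Plane := Set.range (latVec a)

/-- The norms `|ξ|²`, `ξ ∈ 𝓛`: the spectrum of `-Δ` on the flat torus `ℝ² / 2π𝓛₀`. -/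
def norms (a : ℝ) : Set ℝ := (fun ξ : Plane => ‖ξ‖ ^ 2) '' dualLattice a

/-- `#{ξ ∈ 𝓛 : |ξ|² ≤ x}`. -/
def latticeCount (a x : ℝ) : ℕ := {ξ ∈ dualLattice a | ‖ξ‖ ^ 2 ≤ x}.ncard

/-- `θ` is an exponent for the remainder term in Weyl's law on the torus:
`#{ξ ∈ 𝓛 : |ξ|² ≤ x} = π x + O(x ^ θ)` as `x → ∞`. -/
def IsWeylExponent (a θ : ℝ) : Prop :=
  (fun x : ℝ => (latticeCount a x : ℝ) - Real.pi * x) =O[atTop] fun x : ℝ => x ^ θ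

/-! ### The torus, its Hilbert space and the point scatterer -/

/-- The torus `𝕋² = ℝ² / 2π𝓛₀`, in the coordinates in which the lattice `2π𝓛₀` becomes `ℤ²`. -/
abbrev Torus : Type := UnitAddTorus (Fin 2)

/-- The quotient map `ℝ² → ℝ² / 2π𝓛₀`; the sides of the fundamental rectangle have lengths
`2π / a` and `2π a`. -/
def toTorus (a : ℝ) (x : Plane) : Torus :=
  fun i => ((![a * x 0 / (2 * Real.pi), x 1 / (2 * Real.pi * a)] i : ℝ) : UnitAddCircle)

/-- Lebesgue measure on the torus, normalised to have total mass one (it is `dx / (4π²)`). -/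
abbrev torusMeasure : Measure Torus := Measure.pi fun _ => AddCircle.haarAddCircle

/-- The Hilbert space `L²(𝕋²)`. -/
abbrev L2 : Type := Lp ℂ 2 torusMeasure

/-- The graph of `-Δ` restricted to `C_c^∞(𝕋² ∖ {x₀})`: the pairs of classes `(u, v)` where `u` is
a smooth function on the torus vanishing in a neighbourhood of `x₀`, and `v = -Δ u`. -/
def restrictedLaplacianGraph (a : ℝ) (x₀ : Torus) : Set (L2 × L2) :=
  {p | ∃ u v : Torus → ℂ,
    ContDiff ℝ ∞ (fun x : Plane => u (toTorus a x)) ∧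
    (∀ᶠ y in 𝓝 x₀, u y = 0) ∧
    (∀ x : Plane, v (toTorus a x) = -(Laplacian.laplacian (fun z : Plane => u (toTorus a z)) x)) ∧
    p.1 =ᵐ[torusMeasure] u ∧ p.2 =ᵐ[torusMeasure] v}

/-- The coefficient of `exp (i ⟨ξ, x⟩)`, `ξ = latVec a n`, in the Green's function
`G_z(x, x₀) = -(1 / 4π²) ∑_{ξ ∈ 𝓛} exp (i ⟨ξ, x - x₀⟩) / (|ξ|² - z)`. -/
def greenCoeff (a : ℝ) (x₀ : Torus) (z : ℂ) (n : Fin 2 → ℤ) : ℂ :=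
  -(1 / (4 * (Real.pi : ℂ) ^ 2)) * UnitAddTorus.mFourier (-n) x₀ / ((‖latVec a n‖ : ℂ) ^ 2 - z)

theorem norm_sq_latVec (a : ℝ) (n : Fin 2 → ℤ) :
    ‖latVec a n‖ ^ 2 = ((n 0 : ℝ) * a) ^ 2 + ((n 1 : ℝ) / a) ^ 2 := by
  simp [latVec, EuclideanSpace.norm_sq_eq, Fin.sum_univ_two]

/-- `exp (i ⟨ξ, x⟩)` is the monomial with index `n`, when `ξ = latVec a n`. -/
theorem mFourier_toTorus {a : ℝ} (ha : 0 < a) (n : Fin 2 → ℤ) (x : Plane) :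
    UnitAddTorus.mFourier n (toTorus a x) = Complex.exp (Complex.I * (⟪latVec a n, x⟫_ℝ : ℝ)) := by
  have hpi : (Real.pi : ℂ) ≠ 0 := by exact_mod_cast Real.pi_ne_zero
  have ha' : (a : ℂ) ≠ 0 := by exact_mod_cast ha.ne'
  simp only [UnitAddTorus.mFourier, ContinuousMap.coe_mk, Fin.prod_univ_two, toTorus,
    Matrix.cons_val_zero, Matrix.cons_val_one]
  rw [fourier_coe_apply, fourier_coe_apply, ← Complex.exp_add]
  congr 1
  simp only [latVec, PiLp.inner_apply, Fin.sum_univ_two, RCLike.inner_apply, conj_trivial,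
    Matrix.cons_val_zero, Matrix.cons_val_one]
  push_cast
  field_simp

theorem norm_sq_latVec_ge {a : ℝ} (ha : 0 < a) (n : Fin 2 → ℤ) :
    min (a ^ 2) (1 / a ^ 2) * ‖n‖ ^ 2 ≤ ‖latVec a n‖ ^ 2 := by
  have hk : 0 ≤ min (a ^ 2) (1 / a ^ 2) := by positivity
  have key : ∀ i, min (a ^ 2) (1 / a ^ 2) * ‖n i‖ ^ 2 ≤ ‖latVec a n‖ ^ 2 := by
    rw [norm_sq_latVec]
    intro i
    fin_cases i
    · have := mul_le_mul_of_nonneg_right (min_le_left (a ^ 2) (1 / a ^ 2)) (sq_nonneg (n 0 : ℝ))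
      simp only [Int.norm_eq_abs, sq_abs, Fin.zero_eta]
      nlinarith [sq_nonneg ((n 1 : ℝ) / a)]
    · have := mul_le_mul_of_nonneg_right (min_le_right (a ^ 2) (1 / a ^ 2)) (sq_nonneg (n 1 : ℝ))
      have h2 : 1 / a ^ 2 * (n 1 : ℝ) ^ 2 = ((n 1 : ℝ) / a) ^ 2 := by rw [div_pow]; ring
      simp only [Int.norm_eq_abs, sq_abs, Fin.mk_one]
      nlinarith [sq_nonneg ((n 0 : ℝ) * a)]
  rw [Pi.norm_def]
  obtain ⟨i, -, hi⟩ := Finset.exists_mem_eq_sup Finset.univ Finset.univ_nonempty (fun b => ‖n b‖₊)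
  rw [hi]
  exact key i

theorem memℓp_greenCoeff {a : ℝ} (ha : 0 < a) (x₀ : Torus) (z : ℂ) :
    Memℓp (greenCoeff a x₀ z) 2 := by
  apply memℓp_gen
  set k := min (a ^ 2) (1 / a ^ 2) with hkdef
  have hk : 0 < k := lt_min (by positivity) (by positivity)
  have hsum := (EisensteinSeries.summable_one_div_norm_rpow (k := 4) (by norm_num)).mul_left
    ((1 / (4 * Real.pi ^ 2) * (2 / k)) ^ 2)
  refine Summable.of_norm_bounded_eventually hsum ?_
  have ht : Tendsto (fun n : Fin 2 → ℤ => k * ‖n‖ ^ 2) cofinite atTop := by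
    rw [← Filter.cocompact_eq_cofinite]
    exact ((tendsto_pow_atTop (by norm_num)).comp tendsto_norm_cocompact_atTop).const_mul_atTop hk
  filter_upwards [ht.eventually_ge_atTop (2 * ‖z‖), ht.eventually_gt_atTop 0] with n hn hn0
  have hnorm : 0 < ‖n‖ := by
    by_contra h
    have : ‖n‖ = 0 := le_antisymm (not_lt.mp h) (norm_nonneg _)
    simp [this] at hn0
  have hden : k * ‖n‖ ^ 2 / 2 ≤ ‖((‖latVec a n‖ : ℂ) ^ 2 - z)‖ := by
    have h1 := norm_sub_norm_le ((‖latVec a n‖ : ℂ) ^ 2) z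
    have h2 : ‖((‖latVec a n‖ : ℂ) ^ 2)‖ = ‖latVec a n‖ ^ 2 := by simp
    have h3 := norm_sq_latVec_ge ha n
    rw [h2] at h1
    linarith
  have hm : ‖UnitAddTorus.mFourier (-n) x₀‖ ≤ 1 :=
    ((UnitAddTorus.mFourier (-n)).norm_coe_le_norm x₀).trans_eq UnitAddTorus.mFourier_norm
  have hc : ‖-(1 / (4 * (Real.pi : ℂ) ^ 2))‖ = 1 / (4 * Real.pi ^ 2) := by
    simp [abs_of_pos Real.pi_pos]
  have hb : ‖greenCoeff a x₀ z n‖ ≤ 1 / (4 * Real.pi ^ 2) * (2 / k) * (‖n‖ ^ 2)⁻¹ := by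
    rw [greenCoeff, norm_div, norm_mul, hc]
    calc _ ≤ 1 / (4 * Real.pi ^ 2) * 1 / (k * ‖n‖ ^ 2 / 2) := by gcongr
      _ = _ := by field_simp
  have h4 : ‖n‖ ^ (-4 : ℝ) = ((‖n‖ ^ 2)⁻¹) ^ 2 := by
    rw [Real.rpow_neg hnorm.le, inv_pow, ← pow_mul]
    norm_cast
  have h5 : ‖greenCoeff a x₀ z n‖ ^ (2 : ℝ≥0∞).toReal = ‖greenCoeff a x₀ z n‖ ^ 2 := by
    norm_num
  rw [h5, h4, Real.norm_of_nonneg (by positivity), ← mul_pow]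
  gcongr

/-- The Green's function `G_z(·, x₀) = (Δ + z)⁻¹ δ_{x₀} ∈ L²(𝕋²)` for `z ∉ σ(-Δ)`. -/
def green {a : ℝ} (ha : 0 < a) (x₀ : Torus) (z : ℂ) : L2 :=
  UnitAddTorus.mFourierBasis.repr.symm ⟨greenCoeff a x₀ z, memℓp_greenCoeff ha x₀ z⟩

/-- The graph of the self-adjoint extension `-Δ_φ` of `-Δ` on `C_c^∞(𝕋² ∖ {x₀})`. Its domain
consists of the functions `g + c G_i + c e^{iφ} G_{-i}` with `c ∈ ℂ` and `g` in the domain of the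
closure of `-Δ` on `C_c^∞(𝕋² ∖ {x₀})`, and it sends such a function to
`-Δ g + c i G_i - c e^{iφ} i G_{-i}`. -/
def scattererGraph {a : ℝ} (ha : 0 < a) (x₀ : Torus) (φ : ℝ) : Set (L2 × L2) :=
  {p | ∃ q ∈ closure (restrictedLaplacianGraph a x₀), ∃ c : ℂ,
    p.1 = q.1 + c • green ha x₀ Complex.I
      + (c * Complex.exp (Complex.I * φ)) • green ha x₀ (-Complex.I) ∧
    p.2 = q.2 + (c * Complex.I) • green ha x₀ Complex.I
      - (c * Complex.exp (Complex.I * φ) * Complex.I) • green ha x₀ (-Complex.I)}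

/-- The set `Λ` of perturbed (new) eigenvalues: the eigenvalues of `-Δ_φ` that are not in the
spectrum of `-Δ`. -/
def perturbedEigenvalues {a : ℝ} (ha : 0 < a) (x₀ : Torus) (φ : ℝ) : Set ℝ :=
  {lam | lam ∉ norms a ∧ ∃ f : L2, f ≠ 0 ∧ (f, (lam : ℂ) • f) ∈ scattererGraph ha x₀ φ}

/-! ### Exceptional eigenvalues and density -/

/-- `A(λ, L) = {ξ ∈ 𝓛 : ||ξ|² - λ| < L}`. -/
def annulus (a lam L : ℝ) : Set Plane := {ξ ∈ dualLattice a | |‖ξ‖ ^ 2 - lam| < L}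

/-- `S_ζ = {η ∈ 𝓛 : |⟨η, ζ⟩| ≤ |η| ^ (2δ)}`. -/
def diophantineSet (a δ : ℝ) (ζ : Plane) : Set Plane :=
  {η ∈ dualLattice a | |⟪η, ζ⟫_ℝ| ≤ ‖η‖ ^ (2 * δ)}

/-- `Λ_ζ`, the set of `λ ∈ Λ` such that `A(λ, λ ^ δ)` does not meet `S_ζ`. The absolute value in
`|λ| ^ δ` only matters for negative elements of `Λ` (there is at most one). -/
def goodEigenvalues {a : ℝ} (ha : 0 < a) (x₀ : Torus) (φ δ : ℝ) (ζ : Plane) : Set ℝ :=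
  {lam ∈ perturbedEigenvalues ha x₀ φ | annulus a lam (|lam| ^ δ) ∩ diophantineSet a δ ζ = ∅}

/-- `B_ζ = Λ ∖ Λ_ζ`, the set of exceptional eigenvalues. -/
def exceptionalEigenvalues {a : ℝ} (ha : 0 < a) (x₀ : Torus) (φ δ : ℝ) (ζ : Plane) : Set ℝ :=
  perturbedEigenvalues ha x₀ φ \ goodEigenvalues ha x₀ φ δ ζ

/-- The subset `S` of `T ⊆ ℝ` has density `d` in `T`: every `T ∩ (-∞, X]` is finite, and
`#{s ∈ S : s ≤ X} / #{t ∈ T : t ≤ X} → d` as `X → ∞`. -/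
def HasDensityIn (S T : Set ℝ) (d : ℝ) : Prop :=
  S ⊆ T ∧ (∀ X : ℝ, (T ∩ Set.Iic X).Finite) ∧
    Tendsto (fun X : ℝ => ((S ∩ Set.Iic X).ncard : ℝ) / ((T ∩ Set.Iic X).ncard : ℝ)) atTop (𝓝 d)

end PointScatterer

end

noncomputable section

namespace PointScatterer

/-! ### The quotient map onto the torus -/

/-! Write `N = |ξ|²` for `ξ` in the dual lattice. Everything reduces to counting, once the new
eigenvalues are known to interlace with the distinct norms `N`.

Spectral equation. The closure of the restricted Laplacian consists of the `H²` functions vanishing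
at `x₀` (`closure_restrictedLaplacianGraph`). Its Fourier description is a closed condition, which
gives one inclusion. For the other, each `e_n - e_n(x₀)` is multiplied by cutoffs at scale `k ^
(-1/2)` around `x₀`: the Laplacians of the products are `O(√k)` on a set of area `O(1/k)` and
bounded elsewhere, hence bounded in `L²` and weakly convergent, and a closed subspace is weakly
closed. An eigenfunction with eigenvalue `λ` outside the old spectrum is then a multiple of `G_λ`,
and vanishing at `x₀` of its regular part says `∑ (1 / (N - λ) - N / (N² + 1)) = tan(φ/2) ∑ 1 / (N²
+ 1)` (`mem_perturbedEigenvalues_iff`).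

Interlacing. The left side increases strictly from `-∞` to `+∞` between consecutive norms, so each
such gap holds exactly one new eigenvalue, and at most one lies below all norms.

Upper bound. If `λ ≤ X` is exceptional, some `η` in `S_ζ` satisfies `||η|² - λ| < X ^ δ`. Such `η`
lie in a disc of radius `√(2X)` and in a strip `|⟨η, ζ⟩| ≤ 2 X ^ δ`, which leaves `O(X ^ (1/2 + δ) /
|ζ|)` of them (`ncard_strip_le`). By Weyl's law and interlacing, a window of radius `X ^ δ` around
`|η|²` holds `O(X ^ θ)` new eigenvalues. The product of the two bounds is `O(X ^ (1 - δ') / |ζ|)`.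

Lower bound. There are at least `c X ^ s` distinct norms up to `X`, for every `s < 1`
(`exists_rpow_le_ncard_norms`): by Cauchy–Schwarz it is enough to bound the coincidences `|ξ|² =
|η|²`, which divisor sums control up to logarithms. Since `1 - δ' < 1`, the exceptional set has
density zero. -/

theorem toTorus_add (a : ℝ) (x y : Plane) : toTorus a (x + y) = toTorus a x + toTorus a y := by
  funext i
  fin_cases i
  · simp [toTorus, mul_add, add_div]
  · simp [toTorus, add_div]

theorem isOpenQuotientMap_toTorus {a : ℝ} (ha : 0 < a) : IsOpenQuotientMap (toTorus a) := by
  have hc : ∀ i : Fin 2, (![a / (2 * Real.pi), 1 / (2 * Real.pi * a)] i : ℝ) ≠ 0 := by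
    intro i
    fin_cases i <;> simp <;> exact ha.ne'
  have h1 : IsOpenQuotientMap (fun x : Plane => (WithLp.ofLp x : Fin 2 → ℝ)) :=
    (PiLp.homeomorph 2 (fun _ : Fin 2 => ℝ)).isOpenQuotientMap
  have h2 : IsOpenQuotientMap (Pi.map fun (i : Fin 2) (t : ℝ) =>
      (![a / (2 * Real.pi), 1 / (2 * Real.pi * a)] i : ℝ) * t) :=
    IsOpenQuotientMap.piMap fun i => (Homeomorph.mulLeft₀ _ (hc i)).isOpenQuotientMap
  have h3 : IsOpenQuotientMap (Pi.map fun (_ : Fin 2) (t : ℝ) => (t : UnitAddCircle)) :=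
    IsOpenQuotientMap.piMap fun _ => QuotientAddGroup.isOpenQuotientMap_mk
  have h4 := (h3.comp h2).comp h1
  convert h4 using 1
  funext x i
  fin_cases i
  · simp [toTorus]; congr 1; ring
  · simp [toTorus]; congr 1; ring

theorem mFourier_add_apply (n : Fin 2 → ℤ) (x y : Torus) :
    UnitAddTorus.mFourier n (x + y) = UnitAddTorus.mFourier n x * UnitAddTorus.mFourier n y := by
  -- The identity does not involve `a`, so the points can be lifted to the plane with `a = 1`.
  obtain ⟨p, rfl⟩ := (isOpenQuotientMap_toTorus one_pos).surjective x
  obtain ⟨q, rfl⟩ := (isOpenQuotientMap_toTorus one_pos).surjective y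
  rw [← toTorus_add, mFourier_toTorus one_pos, mFourier_toTorus one_pos, mFourier_toTorus one_pos,
    ← Complex.exp_add, inner_add_right]
  push_cast
  ring_nf

theorem norm_mFourier_apply (n : Fin 2 → ℤ) (x : Torus) : ‖UnitAddTorus.mFourier n x‖ = 1 := by
  obtain ⟨p, rfl⟩ := (isOpenQuotientMap_toTorus one_pos).surjective x
  rw [mFourier_toTorus one_pos, mul_comm, Complex.norm_exp_ofReal_mul_I]

/-- The unit vector in the `i`-th coordinate direction. -/
abbrev unitVec (i : Fin 2) : Plane := EuclideanSpace.single i (1 : ℝ)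

theorem laplacian_eq_sum_fderiv {f : Plane → ℂ} (hf : ContDiff ℝ ∞ f) (x : Plane) :
    Laplacian.laplacian f x =
      ∑ i, fderiv ℝ (fun z => fderiv ℝ f z (unitVec i)) x (unitVec i) := by
  rw [InnerProductSpace.laplacian_eq_iteratedFDeriv_orthonormalBasis f
    (EuclideanSpace.basisFun (Fin 2) ℝ)]
  refine Finset.sum_congr rfl fun i _ => ?_
  rw [iteratedFDeriv_two_apply]
  have hd : DifferentiableAt ℝ (fderiv ℝ f) x :=
    ((hf.fderiv_right (m := 1) (by norm_cast)).differentiable (by norm_num)).differentiableAt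
  rw [fderiv_clm_apply hd (differentiableAt_const _)]
  simp

/-- The difference `y - x` is a period of the lifted function, and the derivative of a periodic
function has the same periods. This is what lets derivatives descend to the torus. -/
theorem fderiv_eq_of_toTorus_eq {a : ℝ} {u : Torus → ℂ} {x y : Plane}
    (h : toTorus a x = toTorus a y) :
    fderiv ℝ (fun z => u (toTorus a z)) x = fderiv ℝ (fun z => u (toTorus a z)) y := by
  have h1 : ∀ z, u (toTorus a (z + (y - x))) = u (toTorus a z) := fun z => by
    have h2 : toTorus a y = toTorus a (y - x) + toTorus a x := by
      rw [← toTorus_add, sub_add_cancel]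
    rw [h] at h2
    rw [toTorus_add, left_eq_add.mp (h2.trans (add_comm _ _)), add_zero]
  have h3 : fderiv ℝ (fun z => u (toTorus a (z + (y - x)))) x
      = fderiv ℝ (fun z => u (toTorus a z)) (x + (y - x)) :=
    fderiv_comp_add_right (f := fun z => u (toTorus a z)) (y - x)
  simpa only [h1, add_sub_cancel] using h3

/-- A partial derivative of a smooth function on the torus is a smooth function on the torus. -/
theorem exists_partial {a : ℝ} (ha : 0 < a) {u : Torus → ℂ}
    (hu : ContDiff ℝ ∞ fun x => u (toTorus a x)) (e : Plane) :
    ∃ u' : Torus → ℂ, ContDiff ℝ ∞ (fun x => u' (toTorus a x)) ∧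
      ∀ x, u' (toTorus a x) = fderiv ℝ (fun z => u (toTorus a z)) x e := by
  have hs := (isOpenQuotientMap_toTorus ha).surjective
  refine ⟨fun y => fderiv ℝ (fun z => u (toTorus a z)) (Function.surjInv hs y) e, ?_⟩
  have key : ∀ x, fderiv ℝ (fun z => u (toTorus a z)) (Function.surjInv hs (toTorus a x)) e
      = fderiv ℝ (fun z => u (toTorus a z)) x e := fun x => by
    rw [fderiv_eq_of_toTorus_eq (Function.surjInv_eq hs (toTorus a x))]
  refine ⟨?_, key⟩
  simp only [key]
  exact (hu.fderiv_right (m := ∞) (by norm_cast)).clm_apply contDiff_const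

theorem continuous_of_contDiff_toTorus {a : ℝ} (ha : 0 < a) {u : Torus → ℂ}
    (hu : ContDiff ℝ ∞ fun x => u (toTorus a x)) : Continuous u :=
  (isOpenQuotientMap_toTorus ha).isQuotientMap.continuous_iff.mpr hu.continuous

/-! ### Fourier coefficients of derivatives -/

instance isAddHaarMeasure_torusMeasure : torusMeasure.IsAddHaarMeasure :=
  inferInstanceAs (Measure.pi fun _ : Fin 2 => (AddCircle.haarAddCircle : Measure UnitAddCircle)).IsAddHaarMeasure

theorem mFourierCoeff_eq_integral_mul (f : Torus → ℂ) (n : Fin 2 → ℤ) :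
    UnitAddTorus.mFourierCoeff f n = ∫ y, UnitAddTorus.mFourier (-n) y * f y ∂torusMeasure := rfl

theorem mFourierCoeff_translate (f : Torus → ℂ) (s : Torus) (n : Fin 2 → ℤ) :
    UnitAddTorus.mFourierCoeff (fun y => f (y + s)) n =
      UnitAddTorus.mFourier n s * UnitAddTorus.mFourierCoeff f n := by
  rw [mFourierCoeff_eq_integral_mul, mFourierCoeff_eq_integral_mul, ← integral_const_mul,
    ← integral_add_right_eq_self (fun y => UnitAddTorus.mFourier n s *
      (UnitAddTorus.mFourier (-n) y * f y)) s]
  refine integral_congr_ae (Eventually.of_forall fun y => ?_)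
  have h : UnitAddTorus.mFourier n s * UnitAddTorus.mFourier (-n) s = 1 := by
    rw [← UnitAddTorus.mFourier_add, add_neg_cancel, UnitAddTorus.mFourier_zero]; rfl
  simp only [mFourier_add_apply]
  linear_combination (- UnitAddTorus.mFourier (-n) y * f (y + s)) * h

/-- Translation replaces integration by parts: the coefficient of `u(· + t e)` is `exp(i t ⟨ξ, e⟩)`
times that of `u`, and both sides are differentiated at `t = 0`, the left one under the integral
sign. -/
theorem mFourierCoeff_partial {a : ℝ} (ha : 0 < a) {u u' : Torus → ℂ} {e : Plane}
    (hu : ContDiff ℝ ∞ fun x => u (toTorus a x)) (hu' : ContDiff ℝ ∞ fun x => u' (toTorus a x))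
    (h : ∀ x, u' (toTorus a x) = fderiv ℝ (fun z => u (toTorus a z)) x e) (n : Fin 2 → ℤ) :
    UnitAddTorus.mFourierCoeff u' n =
      Complex.I * (⟪latVec a n, e⟫_ℝ : ℝ) * UnitAddTorus.mFourierCoeff u n := by
  have hc := continuous_of_contDiff_toTorus ha hu
  have hc' := continuous_of_contDiff_toTorus ha hu'
  have hF : ∀ t : ℝ, ∫ y, UnitAddTorus.mFourier (-n) y * u (y + toTorus a (t • e)) ∂torusMeasure
      = Complex.exp (Complex.I * (⟪latVec a n, e⟫_ℝ : ℝ) * t) * UnitAddTorus.mFourierCoeff u n := by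
    intro t
    rw [← mFourierCoeff_eq_integral_mul (fun y => u (y + toTorus a (t • e))),
      mFourierCoeff_translate, mFourier_toTorus ha, inner_smul_right]
    push_cast
    ring_nf
  obtain ⟨B, hB⟩ := (isCompact_range hc').isBounded.exists_norm_le
  have hcont : ∀ {f : Torus → ℂ} (_ : Continuous f) (t : ℝ), Continuous fun y : Torus =>
      UnitAddTorus.mFourier (-n) y * f (y + toTorus a (t • e)) := fun hf t =>
    (UnitAddTorus.mFourier (-n)).continuous.mul (hf.comp (continuous_id.add continuous_const))
  have hint : ∀ {f : Torus → ℂ}, Continuous f → Integrable f torusMeasure := fun hf =>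
    hf.integrable_of_hasCompactSupport (HasCompactSupport.of_compactSpace _)
  have key := hasDerivAt_integral_of_dominated_loc_of_deriv_le (μ := torusMeasure) (x₀ := (0 : ℝ))
    (F := fun t y => UnitAddTorus.mFourier (-n) y * u (y + toTorus a (t • e)))
    (F' := fun t y => UnitAddTorus.mFourier (-n) y * u' (y + toTorus a (t • e)))
    (bound := fun _ => B) (s := Set.univ) univ_mem
    (Eventually.of_forall fun t => (hcont hc t).aestronglyMeasurable)
    (hint (hcont hc 0)) (hcont hc' 0).aestronglyMeasurable
    (Eventually.of_forall fun y t _ => by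
      rw [norm_mul, norm_mFourier_apply, one_mul]
      exact hB _ (Set.mem_range_self _))
    (integrable_const _)
    (Eventually.of_forall fun y t _ => by
      obtain ⟨p, rfl⟩ := (isOpenQuotientMap_toTorus ha).surjective y
      simp only [← toTorus_add, h]
      refine HasDerivAt.const_mul _ ?_
      have h1 := ((hu.differentiable (by norm_num)) (p + t • e)).hasFDerivAt
      have h2 : HasDerivAt (fun t : ℝ => p + t • e) e t := by
        simpa using ((hasDerivAt_id t).smul_const e).const_add p
      exact h1.comp_hasDerivAt t h2)
  have h1 := key.2
  simp only [hF] at h1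
  have h2 : HasDerivAt (fun t : ℝ => Complex.exp (Complex.I * (⟪latVec a n, e⟫_ℝ : ℝ) * t)
      * UnitAddTorus.mFourierCoeff u n)
      (Complex.I * (⟪latVec a n, e⟫_ℝ : ℝ) * UnitAddTorus.mFourierCoeff u n) 0 := by
    have h3 : HasDerivAt (fun t : ℝ => Complex.I * (⟪latVec a n, e⟫_ℝ : ℝ) * (t : ℂ))
      (Complex.I * (⟪latVec a n, e⟫_ℝ : ℝ)) 0 := by
      simpa using (Complex.ofRealCLM.hasDerivAt (x := (0 : ℝ))).const_mul
        (Complex.I * ((⟪latVec a n, e⟫_ℝ : ℝ) : ℂ))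
    simpa using h3.cexp.mul_const (UnitAddTorus.mFourierCoeff u n)
  have h4 := h1.unique h2
  rw [← h4, mFourierCoeff_eq_integral_mul]
  refine integral_congr_ae (Eventually.of_forall fun y => ?_)
  have h0 : toTorus a 0 = 0 := by
    have := toTorus_add a 0 0
    simpa using this
  simp [h0]

theorem mFourierCoeff_neg_laplacian {a : ℝ} (ha : 0 < a) {u v : Torus → ℂ}
    (hu : ContDiff ℝ ∞ fun x => u (toTorus a x))
    (h : ∀ x, v (toTorus a x) = -(Laplacian.laplacian (fun z => u (toTorus a z)) x))
    (n : Fin 2 → ℤ) :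
    UnitAddTorus.mFourierCoeff v n = (‖latVec a n‖ : ℂ) ^ 2 * UnitAddTorus.mFourierCoeff u n := by
  choose u₁ hu₁ hd₁ using fun i => exists_partial ha hu (unitVec i)
  choose u₂ hu₂ hd₂ using fun i => exists_partial ha (hu₁ i) (unitVec i)
  have hv : v = fun y => -(u₂ 0 y + u₂ 1 y) := by
    funext y
    obtain ⟨x, rfl⟩ := (isOpenQuotientMap_toTorus ha).surjective y
    rw [h, laplacian_eq_sum_fderiv hu, Fin.sum_univ_two, hd₂, hd₂]
    simp only [hd₁]
  have hc : ∀ i, Continuous (u₂ i) := fun i => continuous_of_contDiff_toTorus ha (hu₂ i)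
  have hint : ∀ i, Integrable (fun y => UnitAddTorus.mFourier (-n) y * u₂ i y) torusMeasure :=
    fun i => ((UnitAddTorus.mFourier (-n)).continuous.mul (hc i)).integrable_of_hasCompactSupport
      (HasCompactSupport.of_compactSpace _)
  have h1 : UnitAddTorus.mFourierCoeff v n =
      -(UnitAddTorus.mFourierCoeff (u₂ 0) n + UnitAddTorus.mFourierCoeff (u₂ 1) n) := by
    simp only [mFourierCoeff_eq_integral_mul]
    rw [← integral_add (hint 0) (hint 1), ← integral_neg]
    refine integral_congr_ae (Eventually.of_forall fun y => ?_)
    simp only [hv]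
    ring
  rw [h1]
  simp only [fun i => mFourierCoeff_partial ha (hu₁ i) (hu₂ i) (hd₂ i) n,
    fun i => mFourierCoeff_partial ha hu (hu₁ i) (hd₁ i) n]
  have h2 : (‖latVec a n‖ : ℂ) ^ 2 = ((‖latVec a n‖ ^ 2 : ℝ) : ℂ) := by push_cast; rfl
  rw [h2, norm_sq_latVec]
  simp only [EuclideanSpace.inner_single_right, latVec]
  simp
  linear_combination (-(((n 0 : ℂ) * a) ^ 2 + ((n 1 : ℂ) / a) ^ 2)
    * UnitAddTorus.mFourierCoeff u n) * Complex.I_sq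

/-! ### Cutoff functions -/

/-- Reduces second directional derivatives to one-variable calculus along the line `x + t e`, where
the cutoff products are explicit. -/
theorem fderiv_fderiv_eq_of_hasDerivAt {f : Plane → ℂ} (hf : ContDiff ℝ ∞ f) {x e : Plane}
    {g₁ : ℝ → ℂ} {g₂ : ℂ} (h₁ : ∀ t : ℝ, HasDerivAt (fun t : ℝ => f (x + t • e)) (g₁ t) t)
    (h₂ : HasDerivAt g₁ g₂ 0) : fderiv ℝ (fun z => fderiv ℝ f z e) x e = g₂ := by
  have hl : ∀ t : ℝ, HasDerivAt (fun t : ℝ => x + t • e) e t := fun t => by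
    simpa using ((hasDerivAt_id t).smul_const e).const_add x
  have h3 : g₁ = fun t => fderiv ℝ f (x + t • e) e := by
    funext t
    exact (h₁ t).unique
      (((hf.differentiable (by norm_num)) (x + t • e)).hasFDerivAt.comp_hasDerivAt t (hl t))
  have h4 : ContDiff ℝ ∞ fun z => fderiv ℝ f z e :=
    (hf.fderiv_right (m := ∞) (by norm_cast)).clm_apply contDiff_const
  have h5 := ((h4.differentiable (by norm_num)) (x + (0 : ℝ) • e)).hasFDerivAt.comp_hasDerivAt 0 (hl 0)
  rw [h3] at h₂
  have h6 := h5.unique h₂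
  simpa using h6

/-- A smooth transition from `0` on `(-∞, 1)` to `1` on `(2, ∞)`, with its two derivatives. -/
theorem exists_smooth_step : ∃ (H H₁ H₂ : ℝ → ℝ) (B : ℝ), ContDiff ℝ ∞ H ∧
    (∀ s, HasDerivAt H (H₁ s) s) ∧ (∀ s, HasDerivAt H₁ (H₂ s) s) ∧
    (∀ s < 1, H s = 0) ∧ (∀ s, 2 < s → H s = 1 ∧ H₁ s = 0 ∧ H₂ s = 0) ∧
    ∀ s, |H s| ≤ B ∧ |H₁ s| ≤ B ∧ |H₂ s| ≤ B := by
  set H : ℝ → ℝ := fun s => Real.smoothTransition (s - 1) with hH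
  have hsm : ContDiff ℝ ∞ H := Real.smoothTransition.contDiff.comp (contDiff_id.sub contDiff_const)
  have hd : ∀ {f : ℝ → ℝ}, ContDiff ℝ ∞ f → ContDiff ℝ ∞ (deriv f) := fun hf =>
    (contDiff_infty_iff_deriv.mp hf).2
  have hda : ∀ {f : ℝ → ℝ}, ContDiff ℝ ∞ f → ∀ s, HasDerivAt f (deriv f s) s := fun hf s =>
    ((hf.differentiable (by norm_num)) s).hasDerivAt
  have hz : ∀ {f : ℝ → ℝ} {c : ℝ}, (∀ s < 1, f s = c) → ∀ s < 1, deriv f s = 0 := by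
    intro f c h s hs
    have : f =ᶠ[𝓝 s] fun _ => c := by
      filter_upwards [Iio_mem_nhds hs] with t ht using h t ht
    rw [this.deriv_eq]; simp
  have ho : ∀ {f : ℝ → ℝ} {c : ℝ}, (∀ s, 2 < s → f s = c) → ∀ s, 2 < s → deriv f s = 0 := by
    intro f c h s hs
    have : f =ᶠ[𝓝 s] fun _ => c := by
      filter_upwards [Ioi_mem_nhds hs] with t ht using h t ht
    rw [this.deriv_eq]; simp
  have hb : ∀ {f : ℝ → ℝ}, Continuous f → (∀ s < 1, f s = 0) → (∀ s, 2 < s → f s = 0) →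
      ∃ B, ∀ s, |f s| ≤ B := by
    intro f hf h1 h2
    obtain ⟨B, hB⟩ := (isCompact_Icc (a := (1 : ℝ)) (b := 2)).exists_bound_of_continuousOn
      hf.continuousOn
    refine ⟨max B 0, fun s => ?_⟩
    by_cases hs : s ∈ Set.Icc (1 : ℝ) 2
    · exact (hB s hs).trans (le_max_left _ _)
    · have : f s = 0 := by
        by_cases h : s < 1
        · exact h1 s h
        · exact h2 s (by by_contra h'; exact hs ⟨not_lt.mp h, not_lt.mp h'⟩)
      simp [this]
  have h0 : ∀ s < 1, H s = 0 := fun s hs =>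
    Real.smoothTransition.zero_of_nonpos (by linarith)
  have h1 : ∀ s, 2 < s → H s = 1 := fun s hs =>
    Real.smoothTransition.one_of_one_le (by linarith)
  obtain ⟨B₁, hB₁⟩ := hb (hd hsm).continuous (hz h0) (ho h1)
  obtain ⟨B₂, hB₂⟩ := hb (hd (hd hsm)).continuous (hz (hz h0)) (ho (ho h1))
  refine ⟨H, deriv H, deriv (deriv H), max 1 (max B₁ B₂), hsm, hda hsm, hda (hd hsm), h0,
    fun s hs => ⟨h1 s hs, ho h1 s hs, ho (ho h1) s hs⟩, fun s => ⟨?_, ?_, ?_⟩⟩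
  · rw [abs_of_nonneg (Real.smoothTransition.nonneg _)]
    exact (Real.smoothTransition.le_one _).trans (le_max_left _ _)
  · exact (hB₁ s).trans ((le_max_left _ _).trans (le_max_right _ _))
  · exact (hB₂ s).trans ((le_max_right _ _).trans (le_max_right _ _))

theorem hasDerivAt_mul_comp {A A₁ : ℝ → ℂ} {W W₁ h h₁ : ℝ → ℝ} {t : ℝ}
    (hA : HasDerivAt A (A₁ t) t) (hW : HasDerivAt W (W₁ t) t)
    (hh : HasDerivAt h (h₁ (W t)) (W t)) :
    HasDerivAt (fun t => A t * (h (W t) : ℂ)) (A₁ t * (h (W t) : ℂ)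
      + A t * ((h₁ (W t) * W₁ t : ℝ) : ℂ)) t :=
  hA.mul (hh.comp t hW).ofReal_comp

theorem hasDerivAt_mul_comp_two {A A₁ : ℝ → ℂ} {A₂ : ℂ} {W W₁ h h₁ h₂ : ℝ → ℝ} {W₂ t : ℝ}
    (hA : HasDerivAt A (A₁ t) t) (hA₁ : HasDerivAt A₁ A₂ t)
    (hW : HasDerivAt W (W₁ t) t) (hW₁ : HasDerivAt W₁ W₂ t)
    (hh : HasDerivAt h (h₁ (W t)) (W t)) (hh₁ : HasDerivAt h₁ (h₂ (W t)) (W t)) :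
    HasDerivAt (fun t => A₁ t * (h (W t) : ℂ) + A t * ((h₁ (W t) * W₁ t : ℝ) : ℂ))
      (A₂ * h (W t) + 2 * (A₁ t * (h₁ (W t) * W₁ t : ℝ))
        + A t * (h₂ (W t) * W₁ t ^ 2 + h₁ (W t) * W₂ : ℝ)) t := by
  have h3 := (hA₁.mul (hh.comp t hW).ofReal_comp).add
    (hA.mul ((hh₁.comp t hW).mul hW₁).ofReal_comp)
  refine h3.congr_deriv ?_
  simp only [Function.comp, Pi.mul_apply]
  push_cast
  ring

/-! ### A trigonometric distance function -/

/-- A smooth function on the torus that is comparable to the square of the distance to `x₀`. -/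
def sqDist (x₀ : Torus) (y : Torus) : ℝ :=
  ∑ j : Fin 2, (1 - (UnitAddTorus.mFourier (Pi.single j 1) (y - x₀)).re)

theorem continuous_sqDist (x₀ : Torus) : Continuous (sqDist x₀) := by
  unfold sqDist
  refine continuous_finsetSum _ fun j _ => continuous_const.sub (Complex.continuous_re.comp ?_)
  exact (UnitAddTorus.mFourier _).continuous.comp (continuous_id.sub continuous_const)

theorem toTorus_sub (a : ℝ) (x y : Plane) : toTorus a (x - y) = toTorus a x - toTorus a y := by
  rw [eq_sub_iff_add_eq, ← toTorus_add, sub_add_cancel]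

theorem mFourier_toTorus_re {a : ℝ} (ha : 0 < a) (n : Fin 2 → ℤ) (x : Plane) :
    (UnitAddTorus.mFourier n (toTorus a x)).re = Real.cos ⟪latVec a n, x⟫_ℝ := by
  rw [mFourier_toTorus ha, mul_comm, Complex.exp_ofReal_mul_I_re]

theorem sqDist_toTorus {a : ℝ} (ha : 0 < a) (p x : Plane) :
    sqDist (toTorus a p) (toTorus a x) =
      ∑ j : Fin 2, (1 - Real.cos ⟪latVec a (Pi.single j 1), x - p⟫_ℝ) := by
  simp only [sqDist, ← toTorus_sub, mFourier_toTorus_re ha]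

theorem sqDist_self (x₀ : Torus) : sqDist x₀ x₀ = 0 := by
  obtain ⟨p, rfl⟩ := (isOpenQuotientMap_toTorus one_pos).surjective x₀
  simp [sqDist_toTorus one_pos]

/-- Turns `sqDist` into squared chord lengths on the unit circle, for which the triangle inequality
is available. -/
theorem norm_exp_sub_one_sq (t : ℝ) :
    ‖Complex.exp (Complex.I * t) - 1‖ ^ 2 = 2 * (1 - Real.cos t) := by
  rw [mul_comm, ← Complex.normSq_eq_norm_sq, Complex.normSq_apply]
  simp only [Complex.sub_re, Complex.exp_ofReal_mul_I_re, Complex.one_re, Complex.sub_im,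
    Complex.exp_ofReal_mul_I_im, Complex.one_im]
  nlinarith [Real.sin_sq_add_cos_sq t]

theorem norm_exp_nat_mul_sub_one_le (t : ℝ) (m : ℕ) :
    ‖Complex.exp (Complex.I * (m * t : ℝ)) - 1‖ ≤ m * ‖Complex.exp (Complex.I * t) - 1‖ := by
  induction m with
  | zero => simp
  | succ m ih =>
    have h1 : Complex.exp (Complex.I * ((m + 1 : ℕ) * t : ℝ)) - 1 =
        Complex.exp (Complex.I * (m * t : ℝ)) * (Complex.exp (Complex.I * t) - 1)
          + (Complex.exp (Complex.I * (m * t : ℝ)) - 1) := by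
      rw [mul_sub, ← Complex.exp_add]
      push_cast
      ring_nf
    have h2 : ‖Complex.exp (Complex.I * (m * t : ℝ))‖ = 1 := by
      rw [mul_comm, Complex.norm_exp_ofReal_mul_I]
    rw [h1]
    refine (norm_add_le _ _).trans ?_
    rw [norm_mul, h2, Nat.cast_succ]
    linarith

theorem norm_exp_int_mul_sub_one_le (t : ℝ) (m : ℤ) :
    ‖Complex.exp (Complex.I * (m * t : ℝ)) - 1‖ ≤ |(m : ℝ)| * ‖Complex.exp (Complex.I * t) - 1‖ := by
  have key : ∀ s : ℝ, ‖Complex.exp (Complex.I * (-s : ℝ)) - 1‖ = ‖Complex.exp (Complex.I * s) - 1‖ := by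
    intro s
    have h1 := norm_exp_sub_one_sq s
    have h2 := norm_exp_sub_one_sq (-s)
    rw [Real.cos_neg, ← h1] at h2
    exact (sq_eq_sq₀ (norm_nonneg _) (norm_nonneg _)).mp h2
  obtain ⟨k, rfl | rfl⟩ := m.eq_nat_or_neg
  · simpa using norm_exp_nat_mul_sub_one_le t k
  · have := norm_exp_nat_mul_sub_one_le t k
    rw [← key] at this
    simpa using this

theorem inner_latVec_eq_sum (a : ℝ) (n : Fin 2 → ℤ) (x : Plane) :
    ⟪latVec a n, x⟫_ℝ = ∑ j, (n j : ℝ) * ⟪latVec a (Pi.single j 1), x⟫_ℝ := by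
  simp [latVec, PiLp.inner_apply, Fin.sum_univ_two]
  ring

/-- Characters are Lipschitz for the distance `√(sqDist x₀ y)`: each coordinate contributes `|n j|`
times a chord `√(2 (1 - cos s_j))`, bounded by `2 √(sqDist x₀ y)`. The vanishing to first order at
`x₀` is what saves a factor `√k` in the cutoff estimate. -/
theorem norm_mFourier_sub_le (x₀ y : Torus) (n : Fin 2 → ℤ) :
    ‖UnitAddTorus.mFourier n y - UnitAddTorus.mFourier n x₀‖ ≤
      2 * (∑ j, |(n j : ℝ)|) * √(sqDist x₀ y) := by
  obtain ⟨p, rfl⟩ := (isOpenQuotientMap_toTorus one_pos).surjective x₀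
  obtain ⟨x, rfl⟩ := (isOpenQuotientMap_toTorus one_pos).surjective y
  set s : Fin 2 → ℝ := fun j => ⟪latVec 1 (Pi.single j 1), x - p⟫_ℝ with hs
  have h1 : UnitAddTorus.mFourier n (toTorus 1 x) - UnitAddTorus.mFourier n (toTorus 1 p) =
      UnitAddTorus.mFourier n (toTorus 1 p) *
        (Complex.exp (Complex.I * (n 0 * s 0 + n 1 * s 1 : ℝ)) - 1) := by
    have : toTorus 1 x = toTorus 1 p + toTorus 1 (x - p) := by
      rw [← toTorus_add, add_sub_cancel]
    rw [this, mFourier_add_apply, mFourier_toTorus one_pos n (x - p), inner_latVec_eq_sum,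
      Fin.sum_univ_two, mul_sub, mul_one]
  have h2 : Complex.exp (Complex.I * (n 0 * s 0 + n 1 * s 1 : ℝ)) - 1 =
      Complex.exp (Complex.I * (n 0 * s 0 : ℝ)) * (Complex.exp (Complex.I * (n 1 * s 1 : ℝ)) - 1)
        + (Complex.exp (Complex.I * (n 0 * s 0 : ℝ)) - 1) := by
    rw [mul_sub, ← Complex.exp_add]
    push_cast
    ring_nf
  have h3 : ‖Complex.exp (Complex.I * (n 0 * s 0 : ℝ))‖ = 1 := by
    rw [mul_comm, Complex.norm_exp_ofReal_mul_I]
  have h0 : sqDist (toTorus 1 p) (toTorus 1 x) = (1 - Real.cos (s 0)) + (1 - Real.cos (s 1)) := by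
    rw [sqDist_toTorus one_pos, Fin.sum_univ_two]
  generalize sqDist (toTorus 1 p) (toTorus 1 x) = d at h0 ⊢
  have h4 : ∀ j, ‖Complex.exp (Complex.I * s j) - 1‖ ≤ 2 * √d := by
    intro j
    have h5 : 1 - Real.cos (s j) ≤ d := by
      have c0 := Real.cos_le_one (s 0)
      have c1 := Real.cos_le_one (s 1)
      rw [h0]
      obtain rfl | rfl : j = 0 ∨ j = 1 := by omega
      · linarith
      · linarith
    have h6 := norm_exp_sub_one_sq (s j)
    have h7 : (0 : ℝ) ≤ 1 - Real.cos (s j) := sub_nonneg.mpr (Real.cos_le_one _)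
    refine (abs_le_of_sq_le_sq' ?_ (by positivity)).2
    rw [h6, mul_pow, Real.sq_sqrt (h7.trans h5)]
    linarith
  rw [h1, norm_mul, norm_mFourier_apply, one_mul, h2]
  refine (norm_add_le _ _).trans ?_
  rw [norm_mul, h3, one_mul, Fin.sum_univ_two]
  have h8 := norm_exp_int_mul_sub_one_le (s 0) (n 0)
  have h9 := norm_exp_int_mul_sub_one_le (s 1) (n 1)
  have h10 := mul_le_mul_of_nonneg_left (h4 0) (abs_nonneg (n 0 : ℝ))
  have h11 := mul_le_mul_of_nonneg_left (h4 1) (abs_nonneg (n 1 : ℝ))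
  linarith

/-- With the representative `r` in `[-1/2, 1/2]`, this is `cos x ≤ 1 - (2 / π²) x²` on `[-π, π]` at
`x = 2π r`. -/
theorem norm_sq_le_one_sub_fourier_re (t : UnitAddCircle) :
    8 * ‖t‖ ^ 2 ≤ 1 - (fourier 1 t : ℂ).re := by
  obtain ⟨s, rfl⟩ := QuotientAddGroup.mk_surjective t
  set r : ℝ := s - round s with hr
  have h1 : ((s : ℝ) : UnitAddCircle) = ((r : ℝ) : UnitAddCircle) := by
    rw [hr, AddCircle.coe_sub, ← sub_eq_zero]
    simp
  have h2 : |r| ≤ 1 / 2 := abs_sub_round s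
  have h3 : ‖((s : ℝ) : UnitAddCircle)‖ = |r| := by
    rw [AddCircle.norm_eq]; simp [hr]
  change 8 * ‖((s : ℝ) : UnitAddCircle)‖ ^ 2 ≤ 1 - (fourier 1 ((s : ℝ) : UnitAddCircle) : ℂ).re
  rw [h3, h1, fourier_coe_apply]
  have h4 : (2 * Real.pi * Complex.I * (1 : ℤ) * r / (1 : ℝ) : ℂ) = ((2 * Real.pi * r : ℝ) : ℂ) * Complex.I := by
    push_cast; ring
  rw [h4, Complex.exp_ofReal_mul_I_re]
  have hpi := Real.pi_pos
  have h5 := Real.cos_le_one_sub_mul_cos_sq (x := 2 * Real.pi * r) (by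
    rw [abs_mul, abs_of_pos (by positivity : (0 : ℝ) < 2 * Real.pi)]
    nlinarith)
  have h6 : 2 / Real.pi ^ 2 * (2 * Real.pi * r) ^ 2 = 8 * r ^ 2 := by
    field_simp; ring
  rw [sq_abs]
  linarith

/-- The sublevel set lies in a sup-norm ball of radius `√ε`, a product of two arcs of length at most
`2 √ε`. The linear dependence on `ε` reflects dimension two and balances the growth `(√k)²` of the
squared Laplacians of the cutoffs. -/
theorem measure_sqDist_le (x₀ : Torus) {ε : ℝ} (hε : 0 ≤ ε) :
    torusMeasure.real {y | sqDist x₀ y ≤ ε} ≤ 4 * ε := by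
  have hsub : {y | sqDist x₀ y ≤ ε} ⊆ Metric.closedBall x₀ (√ε) := by
    intro y hy
    rw [Metric.mem_closedBall, dist_pi_le_iff (Real.sqrt_nonneg _)]
    intro j
    rw [dist_eq_norm]
    refine Real.le_sqrt_of_sq_le ?_
    have h1 : ∀ i, 8 * ‖y i - x₀ i‖ ^ 2 ≤
        1 - (UnitAddTorus.mFourier (Pi.single i 1) (y - x₀)).re := by
      intro i
      have : UnitAddTorus.mFourier (Pi.single i 1) (y - x₀) = fourier 1 ((y - x₀) i) :=
        UnitAddTorus.mFourier_single _ _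
      rw [this]
      exact norm_sq_le_one_sub_fourier_re _
    have h2 : 1 - (UnitAddTorus.mFourier (Pi.single j 1) (y - x₀)).re ≤ sqDist x₀ y :=
      Finset.single_le_sum (f := fun j => 1 - (UnitAddTorus.mFourier (Pi.single j 1) (y - x₀)).re)
        (fun i _ => le_trans (by positivity) (h1 i)) (Finset.mem_univ j)
    have h3 : sqDist x₀ y ≤ ε := hy
    nlinarith [h1 j, sq_nonneg ‖y j - x₀ j‖]
  have hvol : (AddCircle.haarAddCircle : Measure UnitAddCircle) = volume := by
    rw [AddCircle.volume_eq_smul_haarAddCircle]; simp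
  have h1 : torusMeasure (Metric.closedBall x₀ (√ε)) ≤ ENNReal.ofReal (4 * ε) := by
    rw [Measure.pi_closedBall _ _ (Real.sqrt_nonneg _), Fin.prod_univ_two, hvol,
      AddCircle.volume_closedBall, AddCircle.volume_closedBall]
    refine (mul_le_mul' (ENNReal.ofReal_le_ofReal (min_le_right _ _))
      (ENNReal.ofReal_le_ofReal (min_le_right _ _))).trans ?_
    rw [← ENNReal.ofReal_mul (by positivity)]
    refine ENNReal.ofReal_le_ofReal (le_of_eq ?_)
    have := Real.mul_self_sqrt hε
    linear_combination 4 * this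
  refine (measureReal_mono hsub).trans ?_
  exact ENNReal.toReal_le_of_le_ofReal (by positivity) h1

/-- Here `A` is the monomial minus its value at `x₀`, `W` the function `sqDist` along a line, and
`h` the cutoff at scale `k`. Where `k W ≤ 2`, both `A` and `W₁` are `O(√W)`, so the terms with `h₁`
and `h₂` are `O(k √W)` and `O(k² W ^ (3/2))`, hence `O(√k)`. Without the vanishing of `A` they would
only be `O(k)`. Where `k W > 2` only `A₂` survives. -/
theorem norm_cutoff_second_deriv_le {A A₁ A₂ : ℂ} {W W₁ W₂ h h₁ h₂ k K α M B : ℝ}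
    (hk : 0 ≤ k) (hW : 0 ≤ W) (hα : 0 ≤ α) (hM : 0 ≤ M) (hK : 0 ≤ K) (hB : 0 ≤ B)
    (hA : ‖A‖ ≤ K * √W) (hA₁ : ‖A₁‖ ≤ α) (hA₂ : ‖A₂‖ ≤ α ^ 2) (hW₁ : |W₁| ≤ M * √W)
    (hW₂ : |W₂| ≤ M) (hh : |h| ≤ B) (hh₁ : |h₁| ≤ k * B) (hh₂ : |h₂| ≤ k ^ 2 * B)
    (hfar : 2 < k * W → h = 1 ∧ h₁ = 0 ∧ h₂ = 0) :
    ‖A₂ * h + 2 * (A₁ * (h₁ * W₁ : ℝ)) + A * (h₂ * W₁ ^ 2 + h₁ * W₂ : ℝ)‖ ≤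
      (α ^ 2 * (B + 1) + 4 * α * B * M + 8 * K * B * M ^ 2 + 2 * K * B * M) *
        (1 + if k * W ≤ 2 then √k else 0) := by
  set C := α ^ 2 * (B + 1) + 4 * α * B * M + 8 * K * B * M ^ 2 + 2 * K * B * M with hC
  have hC0 : 0 ≤ C := by positivity
  split_ifs with hkW
  · set r := √W with hr
    set q := √k with hq
    have hr0 : 0 ≤ r := Real.sqrt_nonneg _
    have hq0 : 0 ≤ q := Real.sqrt_nonneg _
    have hr2 : W = r ^ 2 := (Real.sq_sqrt hW).symm
    have hq2 : k = q ^ 2 := (Real.sq_sqrt hk).symm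
    -- From `(q r)² = k W ≤ 2`; the cruder bound `2` avoids square roots in the constants.
    have hqr : q * r ≤ 2 := by
      rw [hr2, hq2] at hkW
      nlinarith [mul_nonneg hq0 hr0]
    have hqr0 : 0 ≤ q * r := mul_nonneg hq0 hr0
    have t1 : ‖A₂ * h‖ ≤ α ^ 2 * B := by
      rw [norm_mul, Complex.norm_real, Real.norm_eq_abs]; gcongr
    have t2 : ‖2 * (A₁ * (h₁ * W₁ : ℝ))‖ ≤ 2 * (α * (k * B * (M * r))) := by
      rw [norm_mul, norm_mul, Complex.norm_real, Real.norm_eq_abs, abs_mul, Complex.norm_ofNat]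
      gcongr
    have t3 : ‖A * (h₂ * W₁ ^ 2 + h₁ * W₂ : ℝ)‖ ≤
        K * r * (k ^ 2 * B * (M * r) ^ 2 + k * B * M) := by
      rw [norm_mul, Complex.norm_real, Real.norm_eq_abs]
      gcongr
      refine (abs_add_le _ _).trans ?_
      rw [abs_mul, abs_mul, abs_pow]
      gcongr
    have s2 : 2 * (α * (k * B * (M * r))) ≤ 4 * α * B * M * q := by
      have : 2 * (α * (k * B * (M * r))) = 2 * α * B * M * q * (q * r) := by rw [hq2]; ring
      rw [this]
      calc _ ≤ 2 * α * B * M * q * 2 := by gcongr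
        _ = _ := by ring
    have s3 : K * r * (k ^ 2 * B * (M * r) ^ 2 + k * B * M) ≤
        (8 * K * B * M ^ 2 + 2 * K * B * M) * q := by
      have : K * r * (k ^ 2 * B * (M * r) ^ 2 + k * B * M) =
          K * B * M ^ 2 * q * (q * r) ^ 3 + K * B * M * q * (q * r) := by rw [hq2]; ring
      rw [this]
      calc _ ≤ K * B * M ^ 2 * q * 2 ^ 3 + K * B * M * q * 2 := by gcongr
        _ = _ := by ring
    have s4 : α ^ 2 * B ≤ α ^ 2 * (B + 1) := by nlinarith [sq_nonneg α]
    have s5 : α ^ 2 * (B + 1) ≤ C := by rw [hC]; linarith [show 0 ≤ 4 * α * B * M + 8 * K * B * M ^ 2 + 2 * K * B * M by positivity]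
    have s6 : 0 ≤ α ^ 2 * (B + 1) * q := by positivity
    calc _ ≤ α ^ 2 * B + 2 * (α * (k * B * (M * r)))
          + K * r * (k ^ 2 * B * (M * r) ^ 2 + k * B * M) :=
        (norm_add_le _ _).trans (add_le_add ((norm_add_le _ _).trans (add_le_add t1 t2)) t3)
      _ ≤ C + (4 * α * B * M * q + (8 * K * B * M ^ 2 + 2 * K * B * M) * q) := by linarith
      _ ≤ C * (1 + q) := by rw [mul_add, mul_one]; nth_rewrite 3 [hC]; linarith
  · obtain ⟨e1, e2, e3⟩ := hfar (not_le.mp hkW)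
    rw [e1, e2, e3]
    simp only [Complex.ofReal_one, mul_one, zero_mul, Complex.ofReal_zero, mul_zero, add_zero]
    refine hA₂.trans ?_
    rw [hC]
    have : 0 ≤ α ^ 2 * B + 4 * α * B * M + 8 * K * B * M ^ 2 + 2 * K * B * M := by positivity
    linarith

theorem hasDerivAt_inner_line (ξ x p e : Plane) (t : ℝ) :
    HasDerivAt (fun t : ℝ => ⟪ξ, x + t • e - p⟫_ℝ) ⟪ξ, e⟫_ℝ t := by
  have h : (fun t : ℝ => ⟪ξ, x + t • e - p⟫_ℝ) = fun t => ⟪ξ, x - p⟫_ℝ + t * ⟪ξ, e⟫_ℝ := by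
    funext t
    rw [add_sub_right_comm, inner_add_right, inner_smul_right]
  rw [h]
  simpa using ((hasDerivAt_id t).mul_const ⟪ξ, e⟫_ℝ).const_add ⟪ξ, x - p⟫_ℝ

theorem abs_sin_le_sqrt {s d : ℝ} (h : 1 - Real.cos s ≤ d) : |Real.sin s| ≤ 2 * √d := by
  have h1 : 0 ≤ 1 - Real.cos s := sub_nonneg.mpr (Real.cos_le_one _)
  refine abs_le_of_sq_le_sq ?_ (by positivity)
  rw [mul_pow, Real.sq_sqrt (h1.trans h)]
  nlinarith [Real.sin_sq_add_cos_sq s, Real.cos_le_one s, Real.neg_one_le_cos s]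

/-- The product of the function `mFourier n - mFourier n x₀` with a cutoff at scale `k ^ (-1/2)`
around `x₀`. -/
def cutoffMonomial (H : ℝ → ℝ) (x₀ : Torus) (n : Fin 2 → ℤ) (k : ℝ) (y : Torus) : ℂ :=
  (UnitAddTorus.mFourier n y - UnitAddTorus.mFourier n x₀) * (H (k * sqDist x₀ y) : ℂ)

theorem contDiff_mFourier_toTorus {a : ℝ} (ha : 0 < a) (n : Fin 2 → ℤ) :
    ContDiff ℝ ∞ fun x => UnitAddTorus.mFourier n (toTorus a x) := by
  simp only [mFourier_toTorus ha]
  have h : ContDiff ℝ ∞ fun x : Plane => (⟪latVec a n, x⟫_ℝ : ℝ) := contDiff_const.inner ℝ contDiff_id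
  exact Complex.contDiff_exp.comp (contDiff_const.mul (Complex.ofRealCLM.contDiff.comp h))

theorem contDiff_sqDist_toTorus {a : ℝ} (ha : 0 < a) (p : Plane) :
    ContDiff ℝ ∞ fun x => sqDist (toTorus a p) (toTorus a x) := by
  simp only [sqDist_toTorus ha]
  refine ContDiff.sum fun j _ => contDiff_const.sub (Real.contDiff_cos.comp ?_)
  exact contDiff_const.inner ℝ (contDiff_id.sub contDiff_const)

theorem contDiff_cutoffMonomial {a : ℝ} (ha : 0 < a) {H : ℝ → ℝ} (hH : ContDiff ℝ ∞ H)
    (x₀ : Torus) (n : Fin 2 → ℤ) (k : ℝ) :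
    ContDiff ℝ ∞ fun x => cutoffMonomial H x₀ n k (toTorus a x) := by
  obtain ⟨p, rfl⟩ := (isOpenQuotientMap_toTorus ha).surjective x₀
  exact ((contDiff_mFourier_toTorus ha n).sub contDiff_const).mul (Complex.ofRealCLM.contDiff.comp
    (hH.comp (contDiff_const.mul (contDiff_sqDist_toTorus ha p))))

theorem exists_bound_second_deriv_cutoffMonomial {a : ℝ} (ha : 0 < a) {H H₁ H₂ : ℝ → ℝ} {B : ℝ}
    (hH : ContDiff ℝ ∞ H) (hd₁ : ∀ s, HasDerivAt H (H₁ s) s) (hd₂ : ∀ s, HasDerivAt H₁ (H₂ s) s)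
    (hfar : ∀ s, 2 < s → H s = 1 ∧ H₁ s = 0 ∧ H₂ s = 0)
    (hB : ∀ s, |H s| ≤ B ∧ |H₁ s| ≤ B ∧ |H₂ s| ≤ B) (x₀ : Torus) (n : Fin 2 → ℤ) (e : Plane) :
    ∃ C : ℝ, 0 ≤ C ∧ ∀ k : ℝ, 0 ≤ k → ∀ x : Plane,
      ‖fderiv ℝ (fun z => fderiv ℝ (fun x => cutoffMonomial H x₀ n k (toTorus a x)) z e) x e‖ ≤
        C * (1 + if k * sqDist x₀ (toTorus a x) ≤ 2 then √k else 0) := by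
  obtain ⟨p, rfl⟩ := (isOpenQuotientMap_toTorus ha).surjective x₀
  have hB0 : 0 ≤ B := (abs_nonneg _).trans (hB 0).1
  set b : Fin 2 → ℝ := fun j => ⟪latVec a (Pi.single j 1), e⟫_ℝ with hb
  -- One constant serves two bounds: the first sum controls `|W₁| / √W`, the second controls `|W₂|`.
  set M : ℝ := 2 * ∑ j, |b j| + ∑ j, b j ^ 2 with hM
  set K : ℝ := 2 * ∑ j, |(n j : ℝ)| with hK
  set α : ℝ := |⟪latVec a n, e⟫_ℝ| with hα
  have hM0 : 0 ≤ M := add_nonneg (mul_nonneg two_pos.le (Finset.sum_nonneg fun _ _ => abs_nonneg _))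
    (Finset.sum_nonneg fun _ _ => sq_nonneg _)
  have hK0 : 0 ≤ K := mul_nonneg two_pos.le (Finset.sum_nonneg fun _ _ => abs_nonneg _)
  have hα0 : 0 ≤ α := abs_nonneg _
  clear_value M K α
  refine ⟨α ^ 2 * (B + 1) + 4 * α * B * M + 8 * K * B * M ^ 2 + 2 * K * B * M, by positivity, ?_⟩
  intro k hk x
  set s : Fin 2 → ℝ → ℝ := fun j t => ⟪latVec a (Pi.single j 1), x + t • e - p⟫_ℝ with hs
  have hsd : ∀ j t, HasDerivAt (s j) (b j) t := fun j t => hasDerivAt_inner_line _ _ _ _ t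
  have hWd : ∀ t, HasDerivAt (fun t => ∑ j, (1 - Real.cos (s j t)))
      (∑ j, Real.sin (s j t) * b j) t := by
    intro t
    refine HasDerivAt.fun_sum fun j _ => ?_
    simpa using (hsd j t).cos.const_sub 1
  have hWd₁ : HasDerivAt (fun t => ∑ j, Real.sin (s j t) * b j)
      (∑ j, Real.cos (s j 0) * b j * b j) 0 :=
    HasDerivAt.fun_sum fun j _ => ((hsd j 0).sin).mul_const (b j)
  set m : ℝ → ℂ := fun t => UnitAddTorus.mFourier n (toTorus a (x + t • e)) with hm
  have hmd : ∀ t, HasDerivAt m (m t * (Complex.I * (⟪latVec a n, e⟫_ℝ : ℝ))) t := by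
    intro t
    simp only [hm, mFourier_toTorus ha]
    have h1 := (hasDerivAt_inner_line (latVec a n) x 0 e t).ofReal_comp.const_mul Complex.I
    simp only [sub_zero] at h1
    exact h1.cexp
  have hhd : ∀ r, HasDerivAt (fun r => H (k * r)) (k * H₁ (k * r)) r := by
    intro r
    have := (hd₁ (k * r)).comp r ((hasDerivAt_id r).const_mul k)
    refine this.congr_deriv ?_
    ring
  have hhd₁ : ∀ r, HasDerivAt (fun r => k * H₁ (k * r)) (k ^ 2 * H₂ (k * r)) r := by
    intro r
    have := ((hd₂ (k * r)).comp r ((hasDerivAt_id r).const_mul k)).const_mul k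
    refine this.congr_deriv ?_
    ring
  set c : ℂ := UnitAddTorus.mFourier n (toTorus a p) with hc
  set W : ℝ → ℝ := fun t => ∑ j, (1 - Real.cos (s j t)) with hW
  set W₁ : ℝ → ℝ := fun t => ∑ j, Real.sin (s j t) * b j with hW₁
  set m₁ : ℝ → ℂ := fun t => m t * (Complex.I * (⟪latVec a n, e⟫_ℝ : ℝ)) with hm₁
  have heq : (fun t : ℝ => cutoffMonomial H (toTorus a p) n k (toTorus a (x + t • e))) =
      fun t => (m t - c) * (H (k * W t) : ℂ) := by
    funext t
    rw [cutoffMonomial, sqDist_toTorus ha]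
  have hg₁ : ∀ t, HasDerivAt (fun t => (m t - c) * (H (k * W t) : ℂ))
      (m₁ t * (H (k * W t) : ℂ) + (m t - c) * ((k * H₁ (k * W t) * W₁ t : ℝ) : ℂ)) t := fun t =>
    hasDerivAt_mul_comp (A := fun t => m t - c) (A₁ := m₁) (W := W) (W₁ := W₁)
      (h := fun r => H (k * r)) (h₁ := fun r => k * H₁ (k * r))
      ((hmd t).sub_const _) (hWd t) (hhd _)
  have hg₂ := hasDerivAt_mul_comp_two (A := fun t => m t - c) (A₁ := m₁) (W := W) (W₁ := W₁)
    (h := fun r => H (k * r)) (h₁ := fun r => k * H₁ (k * r)) (h₂ := fun r => k ^ 2 * H₂ (k * r))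
    ((hmd 0).sub_const _) ((hmd 0).mul_const _) (hWd 0) hWd₁ (hhd _) (hhd₁ _)
  rw [fderiv_fderiv_eq_of_hasDerivAt (contDiff_cutoffMonomial ha hH (toTorus a p) n k)
    (fun t => by rw [heq]; exact hg₁ t) hg₂]
  have hW0 : W 0 = sqDist (toTorus a p) (toTorus a x) := by
    simp only [sqDist_toTorus ha, hW, hs, zero_smul, add_zero]
  have hm0 : m 0 = UnitAddTorus.mFourier n (toTorus a x) := by simp [hm]
  have hWj : ∀ j, 1 - Real.cos (s j 0) ≤ sqDist (toTorus a p) (toTorus a x) := by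
    intro j
    have c0 := Real.cos_le_one (s 0 0)
    have c1 := Real.cos_le_one (s 1 0)
    rw [← hW0, hW]
    simp only [Fin.sum_univ_two]
    obtain rfl | rfl : j = 0 ∨ j = 1 := by omega
    · linarith
    · linarith
  rw [hW0]
  have hnm : ∀ t, ‖m t‖ = 1 := fun t => norm_mFourier_apply _ _
  refine norm_cutoff_second_deriv_le hk
    ((sub_nonneg.mpr (Real.cos_le_one _)).trans (hWj 0)) hα0 hM0 hK0 hB0 ?_ ?_ ?_ ?_ ?_ (hB _).1 ?_ ?_ ?_
  · rw [hm0, hK]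
    exact norm_mFourier_sub_le _ _ _
  · rw [norm_mul, hnm, norm_mul, Complex.norm_I, Complex.norm_real, one_mul, one_mul, hα]; rfl
  · rw [norm_mul, norm_mul, hnm, norm_mul, Complex.norm_I, Complex.norm_real, one_mul, one_mul, sq, hα]
    rfl
  · refine (Finset.abs_sum_le_sum_abs _ _).trans ?_
    have h1 : ∀ j, |Real.sin (s j 0) * b j| ≤ 2 * √(sqDist (toTorus a p) (toTorus a x)) * |b j| := by
      intro j
      rw [abs_mul]
      gcongr
      exact abs_sin_le_sqrt (hWj j)
    refine (Finset.sum_le_sum fun j _ => h1 j).trans ?_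
    rw [← Finset.mul_sum, hM]
    have h2 : 0 ≤ (∑ j, b j ^ 2) * √(sqDist (toTorus a p) (toTorus a x)) :=
      mul_nonneg (Finset.sum_nonneg fun _ _ => sq_nonneg _) (Real.sqrt_nonneg _)
    linarith
  · refine (Finset.abs_sum_le_sum_abs _ _).trans ?_
    have h1 : ∀ j, |Real.cos (s j 0) * b j * b j| ≤ b j ^ 2 := by
      intro j
      rw [mul_assoc, ← sq, abs_mul, abs_of_nonneg (sq_nonneg (b j))]
      exact mul_le_of_le_one_left (sq_nonneg _) (Real.abs_cos_le_one _)
    refine (Finset.sum_le_sum fun j _ => h1 j).trans ?_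
    rw [hM]
    have h2 : 0 ≤ 2 * ∑ j, |b j| := mul_nonneg two_pos.le (Finset.sum_nonneg fun _ _ => abs_nonneg _)
    linarith
  · rw [abs_mul, abs_of_nonneg hk]
    exact mul_le_mul_of_nonneg_left (hB _).2.1 hk
  · rw [abs_mul, abs_of_nonneg (sq_nonneg k)]
    exact mul_le_mul_of_nonneg_left (hB _).2.2 (sq_nonneg k)
  · intro h
    obtain ⟨e1, e2, e3⟩ := hfar _ h
    refine ⟨e1, ?_, ?_⟩
    · simp only [e2, mul_zero]
    · simp only [e3, mul_zero]

/-! ### The closure of the restricted Laplacian -/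

/-- The class in `L²` of a continuous function on the torus. -/
abbrev toL2 : C(Torus, ℂ) →L[ℂ] L2 := ContinuousMap.toLp 2 torusMeasure ℂ

theorem coe_mFourierBasis_eq (n : Fin 2 → ℤ) :
    (UnitAddTorus.mFourierBasis (d := Fin 2) n : L2) = toL2 (UnitAddTorus.mFourier n) := by
  rw [UnitAddTorus.coe_mFourierBasis]
  rfl

theorem repr_eq_mFourierCoeff_of_ae {f : L2} {u : Torus → ℂ} (h : f =ᵐ[torusMeasure] u)
    (n : Fin 2 → ℤ) :
    UnitAddTorus.mFourierBasis.repr f n = UnitAddTorus.mFourierCoeff u n := by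
  rw [UnitAddTorus.mFourierBasis_repr]
  refine integral_congr_ae ?_
  filter_upwards [h] with y hy
  rw [hy]

theorem repr_toL2 (u : C(Torus, ℂ)) (n : Fin 2 → ℤ) :
    UnitAddTorus.mFourierBasis.repr (toL2 u) n = UnitAddTorus.mFourierCoeff u n :=
  repr_eq_mFourierCoeff_of_ae (ContinuousMap.coeFn_toLp torusMeasure u) n

theorem norm_toL2_sq (u : C(Torus, ℂ)) : ‖toL2 u‖ ^ 2 = ∫ y, ‖u y‖ ^ 2 ∂torusMeasure := by
  have h := inner_self_eq_norm_sq_to_K (𝕜 := ℂ) (toL2 u)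
  rw [ContinuousMap.inner_toLp] at h
  have h1 : ∀ y, u y * (starRingEnd ℂ) (u y) = ((‖u y‖ ^ 2 : ℝ) : ℂ) := fun y => by
    rw [RCLike.mul_conj]; norm_cast
  simp only [h1, integral_complex_ofReal] at h
  have h2 : ((∫ y, ‖u y‖ ^ 2 ∂torusMeasure : ℝ) : ℂ) = ((‖toL2 u‖ ^ 2 : ℝ) : ℂ) := by
    rw [h]; norm_cast
  exact (Complex.ofReal_injective h2).symm

theorem exists_neg_laplacian {a : ℝ} (ha : 0 < a) {u : Torus → ℂ}
    (hu : ContDiff ℝ ∞ fun x => u (toTorus a x)) :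
    ∃ v : C(Torus, ℂ), ∀ x, v (toTorus a x) =
      -(Laplacian.laplacian (fun z => u (toTorus a z)) x) := by
  choose u₁ hu₁ hd₁ using fun i => exists_partial ha hu (unitVec i)
  choose u₂ hu₂ hd₂ using fun i => exists_partial ha (hu₁ i) (unitVec i)
  refine ⟨⟨fun y => -(u₂ 0 y + u₂ 1 y), ((continuous_of_contDiff_toTorus ha (hu₂ 0)).add
    (continuous_of_contDiff_toTorus ha (hu₂ 1))).neg⟩, fun x => ?_⟩
  rw [laplacian_eq_sum_fderiv hu, Fin.sum_univ_two]
  simp only [ContinuousMap.coe_mk, hd₂]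
  simp only [hd₁]

/-- The restricted Laplacian as a linear subspace of `L² × L²`. -/
def restrictedLaplacianSubmodule {a : ℝ} (x₀ : Torus) : Submodule ℂ (L2 × L2) where
  carrier := restrictedLaplacianGraph a x₀
  zero_mem' := by
    refine ⟨0, 0, contDiff_const, Eventually.of_forall fun _ => rfl, fun x => ?_, ?_, ?_⟩
    · have h : (fun z : Plane => (0 : Torus → ℂ) (toTorus a z)) = fun _ => 0 := rfl
      rw [h, InnerProductSpace.laplacian_const]; simp
    · exact Lp.coeFn_zero _ _ _
    · exact Lp.coeFn_zero _ _ _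
  add_mem' := by
    rintro p q ⟨u, v, hu, h0, hv, h1, h2⟩ ⟨u', v', hu', h0', hv', h1', h2'⟩
    refine ⟨u + u', v + v', hu.add hu', ?_, fun x => ?_, ?_, ?_⟩
    · filter_upwards [h0, h0'] with y hy hy'
      simp [hy, hy']
    · have h := ContDiffAt.laplacian_add ((hu.of_le (m := 2) (by norm_cast)).contDiffAt (x := x))
        ((hu'.of_le (m := 2) (by norm_cast)).contDiffAt (x := x))
      have h3 : (fun z : Plane => (u + u') (toTorus a z)) =
        (fun z => u (toTorus a z)) + fun z => u' (toTorus a z) := rfl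
      rw [h3, h, Pi.add_apply, hv, hv']
      ring
    · exact (Lp.coeFn_add _ _).trans (h1.add h1')
    · exact (Lp.coeFn_add _ _).trans (h2.add h2')
  smul_mem' := by
    rintro c p ⟨u, v, hu, h0, hv, h1, h2⟩
    refine ⟨c • u, c • v, contDiff_const.smul hu, ?_, fun x => ?_, ?_, ?_⟩
    · filter_upwards [h0] with y hy
      simp [hy]
    · have h := InnerProductSpace.laplacian_smul c
        ((hu.of_le (m := 2) (by norm_cast)).contDiffAt (x := x))
      have h3 : (fun z : Plane => (c • u) (toTorus a z)) = c • fun z => u (toTorus a z) := rfl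
      rw [h3, h, Pi.smul_apply, hv]
      simp
    · exact (Lp.coeFn_smul _ _).trans (h1.const_smul c)
    · exact (Lp.coeFn_smul _ _).trans (h2.const_smul c)

theorem hasSum_inner_green {a : ℝ} (ha : 0 < a) (x₀ : Torus) (z : ℂ) (f : L2) :
    HasSum (fun n => (starRingEnd ℂ) (greenCoeff a x₀ z n) * UnitAddTorus.mFourierBasis.repr f n)
      ⟪green ha x₀ z, f⟫_ℂ := by
  have h := lp.hasSum_inner (𝕜 := ℂ) (UnitAddTorus.mFourierBasis.repr (green ha x₀ z))
    (UnitAddTorus.mFourierBasis.repr f)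
  rw [LinearIsometryEquiv.inner_map_map] at h
  refine h.congr_fun fun n => ?_
  rw [green, LinearIsometryEquiv.apply_symm_apply, RCLike.inner_apply, mul_comm]

theorem repr_green {a : ℝ} (ha : 0 < a) (x₀ : Torus) (z : ℂ) (n : Fin 2 → ℤ) :
    UnitAddTorus.mFourierBasis.repr (green ha x₀ z) n = greenCoeff a x₀ z n := by
  rw [green, LinearIsometryEquiv.apply_symm_apply]

/-- For a function in `H²` with Laplacian in `L²`, the Fourier series at `x₀` converges. -/
theorem hasSum_eval {a : ℝ} (ha : 0 < a) (x₀ : Torus) {p : L2 × L2}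
    (hp : ∀ n, UnitAddTorus.mFourierBasis.repr p.2 n =
      (‖latVec a n‖ : ℂ) ^ 2 * UnitAddTorus.mFourierBasis.repr p.1 n) :
    HasSum (fun n => UnitAddTorus.mFourierBasis.repr p.1 n * UnitAddTorus.mFourier n x₀)
      (-(4 * (Real.pi : ℂ) ^ 2) * ⟪green ha x₀ (-1), p.1 + p.2⟫_ℂ) := by
  -- The coefficients of `p.1 + p.2` carry a factor `|ξ|² + 1` that cancels the denominator of
  -- `G_{-1}`. Evaluation at `x₀` thus becomes a bounded functional on the graph.
  refine ((hasSum_inner_green ha x₀ (-1) (p.1 + p.2)).mul_left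
    (-(4 * (Real.pi : ℂ) ^ 2))).congr_fun fun n => ?_
  have h1 : ((‖latVec a n‖ : ℂ) ^ 2 + 1) ≠ 0 := by
    have : (0 : ℝ) < ‖latVec a n‖ ^ 2 + 1 := by positivity
    exact_mod_cast this.ne'
  have hpi : (Real.pi : ℂ) ≠ 0 := by exact_mod_cast Real.pi_ne_zero
  have hc : (starRingEnd ℂ) (greenCoeff a x₀ (-1) n) =
      -(1 / (4 * (Real.pi : ℂ) ^ 2)) * UnitAddTorus.mFourier n x₀ / ((‖latVec a n‖ : ℂ) ^ 2 + 1) := by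
    have h4 : (starRingEnd ℂ) 4 = 4 := map_ofNat _ 4
    simp [greenCoeff, UnitAddTorus.mFourier_neg, h4]
  rw [hc, map_add, lp.coeFn_add, Pi.add_apply, hp]
  field_simp
  ring

/-- The pairs `(g, -Δ g)` with `g ∈ H²` and `g(x₀) = 0`, in terms of Fourier coefficients. -/
def pointGraph {a : ℝ} (ha : 0 < a) (x₀ : Torus) : Set (L2 × L2) :=
  {p | (∀ n, UnitAddTorus.mFourierBasis.repr p.2 n =
      (‖latVec a n‖ : ℂ) ^ 2 * UnitAddTorus.mFourierBasis.repr p.1 n) ∧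
    ⟪green ha x₀ (-1), p.1 + p.2⟫_ℂ = 0}

theorem continuous_repr_apply (n : Fin 2 → ℤ) :
    Continuous fun f : L2 => UnitAddTorus.mFourierBasis.repr f n := by
  simp only [HilbertBasis.repr_apply_apply]
  exact continuous_const.inner continuous_id

/-- Both conditions are equalities between continuous functionals on `L² × L²`; this is the reason
for expressing `g(x₀) = 0` as a pairing with `G_{-1}`. -/
theorem isClosed_pointGraph {a : ℝ} (ha : 0 < a) (x₀ : Torus) : IsClosed (pointGraph ha x₀) := by
  refine IsClosed.inter ?_ ?_
  · have h : {p : L2 × L2 | ∀ n, UnitAddTorus.mFourierBasis.repr p.2 n =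
        (‖latVec a n‖ : ℂ) ^ 2 * UnitAddTorus.mFourierBasis.repr p.1 n} =
        ⋂ n, {p : L2 × L2 | UnitAddTorus.mFourierBasis.repr p.2 n =
          (‖latVec a n‖ : ℂ) ^ 2 * UnitAddTorus.mFourierBasis.repr p.1 n} := by
      ext p; simp
    change IsClosed {p : L2 × L2 | ∀ n, UnitAddTorus.mFourierBasis.repr p.2 n =
        (‖latVec a n‖ : ℂ) ^ 2 * UnitAddTorus.mFourierBasis.repr p.1 n}
    rw [h]
    exact isClosed_iInter fun n => isClosed_eq ((continuous_repr_apply n).comp continuous_snd)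
      (continuous_const.mul ((continuous_repr_apply n).comp continuous_fst))
  · exact isClosed_eq (continuous_const.inner (continuous_fst.add continuous_snd)) continuous_const

/-- The series for the value at `x₀` converges, hence absolutely since it is a sum of complex
numbers; the characters have modulus one, so the Fourier coefficients are summable and the series
really sums to `u x₀ = 0`. -/
theorem restrictedLaplacianGraph_subset {a : ℝ} (ha : 0 < a) (x₀ : Torus) :
    restrictedLaplacianGraph a x₀ ⊆ pointGraph ha x₀ := by
  rintro p ⟨u, v, hu, h0, hv, h1, h2⟩
  have hrel : ∀ n, UnitAddTorus.mFourierBasis.repr p.2 n =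
      (‖latVec a n‖ : ℂ) ^ 2 * UnitAddTorus.mFourierBasis.repr p.1 n := fun n => by
    rw [repr_eq_mFourierCoeff_of_ae h1, repr_eq_mFourierCoeff_of_ae h2,
      mFourierCoeff_neg_laplacian ha hu hv n]
  refine ⟨hrel, ?_⟩
  have hsum := hasSum_eval ha x₀ hrel
  simp only [fun n => repr_eq_mFourierCoeff_of_ae h1 n] at hsum
  set U : C(Torus, ℂ) := ⟨u, continuous_of_contDiff_toTorus ha hu⟩
  have hs : Summable (UnitAddTorus.mFourierCoeff U) := by
    have := hsum.summable.norm
    simp only [norm_mul, norm_mFourier_apply, mul_one] at this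
    exact this.of_norm
  have h3 := UnitAddTorus.hasSum_mFourier_series_apply_of_summable hs x₀
  have h4 := hsum.unique h3
  have h5 : U x₀ = 0 := h0.self_of_nhds
  rw [h5] at h4
  have hpi : (4 * (Real.pi : ℂ) ^ 2) ≠ 0 := by
    have : (Real.pi : ℂ) ≠ 0 := by exact_mod_cast Real.pi_ne_zero
    simp [this]
  simpa [hpi] using h4

/-- In a Hilbert space, a bounded sequence whose coefficients in a Hilbert basis converge,
converges weakly. -/
theorem tendsto_inner_of_tendsto_basis {ι E : Type*} [NormedAddCommGroup E]
    [InnerProductSpace ℂ E] (b : HilbertBasis ι ℂ E) {v : ℕ → E} {w : E} {B : ℝ}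
    (hB : ∀ k, ‖v k‖ ≤ B) (h : ∀ i, Tendsto (fun k => ⟪b i, v k⟫_ℂ) atTop (𝓝 ⟪b i, w⟫_ℂ)) (y : E) :
    Tendsto (fun k => ⟪y, v k⟫_ℂ) atTop (𝓝 ⟪y, w⟫_ℂ) := by
  have hd : y ∈ closure (Submodule.span ℂ (Set.range b) : Set E) := by
    have := b.dense_span
    rw [← Submodule.topologicalClosure_coe, this]; trivial
  have hspan : ∀ z ∈ Submodule.span ℂ (Set.range b),
      Tendsto (fun k => ⟪z, v k⟫_ℂ) atTop (𝓝 ⟪z, w⟫_ℂ) := by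
    intro z hz
    induction hz using Submodule.span_induction with
    | mem x hx => obtain ⟨i, rfl⟩ := hx; exact h i
    | zero => simp
    | add x y _ _ hx hy => simpa only [inner_add_left] using hx.add hy
    | smul c x _ hx => simpa only [inner_smul_left] using hx.const_mul _
  rw [Metric.tendsto_atTop]
  intro ε hε
  have hB0 : 0 ≤ B := (norm_nonneg _).trans (hB 0)
  set D := B + ‖w‖ + 1 with hD
  have hD0 : 0 < D := by positivity
  obtain ⟨z, hz, hyz⟩ := Metric.mem_closure_iff.mp hd (ε / (2 * D)) (by positivity)
  obtain ⟨N, hN⟩ := Metric.tendsto_atTop.mp (hspan z hz) (ε / 2) (by positivity)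
  refine ⟨N, fun k hk => ?_⟩
  have h1 := hN k hk
  rw [dist_eq_norm, ← inner_sub_right] at h1 ⊢
  rw [dist_eq_norm] at hyz
  have h2 : ⟪y, v k - w⟫_ℂ = ⟪y - z, v k - w⟫_ℂ + ⟪z, v k - w⟫_ℂ := by
    rw [← inner_add_left, sub_add_cancel]
  have h3 : ‖⟪y - z, v k - w⟫_ℂ‖ ≤ ε / (2 * D) * D := by
    refine (norm_inner_le_norm _ _).trans ?_
    gcongr
    exact (norm_sub_le _ _).trans (by linarith [hB k])
  have h4 : ε / (2 * D) * D = ε / 2 := by field_simp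
  rw [h2]
  refine (norm_add_le _ _).trans_lt ?_
  linarith

/-- A point that is a limit of a sequence of a subspace of a product of Hilbert spaces, strongly in
the first and weakly in the second component, is in the closure of the subspace. -/
theorem mem_closure_of_tendsto_weak {E : Type*} [NormedAddCommGroup E]
    [InnerProductSpace ℂ E] [CompleteSpace E] (S : Submodule ℂ (E × E)) {u v : ℕ → E} {f g : E}
    (hS : ∀ k, (u k, v k) ∈ S) (hu : Tendsto u atTop (𝓝 f))
    (hv : ∀ y, Tendsto (fun k => ⟪y, v k⟫_ℂ) atTop (𝓝 ⟪y, g⟫_ℂ)) :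
    (f, g) ∈ closure (S : Set (E × E)) := by
  by_contra hfg
  rw [← Submodule.topologicalClosure_coe] at hfg
  -- A separating functional acts on the second component as an inner product, so weak convergence
  -- there is enough to pass to the limit in the strict separation and contradict it.
  obtain ⟨l, c, hl, hc⟩ := RCLike.geometric_hahn_banach_closed_point (𝕜 := ℂ)
    (S.topologicalClosure.restrictScalars ℝ).convex S.isClosed_topologicalClosure hfg
  have h1 : Tendsto (fun k => l (u k, v k)) atTop (𝓝 (l (f, g))) := by
    have hsplit : ∀ x y, l (x, y) = l.comp (ContinuousLinearMap.inl ℂ E E) x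
        + ⟪(InnerProductSpace.toDual ℂ E).symm (l.comp (ContinuousLinearMap.inr ℂ E E)), y⟫_ℂ := by
      intro x y
      rw [InnerProductSpace.toDual_symm_apply]
      simp [← map_add]
    simp only [hsplit]
    exact (((l.comp (ContinuousLinearMap.inl ℂ E E)).continuous.tendsto f).comp hu).add (hv _)
  have h2 : RCLike.re (l (f, g)) ≤ c :=
    le_of_tendsto ((RCLike.continuous_re.tendsto _).comp h1)
      (Eventually.of_forall fun k => (hl _ (S.le_topologicalClosure (hS k))).le)
  exact absurd hc h2.not_gt

/-- The functions `mFourier n - mFourier n x₀` are in the domain of the closure of the restricted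
Laplacian. -/
theorem monomial_mem_closure {a : ℝ} (ha : 0 < a) (x₀ : Torus) (n : Fin 2 → ℤ) :
    (toL2 (UnitAddTorus.mFourier n) - UnitAddTorus.mFourier n x₀ • toL2 (UnitAddTorus.mFourier 0),
      (‖latVec a n‖ : ℂ) ^ 2 • toL2 (UnitAddTorus.mFourier n)) ∈
      closure (restrictedLaplacianGraph a x₀) := by
  obtain ⟨H, H₁, H₂, B, hH, hd₁, hd₂, hnear, hfar, hB⟩ := exists_smooth_step
  have hB0 : 0 ≤ B := (abs_nonneg _).trans (hB 0).1
  choose C hC0 hC using fun i => exists_bound_second_deriv_cutoffMonomial ha hH hd₁ hd₂ hfar hB x₀ n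
    (unitVec i)
  set u : ℕ → C(Torus, ℂ) := fun k => ⟨cutoffMonomial H x₀ n k,
    continuous_of_contDiff_toTorus ha (contDiff_cutoffMonomial ha hH x₀ n k)⟩ with hu
  choose v hv using fun k : ℕ => exists_neg_laplacian ha (contDiff_cutoffMonomial ha hH x₀ n k)
  set P : C(Torus, ℂ) := UnitAddTorus.mFourier n
    - UnitAddTorus.mFourier n x₀ • UnitAddTorus.mFourier 0 with hP
  have hPy : ∀ y, P y = UnitAddTorus.mFourier n y - UnitAddTorus.mFourier n x₀ := fun y => by
    simp [hP, UnitAddTorus.mFourier_zero]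
  set K : ℝ := 2 * ∑ j, |(n j : ℝ)| with hK
  have hK0 : 0 ≤ K := mul_nonneg two_pos.le (Finset.sum_nonneg fun _ _ => abs_nonneg _)
  have hmem : ∀ k : ℕ, 1 ≤ k → (toL2 (u k), toL2 (v k)) ∈ restrictedLaplacianGraph a x₀ := by
    intro k hk
    have hk' : (0 : ℝ) < k := by exact_mod_cast hk
    refine ⟨u k, v k, contDiff_cutoffMonomial ha hH x₀ n k, ?_, hv k,
      ContinuousMap.coeFn_toLp torusMeasure _, ContinuousMap.coeFn_toLp torusMeasure _⟩
    have h1 : ∀ᶠ y in 𝓝 x₀, k * sqDist x₀ y < 1 := by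
      refine (continuous_const.mul (continuous_sqDist x₀)).tendsto x₀ |>.eventually_lt_const ?_
      simp [sqDist_self]
    filter_upwards [h1] with y hy
    simp [hu, cutoffMonomial, hnear _ hy]
  -- The cutoff differs from `1` only where `sqDist ≤ 2 / k`, and there the monomial differs from
  -- its value at `x₀` by `O(k ^ (-1/2))`; convergence is therefore uniform.
  have hclose : ∀ k : ℕ, 1 ≤ k → ‖u k - P‖ ≤ K * √2 * (B + 1) / √k := by
    intro k hk
    have hk' : (0 : ℝ) < k := by exact_mod_cast hk
    refine (ContinuousMap.norm_le _ (by positivity)).mpr fun y => ?_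
    have h1 : (u k - P) y = (UnitAddTorus.mFourier n y - UnitAddTorus.mFourier n x₀) *
        ((H (k * sqDist x₀ y) - 1 : ℝ) : ℂ) := by
      rw [ContinuousMap.sub_apply, hPy]
      simp only [hu, ContinuousMap.coe_mk, cutoffMonomial]
      push_cast
      ring
    rw [h1, norm_mul, Complex.norm_real, Real.norm_eq_abs]
    by_cases hky : 2 < k * sqDist x₀ y
    · rw [(hfar _ hky).1, sub_self, abs_zero, mul_zero]
      positivity
    · have h2 : √(sqDist x₀ y) ≤ √2 / √k := by
        rw [← Real.sqrt_div two_pos.le]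
        refine Real.sqrt_le_sqrt ?_
        rw [le_div_iff₀ hk']
        linarith
      have h3 : |H (k * sqDist x₀ y) - 1| ≤ B + 1 := by
        refine (abs_sub _ _).trans ?_
        simpa using (hB (k * sqDist x₀ y)).1
      calc _ ≤ K * √(sqDist x₀ y) * (B + 1) := by
            gcongr
            exact norm_mFourier_sub_le x₀ y n
        _ ≤ K * (√2 / √k) * (B + 1) := by gcongr
        _ = _ := by ring
  have hlim : Tendsto (fun k : ℕ => u (k + 1)) atTop (𝓝 P) := by
    rw [tendsto_iff_norm_sub_tendsto_zero]
    have h1 : Tendsto (fun k : ℕ => K * √2 * (B + 1) / √((k + 1 : ℕ) : ℝ)) atTop (𝓝 0) := by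
      refine Tendsto.const_div_atTop ?_ _
      exact Real.tendsto_sqrt_atTop.comp
        (tendsto_natCast_atTop_atTop.comp (tendsto_add_atTop_nat 1))
    exact squeeze_zero (fun _ => norm_nonneg _) (fun k => hclose (k + 1) (by omega)) h1
  set D : ℝ := ∑ i, C i with hD
  have hD0 : 0 ≤ D := Finset.sum_nonneg fun i _ => hC0 i
  have hvb : ∀ (k : ℕ) y, ‖v k y‖ ≤ D * (1 + if k * sqDist x₀ y ≤ 2 then √k else 0) := by
    intro k y
    obtain ⟨x, rfl⟩ := (isOpenQuotientMap_toTorus ha).surjective y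
    rw [hv, norm_neg, laplacian_eq_sum_fderiv (contDiff_cutoffMonomial ha hH x₀ n k), hD,
      Finset.sum_mul]
    exact (norm_sum_le _ _).trans (Finset.sum_le_sum fun i _ => hC i k (Nat.cast_nonneg k) x)
  -- The pointwise bound squared is at most `2 D²`, plus `2 D² k` on a set of measure at most `4 ·
  -- (2 / k)`: in total `2 D² + 16 D²`.
  have hvn : ∀ k : ℕ, 1 ≤ k → ‖toL2 (v k)‖ ≤ √(18 * D ^ 2) := by
    intro k hk
    have hk' : (0 : ℝ) < k := by exact_mod_cast hk
    refine Real.le_sqrt_of_sq_le ?_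
    rw [norm_toL2_sq]
    set S : Set Torus := {y | sqDist x₀ y ≤ 2 / k} with hS
    have hSm : MeasurableSet S :=
      (isClosed_le (continuous_sqDist x₀) continuous_const).measurableSet
    have hpt : ∀ y, ‖v k y‖ ^ 2 ≤ 2 * D ^ 2 + S.indicator (fun _ => 2 * D ^ 2 * k) y := by
      intro y
      have h1 := hvb k y
      have h2 : ‖v k y‖ ^ 2 ≤ (D * (1 + if k * sqDist x₀ y ≤ 2 then √k else 0)) ^ 2 :=
        pow_le_pow_left₀ (norm_nonneg _) h1 2
      refine h2.trans ?_
      by_cases hy : k * sqDist x₀ y ≤ 2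
      · have hyS : y ∈ S := by
          change sqDist x₀ y ≤ 2 / k
          rw [le_div_iff₀ hk']; linarith
        rw [if_pos hy, Set.indicator_of_mem hyS]
        have h3 : √(k : ℝ) ^ 2 = k := Real.sq_sqrt hk'.le
        rw [mul_pow]
        nlinarith [mul_nonneg (sq_nonneg D) (sq_nonneg (1 - √(k : ℝ)))]
      · have hyS : y ∉ S := fun h => hy (by
          have h' : sqDist x₀ y ≤ 2 / k := h
          rw [le_div_iff₀ hk'] at h'; linarith)
        rw [if_neg hy, Set.indicator_of_notMem hyS]
        nlinarith [sq_nonneg D]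
    have hint : Integrable (fun y => 2 * D ^ 2 + S.indicator (fun _ => 2 * D ^ 2 * (k : ℝ)) y)
        torusMeasure := (integrable_const _).add ((integrable_const _).indicator hSm)
    have hint' : Integrable (fun y => ‖v k y‖ ^ 2) torusMeasure :=
      ((v k).continuous.norm.pow 2).integrable_of_hasCompactSupport
        (HasCompactSupport.of_compactSpace _)
    refine (integral_mono hint' hint hpt).trans ?_
    rw [integral_add (integrable_const _) ((integrable_const _).indicator hSm),
      integral_indicator_const _ hSm]
    have hm := measure_sqDist_le x₀ (ε := 2 / k) (by positivity)
    have h5 : torusMeasure.real S • (2 * D ^ 2 * (k : ℝ)) ≤ 4 * (2 / k) * (2 * D ^ 2 * k) := by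
      rw [smul_eq_mul]
      gcongr
    have h6 : 4 * (2 / (k : ℝ)) * (2 * D ^ 2 * k) = 16 * D ^ 2 := by field_simp; ring
    have h7 : ∫ _ : Torus, 2 * D ^ 2 ∂torusMeasure = 2 * D ^ 2 := by simp
    linarith
  have hL2 : Tendsto (fun k : ℕ => toL2 (u (k + 1))) atTop (𝓝 (toL2 P)) :=
    (toL2.continuous.tendsto P).comp hlim
  -- The `L²` norms are bounded, so it suffices to test on characters, where `-Δ` is multiplication
  -- by `|ξ|²` and convergence is inherited from `u`. The subtracted constant has frequency zero and
  -- does not contribute.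
  have hw : ∀ y, Tendsto (fun k : ℕ => ⟪y, toL2 (v (k + 1))⟫_ℂ) atTop
      (𝓝 ⟪y, (‖latVec a n‖ : ℂ) ^ 2 • toL2 (UnitAddTorus.mFourier n)⟫_ℂ) := by
    refine tendsto_inner_of_tendsto_basis (UnitAddTorus.mFourierBasis (d := Fin 2))
      (fun k => hvn (k + 1) (by omega)) fun m => ?_
    have h1 : ∀ k, ⟪(UnitAddTorus.mFourierBasis m : L2), toL2 (v (k + 1))⟫_ℂ =
        (‖latVec a m‖ : ℂ) ^ 2 * ⟪(UnitAddTorus.mFourierBasis m : L2), toL2 (u (k + 1))⟫_ℂ := by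
      intro k
      rw [← HilbertBasis.repr_apply_apply, ← HilbertBasis.repr_apply_apply, repr_toL2, repr_toL2]
      exact mFourierCoeff_neg_laplacian ha (contDiff_cutoffMonomial ha hH x₀ n _) (hv (k + 1)) m
    have h2 : ⟪(UnitAddTorus.mFourierBasis m : L2),
        (‖latVec a n‖ : ℂ) ^ 2 • toL2 (UnitAddTorus.mFourier n)⟫_ℂ =
        (‖latVec a m‖ : ℂ) ^ 2 * ⟪(UnitAddTorus.mFourierBasis m : L2), toL2 P⟫_ℂ := by
      have ho := orthonormal_iff_ite.mp (UnitAddTorus.mFourierBasis (d := Fin 2)).orthonormal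
      have h0 : latVec a 0 = 0 := by ext i; fin_cases i <;> simp [latVec]
      rw [hP, map_sub, map_smul, inner_sub_right, inner_smul_right, inner_smul_right,
        ← coe_mFourierBasis_eq, ← coe_mFourierBasis_eq, ho, ho]
      by_cases hmn : m = n
      · subst hmn
        by_cases hm0 : m = 0
        · subst hm0; simp [h0]
        · simp [hm0]
      · by_cases hm0 : m = 0
        · subst hm0; simp [hmn, h0]
        · simp [hmn, hm0]
    simp only [h1, h2]
    exact ((continuous_const.inner continuous_id).tendsto _ |>.comp hL2).const_mul _
  have := mem_closure_of_tendsto_weak (restrictedLaplacianSubmodule (a := a) x₀)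
    (fun k => hmem (k + 1) (by omega)) hL2 hw
  rw [hP, map_sub, map_smul] at this
  exact this

/-- Since `∑ ĝ(n) e_n(x₀) = 0`, that multiple of the constant function can be subtracted from the
Fourier series: `g = ∑ ĝ(n) (e_n - e_n(x₀))`. The terms lie in the closure by
`monomial_mem_closure`, and the series of Laplacians converges along with it. -/
theorem closure_restrictedLaplacianGraph {a : ℝ} (ha : 0 < a) (x₀ : Torus) :
    closure (restrictedLaplacianGraph a x₀) = pointGraph ha x₀ := by
  refine Set.Subset.antisymm
    (closure_minimal (restrictedLaplacianGraph_subset ha x₀) (isClosed_pointGraph ha x₀)) ?_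
  rintro ⟨g, h⟩ ⟨hrel, h0⟩
  have hs := hasSum_eval ha x₀ (p := (g, h)) hrel
  rw [h0, mul_zero] at hs
  have h1 := UnitAddTorus.mFourierBasis.hasSum_repr g
  have h2 := UnitAddTorus.mFourierBasis.hasSum_repr h
  simp only [coe_mFourierBasis_eq] at h1 h2
  have h3 := h1.sub (hs.smul_const (toL2 (UnitAddTorus.mFourier 0)))
  rw [zero_smul, sub_zero] at h3
  have h4 := h3.prodMk h2
  have hcl : IsClosed ((restrictedLaplacianSubmodule (a := a) x₀).topologicalClosure :
    Set (L2 × L2)) := Submodule.isClosed_topologicalClosure _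
  refine hcl.mem_of_tendsto h4 (Eventually.of_forall fun s => ?_)
  refine Submodule.sum_mem _ fun n _ => ?_
  have h5 := Submodule.smul_mem (restrictedLaplacianSubmodule (a := a) x₀).topologicalClosure
    (UnitAddTorus.mFourierBasis.repr g n) (x := (toL2 (UnitAddTorus.mFourier n)
      - UnitAddTorus.mFourier n x₀ • toL2 (UnitAddTorus.mFourier 0),
      (‖latVec a n‖ : ℂ) ^ 2 • toL2 (UnitAddTorus.mFourier n))) (monomial_mem_closure ha x₀ n)
  convert h5 using 1
  rw [Prod.smul_mk, smul_sub, smul_smul, smul_smul, hrel, mul_comm ((‖latVec a n‖ : ℂ) ^ 2)]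

/-! ### The spectral equation -/

/-- Parseval for two Green's functions. Single resolvent sums `∑ 1 / (N - z)` diverge
logarithmically in dimension two; only differences, which are such products, can be summed. -/
theorem summable_resolvent_mul {a : ℝ} (ha : 0 < a) (z w : ℂ) :
    Summable fun n : Fin 2 → ℤ =>
      1 / ((‖latVec a n‖ : ℂ) ^ 2 - z) * (1 / ((‖latVec a n‖ : ℂ) ^ 2 - w)) := by
  have h := (hasSum_inner_green ha 0 ((starRingEnd ℂ) z) (green ha 0 w)).summable
  have hpi : (Real.pi : ℂ) ≠ 0 := by exact_mod_cast Real.pi_ne_zero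
  refine (h.mul_left ((4 * (Real.pi : ℂ) ^ 2) ^ 2)).congr fun n => ?_
  have h4 : (starRingEnd ℂ) 4 = 4 := map_ofNat _ 4
  have hm : UnitAddTorus.mFourier n (0 : Torus) * UnitAddTorus.mFourier (-n) (0 : Torus) = 1 := by
    rw [← UnitAddTorus.mFourier_add, add_neg_cancel, UnitAddTorus.mFourier_zero]; rfl
  rw [repr_green]
  have hc : (starRingEnd ℂ) (greenCoeff a 0 ((starRingEnd ℂ) z) n) = -(1 / (4 * (Real.pi : ℂ) ^ 2))
      * UnitAddTorus.mFourier n (0 : Torus) * (1 / ((‖latVec a n‖ : ℂ) ^ 2 - z)) := by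
    simp [greenCoeff, UnitAddTorus.mFourier_neg, h4, div_eq_mul_inv]
  rw [hc, greenCoeff]
  calc _ = (UnitAddTorus.mFourier n (0 : Torus) * UnitAddTorus.mFourier (-n) (0 : Torus)) *
      (1 / ((‖latVec a n‖ : ℂ) ^ 2 - z) * (1 / ((‖latVec a n‖ : ℂ) ^ 2 - w))) := by
        field_simp
    _ = _ := by rw [hm, one_mul]

/-- The terms of the spectral function `∑ (1 / (N - λ) - N / (N² + 1))`, `N = |ξ|²`. -/
def spectralTerm (a lam : ℝ) (n : Fin 2 → ℤ) : ℝ :=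
  1 / (‖latVec a n‖ ^ 2 - lam) - ‖latVec a n‖ ^ 2 / ((‖latVec a n‖ ^ 2) ^ 2 + 1)

/-- The spectral function `∑ (1 / (N - λ) - N / (N² + 1))`. -/
def spectralFun (a lam : ℝ) : ℝ := ∑' n, spectralTerm a lam n

/-- The right-hand side of the spectral equation. -/
def spectralConst (a φ : ℝ) : ℝ := Real.tan (φ / 2) * ∑' n, 1 / ((‖latVec a n‖ ^ 2) ^ 2 + 1)

theorem ofReal_sub_I_ne_zero (x : ℝ) : (x : ℂ) - Complex.I ≠ 0 := fun h => by
  simpa using congrArg Complex.im h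

theorem ofReal_add_I_ne_zero (x : ℝ) : (x : ℂ) + Complex.I ≠ 0 := fun h => by
  simpa using congrArg Complex.im h

theorem ofReal_sq_add_one_ne_zero (x : ℝ) : (x : ℂ) ^ 2 + 1 ≠ 0 := by
  have : (0 : ℝ) < x ^ 2 + 1 := by positivity
  exact_mod_cast this.ne'

theorem summable_inv_sq_add_one {a : ℝ} (ha : 0 < a) :
    Summable fun n : Fin 2 → ℤ => 1 / ((‖latVec a n‖ ^ 2) ^ 2 + 1) := by
  have h := summable_resolvent_mul ha Complex.I (-Complex.I)
  rw [← Complex.summable_ofReal]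
  refine h.congr fun n => ?_
  have h1 := ofReal_sub_I_ne_zero (‖latVec a n‖ ^ 2)
  have h2 := ofReal_add_I_ne_zero (‖latVec a n‖ ^ 2)
  have h3 := ofReal_sq_add_one_ne_zero (‖latVec a n‖ ^ 2)
  push_cast at h1 h2 h3 ⊢
  rw [sub_neg_eq_add]
  rw [div_mul_div_comm, div_eq_div_iff (mul_ne_zero h1 h2) h3]
  linear_combination Complex.I_sq

theorem mem_norms_iff {a x : ℝ} : x ∈ norms a ↔ ∃ n, ‖latVec a n‖ ^ 2 = x := by
  simp [norms, dualLattice]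

theorem norm_sq_sub_ne_zero {a lam : ℝ} (h : lam ∉ norms a) (n : Fin 2 → ℤ) :
    ‖latVec a n‖ ^ 2 - lam ≠ 0 := fun h0 =>
  h (mem_norms_iff.mpr ⟨n, sub_eq_zero.mp h0⟩)

/-- The term equals `(λ - i) / ((N - λ)(N - i)) + i / (N² + 1)`, because `1 / (N - i) = (N + i) /
(N² + 1)`. -/
theorem summable_spectralTerm {a : ℝ} (ha : 0 < a) {lam : ℝ} (h : lam ∉ norms a) :
    Summable (spectralTerm a lam) := by
  have h1 := (summable_resolvent_mul ha lam Complex.I).mul_left ((lam : ℂ) - Complex.I)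
  have h2 := (Complex.summable_ofReal.mpr (summable_inv_sq_add_one ha)).mul_left Complex.I
  rw [← Complex.summable_ofReal]
  refine (h1.add h2).congr fun n => ?_
  have e0 := norm_sq_sub_ne_zero h n
  have e0' : ((‖latVec a n‖ : ℂ) ^ 2 - lam) ≠ 0 := by exact_mod_cast e0
  have e1 := ofReal_sub_I_ne_zero (‖latVec a n‖ ^ 2)
  have e3 := ofReal_sq_add_one_ne_zero (‖latVec a n‖ ^ 2)
  rw [spectralTerm]
  push_cast at e1 e3 ⊢
  generalize (‖latVec a n‖ : ℂ) ^ 2 = N at *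
  have r1 : 1 / (N - Complex.I) = (N + Complex.I) / (N ^ 2 + 1) := by
    rw [div_eq_div_iff e1 e3]; linear_combination Complex.I_sq
  have r2 : ((lam : ℂ) - Complex.I) * (1 / (N - lam) * (1 / (N - Complex.I))) =
      1 / (N - lam) - 1 / (N - Complex.I) := by
    field_simp; ring
  rw [r2, r1]
  ring

theorem one_add_exp_ne_zero {φ : ℝ} (hφ : φ ∈ Set.Ioo (-Real.pi) Real.pi) :
    1 + Complex.exp (Complex.I * φ) ≠ 0 := by
  intro h
  have h1 := congrArg Complex.re h
  rw [mul_comm] at h1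
  simp only [Complex.add_re, Complex.one_re, Complex.exp_ofReal_mul_I_re, Complex.zero_re] at h1
  have h2 : 0 < Real.cos (φ / 2) := Real.cos_pos_of_mem_Ioo ⟨by linarith [hφ.1], by linarith [hφ.2]⟩
  have h3 := Real.cos_sq (φ / 2)
  rw [mul_div_cancel₀ φ two_ne_zero] at h3
  nlinarith

/-- Half-angle form of the boundary phase; it makes the spectral equation real. Finiteness of
`tan(φ/2)` is where `φ ≠ ±π` enters. -/
theorem I_mul_one_sub_exp {φ : ℝ} (hφ : φ ∈ Set.Ioo (-Real.pi) Real.pi) :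
    Complex.I * (1 - Complex.exp (Complex.I * φ)) =
      (1 + Complex.exp (Complex.I * φ)) * (Real.tan (φ / 2) : ℝ) := by
  have h2 : Real.cos (φ / 2) ≠ 0 :=
    (Real.cos_pos_of_mem_Ioo ⟨by linarith [hφ.1], by linarith [hφ.2]⟩).ne'
  have h2' : (Real.cos (φ / 2) : ℂ) ≠ 0 := by exact_mod_cast h2
  have h3 : Complex.exp (Complex.I * φ) =
      ((Real.cos (φ / 2) : ℂ) + Real.sin (φ / 2) * Complex.I) ^ 2 := by
    rw [Complex.ofReal_cos, Complex.ofReal_sin, ← Complex.exp_mul_I, ← Complex.exp_nat_mul]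
    congr 1; push_cast; ring
  have h4 : (Real.sin (φ / 2) : ℂ) ^ 2 + (Real.cos (φ / 2) : ℂ) ^ 2 = 1 := by
    exact_mod_cast Real.sin_sq_add_cos_sq (φ / 2)
  rw [h3, Real.tan_eq_sin_div_cos, Complex.ofReal_div]
  generalize (Real.sin (φ / 2) : ℂ) = s at *
  generalize (Real.cos (φ / 2) : ℂ) = c at *
  rw [mul_div_assoc', eq_div_iff h2']
  linear_combination (s - Complex.I * c) * h4 +
    (-2 * c ^ 2 * s - c * s ^ 2 * Complex.I - s ^ 3) * Complex.I_sq

/-- The Fourier coefficients, up to a factor, of `(1 + e^{iφ}) G_λ - G_i - e^{iφ} G_{-i}`. -/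
theorem resolvent_differences_eq {a φ : ℝ} (hφ : φ ∈ Set.Ioo (-Real.pi) Real.pi) {lam : ℝ}
    (n : Fin 2 → ℤ) :
    (1 / ((‖latVec a n‖ : ℂ) ^ 2 - lam) - 1 / ((‖latVec a n‖ : ℂ) ^ 2 - Complex.I)) +
      Complex.exp (Complex.I * φ) * (1 / ((‖latVec a n‖ : ℂ) ^ 2 - lam)
        - 1 / ((‖latVec a n‖ : ℂ) ^ 2 + Complex.I)) =
    (1 + Complex.exp (Complex.I * φ)) *
      ((spectralTerm a lam n - Real.tan (φ / 2) * (1 / ((‖latVec a n‖ ^ 2) ^ 2 + 1)) : ℝ) : ℂ) := by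
  have e1 := ofReal_sub_I_ne_zero (‖latVec a n‖ ^ 2)
  have e2 := ofReal_add_I_ne_zero (‖latVec a n‖ ^ 2)
  have e3 := ofReal_sq_add_one_ne_zero (‖latVec a n‖ ^ 2)
  have h := I_mul_one_sub_exp hφ
  rw [spectralTerm]
  push_cast at e1 e2 e3 h ⊢
  generalize (‖latVec a n‖ : ℂ) ^ 2 = N at *
  have r1 : 1 / (N - Complex.I) = (N + Complex.I) / (N ^ 2 + 1) := by
    rw [div_eq_div_iff e1 e3]; linear_combination Complex.I_sq
  have r2 : 1 / (N + Complex.I) = (N - Complex.I) / (N ^ 2 + 1) := by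
    rw [div_eq_div_iff e2 e3]; linear_combination Complex.I_sq
  rw [r1, r2]
  linear_combination (-1 / (N ^ 2 + 1)) * h

theorem hasSum_spectral_difference {a φ : ℝ} (ha : 0 < a) {lam : ℝ} (h : lam ∉ norms a) :
    HasSum (fun n => spectralTerm a lam n
      - Real.tan (φ / 2) * (1 / ((‖latVec a n‖ ^ 2) ^ 2 + 1)))
      (spectralFun a lam - spectralConst a φ) :=
  (summable_spectralTerm ha h).hasSum.sub ((summable_inv_sq_add_one ha).hasSum.mul_left _)

/-- The new eigenvalues are the solutions of the spectral equation. -/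
theorem mem_perturbedEigenvalues_iff {a : ℝ} (ha : 0 < a) (x₀ : Torus) {φ : ℝ}
    (hφ : φ ∈ Set.Ioo (-Real.pi) Real.pi) {lam : ℝ} :
    lam ∈ perturbedEigenvalues ha x₀ φ ↔
      lam ∉ norms a ∧ spectralFun a lam = spectralConst a φ := by
  refine and_congr_right fun hlam => ?_
  have hpi : (Real.pi : ℂ) ≠ 0 := by exact_mod_cast Real.pi_ne_zero
  have hE := one_add_exp_ne_zero hφ
  set E := Complex.exp (Complex.I * φ) with hEdef
  have hne : ∀ n, ((‖latVec a n‖ : ℂ) ^ 2 - lam) ≠ 0 := fun n => by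
    exact_mod_cast norm_sq_sub_ne_zero hlam n
  have hne₁ : ∀ n, ((‖latVec a n‖ : ℂ) ^ 2 - Complex.I) ≠ 0 := fun n => by
    have := ofReal_sub_I_ne_zero (‖latVec a n‖ ^ 2)
    push_cast at this; exact this
  have hne₂ : ∀ n, ((‖latVec a n‖ : ℂ) ^ 2 + Complex.I) ≠ 0 := fun n => by
    have := ofReal_add_I_ne_zero (‖latVec a n‖ ^ 2)
    push_cast at this; exact this
  have hm : ∀ n, UnitAddTorus.mFourier (-n) x₀ * UnitAddTorus.mFourier n x₀ = 1 := fun n => by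
    rw [← UnitAddTorus.mFourier_add, neg_add_cancel, UnitAddTorus.mFourier_zero]; rfl
  have hsum := (Complex.hasSum_ofReal.mpr (hasSum_spectral_difference (φ := φ) ha hlam)).mul_left (1 + E)
  simp only [hEdef, ← resolvent_differences_eq hφ] at hsum
  simp only [← hEdef] at hsum
  constructor
  · rintro ⟨f, hf, q, hq, c, h1, h2⟩
    rw [closure_restrictedLaplacianGraph ha] at hq
    obtain ⟨hrel, h0⟩ := hq
    simp only at h1 h2
    -- Comparing coefficients in the eigenvalue equation forces `q.1 = c ((1 + E) G_λ - G_i - E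
    -- G_{-i})`, so the eigenfunction is `c (1 + E) G_λ`.
    have hq1 : ∀ n, UnitAddTorus.mFourierBasis.repr q.1 n = -(c / (4 * (Real.pi : ℂ) ^ 2)) *
        UnitAddTorus.mFourier (-n) x₀ * ((1 / ((‖latVec a n‖ : ℂ) ^ 2 - lam)
          - 1 / ((‖latVec a n‖ : ℂ) ^ 2 - Complex.I)) + E * (1 / ((‖latVec a n‖ : ℂ) ^ 2 - lam)
        - 1 / ((‖latVec a n‖ : ℂ) ^ 2 + Complex.I))) := by
      intro n
      have r1 := congrArg (fun g : L2 => UnitAddTorus.mFourierBasis.repr g n) h1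
      have r2 := congrArg (fun g : L2 => UnitAddTorus.mFourierBasis.repr g n) h2
      simp only [map_add, map_sub, map_smul, lp.coeFn_add, lp.coeFn_sub, lp.coeFn_smul,
        Pi.add_apply, Pi.sub_apply, Pi.smul_apply, smul_eq_mul, repr_green, hrel] at r1 r2
      rw [r1] at r2
      have e0 := hne n
      have e1 := hne₁ n
      have e2 := hne₂ n
      simp only [greenCoeff, sub_neg_eq_add] at r2
      refine mul_left_cancel₀ e0 ?_
      generalize (‖latVec a n‖ : ℂ) ^ 2 = N at *
      have r3 : (N - lam) * UnitAddTorus.mFourierBasis.repr q.1 n =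
        (lam * c - c * Complex.I) * (-(1 / (4 * (Real.pi : ℂ) ^ 2)) * UnitAddTorus.mFourier (-n) x₀ / (N - Complex.I))
        + (lam * c * E + c * E * Complex.I) * (-(1 / (4 * (Real.pi : ℂ) ^ 2)) * UnitAddTorus.mFourier (-n) x₀ / (N + Complex.I)) := by
        linear_combination -r2
      rw [r3]
      field_simp
      ring
    -- With `c = 0` the eigenfunction would be an ordinary `H²` eigenfunction, which is impossible
    -- for `λ` outside the old spectrum.
    have hc : c ≠ 0 := by
      rintro rfl
      refine hf ?_
      have hq0 : q.1 = 0 := by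
        apply UnitAddTorus.mFourierBasis.repr.injective
        ext n
        rw [hq1]; simp
      rw [h1, hq0]; simp
    have hs := hasSum_eval ha x₀ hrel
    rw [h0, mul_zero] at hs
    have hs' := hsum.mul_left (-(c / (4 * (Real.pi : ℂ) ^ 2)))
    have hs2 := hs.unique (hs'.congr_fun fun n => by
      rw [hq1]
      linear_combination (-(c / (4 * (Real.pi : ℂ) ^ 2)) * ((1 / ((‖latVec a n‖ : ℂ) ^ 2 - lam)
          - 1 / ((‖latVec a n‖ : ℂ) ^ 2 - Complex.I)) + E * (1 / ((‖latVec a n‖ : ℂ) ^ 2 - lam)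
        - 1 / ((‖latVec a n‖ : ℂ) ^ 2 + Complex.I)))) * hm n)
    have hs3 : ((spectralFun a lam - spectralConst a φ : ℝ) : ℂ) = 0 := by
      simpa [hc, hE, hpi] using hs2.symm
    exact sub_eq_zero.mp (by exact_mod_cast hs3)
  · intro hS
    have h0n : (0 : ℝ) ∈ norms a := mem_norms_iff.mpr ⟨0, by
      have : latVec a 0 = 0 := by ext i; fin_cases i <;> simp [latVec]
      simp [this]⟩
    have hlam0 : lam ≠ 0 := fun h => hlam (h ▸ h0n)
    -- The computation above dictates the witness: the eigenfunction `(1 + E) G_λ` with `c = 1`. The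
    -- spectral equation is exactly what makes its regular part vanish at `x₀`.
    refine ⟨(1 + E) • green ha x₀ lam, ?_, ((1 + E) • green ha x₀ lam
      - (green ha x₀ Complex.I + E • green ha x₀ (-Complex.I)),
      (lam : ℂ) • (1 + E) • green ha x₀ lam - (Complex.I • green ha x₀ Complex.I
        - (E * Complex.I) • green ha x₀ (-Complex.I))), ?_, 1, ?_, ?_⟩
    · intro h
      have h1 := congrArg (fun g : L2 => UnitAddTorus.mFourierBasis.repr g 0) h
      simp only [map_smul, lp.coeFn_smul, Pi.smul_apply, smul_eq_mul, repr_green, map_zero,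
        lp.coeFn_zero, Pi.zero_apply, greenCoeff] at h1
      have h2 := hm 0
      have h3 : UnitAddTorus.mFourier (-0 : Fin 2 → ℤ) x₀ ≠ 0 := left_ne_zero_of_mul_eq_one h2
      simp only [mul_eq_zero, div_eq_zero_iff, neg_eq_zero] at h1
      rcases h1 with h1 | (h1 | h1) | h1
      · exact hE h1
      · simp [hpi] at h1
      · exact h3 h1
      · exact hne 0 h1
    · rw [closure_restrictedLaplacianGraph ha]
      have hrel : ∀ n, UnitAddTorus.mFourierBasis.repr ((lam : ℂ) • (1 + E) • green ha x₀ lam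
          - (Complex.I • green ha x₀ Complex.I - (E * Complex.I) • green ha x₀ (-Complex.I))) n =
          (‖latVec a n‖ : ℂ) ^ 2 * UnitAddTorus.mFourierBasis.repr ((1 + E) • green ha x₀ lam
            - (green ha x₀ Complex.I + E • green ha x₀ (-Complex.I))) n := by
        intro n
        simp only [map_add, map_sub, map_smul, lp.coeFn_add, lp.coeFn_sub, lp.coeFn_smul,
          Pi.add_apply, Pi.sub_apply, Pi.smul_apply, smul_eq_mul, repr_green, greenCoeff,
          sub_neg_eq_add]
        have e0 := hne n
        have e1 := hne₁ n
        have e2 := hne₂ n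
        generalize (‖latVec a n‖ : ℂ) ^ 2 = N at *
        field_simp
        ring
      refine ⟨hrel, ?_⟩
      have hs := hasSum_eval ha x₀ (p := (_, _)) hrel
      have hs' := hsum.mul_left (-(1 / (4 * (Real.pi : ℂ) ^ 2)))
      rw [hS, sub_self, Complex.ofReal_zero, mul_zero, mul_zero] at hs'
      have hs2 := hs.unique (hs'.congr_fun fun n => by
        simp only [map_add, map_sub, map_smul, lp.coeFn_add, lp.coeFn_sub, lp.coeFn_smul,
          Pi.add_apply, Pi.sub_apply, Pi.smul_apply, smul_eq_mul, repr_green, greenCoeff,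
          sub_neg_eq_add]
        linear_combination (-(1 / (4 * (Real.pi : ℂ) ^ 2)) * ((1 / ((‖latVec a n‖ : ℂ) ^ 2 - lam)
            - 1 / ((‖latVec a n‖ : ℂ) ^ 2 - Complex.I)) + E * (1 / ((‖latVec a n‖ : ℂ) ^ 2 - lam)
          - 1 / ((‖latVec a n‖ : ℂ) ^ 2 + Complex.I)))) * hm n)
      have h4pi : -(4 * (Real.pi : ℂ) ^ 2) ≠ 0 := by simp [hpi]
      exact (mul_eq_zero.mp hs2).resolve_left h4pi
    · simp only [one_smul, one_mul]
      abel
    · simp only [one_mul]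
      abel

/-! ### Interlacing -/

theorem spectralTerm_lt {a lam mu : ℝ} (h : lam < mu) {n : Fin 2 → ℤ}
    (hn : ‖latVec a n‖ ^ 2 < lam ∨ mu < ‖latVec a n‖ ^ 2) :
    spectralTerm a lam n < spectralTerm a mu n := by
  unfold spectralTerm
  refine sub_lt_sub_right ?_ _
  rcases hn with hn | hn
  · exact one_div_lt_one_div_of_neg_of_lt (by linarith) (by linarith)
  · exact one_div_lt_one_div_of_lt (by linarith) (by linarith)

theorem spectralTerm_le {a lam mu : ℝ} (h : lam ≤ mu) {n : Fin 2 → ℤ}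
    (hn : ‖latVec a n‖ ^ 2 < lam ∨ mu < ‖latVec a n‖ ^ 2) :
    spectralTerm a lam n ≤ spectralTerm a mu n := by
  rcases h.eq_or_lt with rfl | h
  · exact le_rfl
  · exact (spectralTerm_lt h hn).le

/-- Each term `1 / (N - λ)` increases in `λ` as long as its pole is not crossed. -/
theorem spectralFun_lt {a : ℝ} (ha : 0 < a) {lam mu : ℝ} (h : lam < mu)
    (hgap : ∀ x ∈ norms a, x < lam ∨ mu < x) : spectralFun a lam < spectralFun a mu := by
  have hl : lam ∉ norms a := fun h' => by rcases hgap _ h' with h1 | h1 <;> linarith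
  have hm : mu ∉ norms a := fun h' => by rcases hgap _ h' with h1 | h1 <;> linarith
  have hn : ∀ n, ‖latVec a n‖ ^ 2 < lam ∨ mu < ‖latVec a n‖ ^ 2 := fun n =>
    hgap _ (mem_norms_iff.mpr ⟨n, rfl⟩)
  exact (summable_spectralTerm ha hl).tsum_lt_tsum (i := 0) (fun n => (spectralTerm_lt h (hn n)).le)
    (spectralTerm_lt h (hn 0)) (summable_spectralTerm ha hm)

/-- Comparison of the spectral function at two points of a gap, keeping only one term. -/
theorem spectralTerm_sub_le {a : ℝ} (ha : 0 < a) {lam mu : ℝ} (h : lam ≤ mu)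
    (hgap : ∀ x ∈ norms a, x < lam ∨ mu < x) (n : Fin 2 → ℤ) :
    spectralTerm a mu n - spectralTerm a lam n ≤ spectralFun a mu - spectralFun a lam := by
  have hl : lam ∉ norms a := fun h' => by rcases hgap _ h' with h1 | h1 <;> linarith
  have hm : mu ∉ norms a := fun h' => by rcases hgap _ h' with h1 | h1 <;> linarith
  have hn : ∀ n, ‖latVec a n‖ ^ 2 < lam ∨ mu < ‖latVec a n‖ ^ 2 := fun n =>
    hgap _ (mem_norms_iff.mpr ⟨n, rfl⟩)
  have h1 := (summable_spectralTerm ha hm).hasSum.sub (summable_spectralTerm ha hl).hasSum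
  exact le_hasSum h1 n fun m _ => sub_nonneg.mpr (spectralTerm_le h (hn m))

/-- Monotonicity places each term between its values at the two endpoints, whose absolute values
give a summable majorant. -/
theorem continuousOn_spectralFun {a : ℝ} (ha : 0 < a) {c d : ℝ} (hcd : c ≤ d)
    (hgap : ∀ x ∈ norms a, x < c ∨ d < x) : ContinuousOn (spectralFun a) (Set.Icc c d) := by
  have hl : c ∉ norms a := fun h' => by rcases hgap _ h' with h1 | h1 <;> linarith
  have hm : d ∉ norms a := fun h' => by rcases hgap _ h' with h1 | h1 <;> linarith
  have hn : ∀ n, ‖latVec a n‖ ^ 2 < c ∨ d < ‖latVec a n‖ ^ 2 := fun n =>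
    hgap _ (mem_norms_iff.mpr ⟨n, rfl⟩)
  refine continuousOn_tsum (u := fun n => |spectralTerm a c n| + |spectralTerm a d n|) (fun n => ?_)
    ((summable_spectralTerm ha hl).abs.add (summable_spectralTerm ha hm).abs) fun n x hx => ?_
  · unfold spectralTerm
    refine ContinuousOn.sub (continuousOn_const.div (continuousOn_const.sub continuousOn_id)
      fun x hx => ?_) continuousOn_const
    rcases hn n with h | h
    · exact ne_of_lt (by linarith [hx.1])
    · exact ne_of_gt (by linarith [hx.2])
  · have h1 : spectralTerm a c n ≤ spectralTerm a x n :=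
      spectralTerm_le hx.1 ((hn n).imp id fun h => hx.2.trans_lt h)
    have h2 : spectralTerm a x n ≤ spectralTerm a d n :=
      spectralTerm_le hx.2 ((hn n).imp (fun h => h.trans_le hx.1) id)
    rw [Real.norm_eq_abs, abs_le]
    constructor
    · linarith [neg_abs_le (spectralTerm a c n), abs_nonneg (spectralTerm a d n)]
    · linarith [le_abs_self (spectralTerm a d n), abs_nonneg (spectralTerm a c n)]

/-- Near an end of the gap the term with its pole there dominates, so the function exceeds `κ` close
to `y` and falls below it close to `x`; continuity does the rest. -/
theorem exists_spectralFun_eq {a : ℝ} (ha : 0 < a) {x y : ℝ} (hx : x ∈ norms a) (hy : y ∈ norms a)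
    (hxy : x < y) (hgap : ∀ z ∈ norms a, z ≤ x ∨ y ≤ z) (κ : ℝ) :
    ∃ lam, x < lam ∧ lam < y ∧ spectralFun a lam = κ := by
  obtain ⟨n, hn⟩ := mem_norms_iff.mp hx
  obtain ⟨m, hm⟩ := mem_norms_iff.mp hy
  set c := (x + y) / 2 with hc
  have hxc : x < c := by linarith
  have hcy : c < y := by linarith
  have hg : ∀ {s t : ℝ}, x < s → t < y → ∀ z ∈ norms a, z < s ∨ t < z := fun hs ht z hz =>
    (hgap z hz).imp (fun h => h.trans_lt hs) fun h => ht.trans_le h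
  obtain ⟨d, hcd, hdy, hd⟩ : ∃ d, c ≤ d ∧ d < y ∧ κ ≤ spectralFun a d := by
    -- At `d = y - 1 / M` the singular term equals `M`. The first entry of the maximum makes the
    -- gain over the midpoint sufficient, the second keeps `d ≥ c`.
    set M := max (κ - spectralFun a c + 1 / (y - c)) (1 / (y - c)) with hM
    have hpos : 0 < 1 / (y - c) := one_div_pos.mpr (by linarith)
    have hM1 : 1 / (y - c) ≤ M := le_max_right _ _
    have hM0 : 0 < M := hpos.trans_le hM1
    have hcd : c ≤ y - 1 / M := by
      have : 1 / M ≤ y - c := by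
        rw [one_div_le hM0 (by linarith)]; exact hM1
      linarith
    have hMp : 0 < 1 / M := one_div_pos.mpr hM0
    refine ⟨y - 1 / M, hcd, by linarith, ?_⟩
    have h1 := spectralTerm_sub_le ha hcd (hg hxc (by linarith)) m
    simp only [spectralTerm, hm] at h1
    rw [sub_sub_cancel, one_div_one_div] at h1
    have h2 : κ - spectralFun a c + 1 / (y - c) ≤ M := le_max_left _ _
    linarith
  obtain ⟨b, hbc, hxb, hb⟩ : ∃ b, b ≤ c ∧ x < b ∧ spectralFun a b ≤ κ := by
    set M := max (spectralFun a c - κ + 1 / (c - x)) (1 / (c - x)) with hM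
    have hpos : 0 < 1 / (c - x) := one_div_pos.mpr (by linarith)
    have hM1 : 1 / (c - x) ≤ M := le_max_right _ _
    have hM0 : 0 < M := hpos.trans_le hM1
    have hcd : x + 1 / M ≤ c := by
      have : 1 / M ≤ c - x := by
        rw [one_div_le hM0 (by linarith)]; exact hM1
      linarith
    have hMp : 0 < 1 / M := one_div_pos.mpr hM0
    refine ⟨x + 1 / M, hcd, by linarith, ?_⟩
    have h1 := spectralTerm_sub_le ha hcd (hg (by linarith) hcy) n
    simp only [spectralTerm, hn] at h1
    have h3 : 1 / (x - (x + 1 / M)) = -M := by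
      rw [sub_add_cancel_left, one_div_neg_eq_neg_one_div, one_div_one_div]
    have h4 : 1 / (x - c) = -(1 / (c - x)) := by
      rw [← one_div_neg_eq_neg_one_div, neg_sub]
    rw [h3, h4] at h1
    have h2 : spectralFun a c - κ + 1 / (c - x) ≤ M := le_max_left _ _
    linarith
  have hbd := hbc.trans hcd
  obtain ⟨lam, hlam, h⟩ := intermediate_value_Icc hbd
    (continuousOn_spectralFun ha hbd (hg hxb hdy)) ⟨hb, hd⟩
  exact ⟨lam, hxb.trans_le hlam.1, hlam.2.trans_lt hdy, h⟩

theorem exists_norms_between {a : ℝ} (ha : 0 < a) (x₀ : Torus) {φ : ℝ}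
    (hφ : φ ∈ Set.Ioo (-Real.pi) Real.pi) {lam mu : ℝ} (hl : lam ∈ perturbedEigenvalues ha x₀ φ)
    (hm : mu ∈ perturbedEigenvalues ha x₀ φ) (h : lam < mu) :
    ∃ x ∈ norms a, lam < x ∧ x < mu := by
  rw [mem_perturbedEigenvalues_iff ha x₀ hφ] at hl hm
  by_contra hcon
  push Not at hcon
  refine (spectralFun_lt ha h fun x hx => ?_).ne (hl.2.trans hm.2.symm)
  by_cases hx' : lam < x
  · exact Or.inr (lt_of_le_of_ne (hcon x hx hx') fun h => hm.1 (h ▸ hx))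
  · exact Or.inl (lt_of_le_of_ne (not_lt.mp hx') fun h => hl.1 (h ▸ hx))

/-! ### Counting new eigenvalues by interlacing -/

theorem finite_setOf_norm_latVec_le {a : ℝ} (ha : 0 < a) (x : ℝ) :
    {n : Fin 2 → ℤ | ‖latVec a n‖ ^ 2 ≤ x}.Finite := by
  have hk : 0 < min (a ^ 2) (1 / a ^ 2) := lt_min (by positivity) (by positivity)
  refine (isCompact_iff_finite.mp (isCompact_closedBall (0 : Fin 2 → ℤ)
    (√(x / min (a ^ 2) (1 / a ^ 2))))).subset fun n hn => ?_
  rw [mem_closedBall_zero_iff]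
  refine Real.le_sqrt_of_sq_le ?_
  rw [le_div_iff₀ hk, mul_comm]
  exact (norm_sq_latVec_ge ha n).trans hn

theorem finite_norms_inter_Iic {a : ℝ} (ha : 0 < a) (X : ℝ) : (norms a ∩ Set.Iic X).Finite := by
  refine ((finite_setOf_norm_latVec_le ha X).image fun n => ‖latVec a n‖ ^ 2).subset ?_
  rintro x ⟨hx, hxX⟩
  obtain ⟨n, rfl⟩ := mem_norms_iff.mp hx
  exact ⟨n, hxX, rfl⟩

/-- Between two new eigenvalues of an interval lies a norm of the same interval. The `+ 1` is the
usual excess of points over separators. The form with a `Finset` is needed because finiteness of the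
left-hand set is deduced from it. -/
theorem card_perturbedEigenvalues_le {a : ℝ} (ha : 0 < a) (x₀ : Torus) {φ : ℝ}
    (hφ : φ ∈ Set.Ioo (-Real.pi) Real.pi) {I : Set ℝ} (hI : I.OrdConnected)
    (hfin : (norms a ∩ I).Finite) {s : Finset ℝ}
    (hs : (s : Set ℝ) ⊆ perturbedEigenvalues ha x₀ φ ∩ I) :
    s.card ≤ (norms a ∩ I).ncard + 1 := by
  rw [Set.ncard_eq_toFinset_card _ hfin]
  refine Finset.card_le_of_interleaved fun x hx y hy hxy _ => ?_
  obtain ⟨z, hz, hxz, hzy⟩ := exists_norms_between ha x₀ hφ (hs hx).1 (hs hy).1 hxy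
  exact ⟨z, hfin.mem_toFinset.mpr ⟨hz, hI.out (hs hx).2 (hs hy).2 ⟨hxz.le, hzy.le⟩⟩, hxz, hzy⟩

theorem finite_perturbedEigenvalues_inter {a : ℝ} (ha : 0 < a) (x₀ : Torus) {φ : ℝ}
    (hφ : φ ∈ Set.Ioo (-Real.pi) Real.pi) {I : Set ℝ} (hI : I.OrdConnected)
    (hfin : (norms a ∩ I).Finite) : (perturbedEigenvalues ha x₀ φ ∩ I).Finite := by
  by_contra hinf
  obtain ⟨s, hs, hcard⟩ := Set.Infinite.exists_subset_card_eq hinf ((norms a ∩ I).ncard + 2)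
  have := card_perturbedEigenvalues_le ha x₀ hφ hI hfin hs
  omega

theorem ncard_perturbedEigenvalues_le {a : ℝ} (ha : 0 < a) (x₀ : Torus) {φ : ℝ}
    (hφ : φ ∈ Set.Ioo (-Real.pi) Real.pi) {I : Set ℝ} (hI : I.OrdConnected)
    (hfin : (norms a ∩ I).Finite) :
    (perturbedEigenvalues ha x₀ φ ∩ I).ncard ≤ (norms a ∩ I).ncard + 1 := by
  have h := finite_perturbedEigenvalues_inter ha x₀ hφ hI hfin
  rw [Set.ncard_eq_toFinset_card _ h]
  exact card_perturbedEigenvalues_le ha x₀ hφ hI hfin (by simp)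

theorem ncard_norms_le {a : ℝ} (ha : 0 < a) (x₀ : Torus) {φ : ℝ}
    (hφ : φ ∈ Set.Ioo (-Real.pi) Real.pi) (X : ℝ) :
    (norms a ∩ Set.Iic X).ncard ≤ (perturbedEigenvalues ha x₀ φ ∩ Set.Iic X).ncard + 1 := by
  have h := finite_perturbedEigenvalues_inter ha x₀ hφ Set.ordConnected_Iic
    (finite_norms_inter_Iic ha X)
  have h' := finite_norms_inter_Iic ha X
  rw [Set.ncard_eq_toFinset_card _ h, Set.ncard_eq_toFinset_card _ h']
  refine Finset.card_le_of_interleaved fun x hx y hy hxy hgap => ?_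
  rw [h'.mem_toFinset] at hx hy
  obtain ⟨lam, hxl, hly, hlam⟩ := exists_spectralFun_eq ha hx.1 hy.1 hxy (fun z hz => by
    by_contra hcon
    push Not at hcon
    exact hgap z (h'.mem_toFinset.mpr ⟨hz, hcon.2.le.trans hy.2⟩) hcon) (spectralConst a φ)
  refine ⟨lam, h.mem_toFinset.mpr ⟨(mem_perturbedEigenvalues_iff ha x₀ hφ).mpr ⟨fun hl => ?_, hlam⟩,
    hly.le.trans hy.2⟩, hxl, hly⟩
  exact hgap lam (h'.mem_toFinset.mpr ⟨hl, hly.le.trans hy.2⟩) ⟨hxl, hly⟩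

/-! ### The number of distinct norms -/

/-- Exchanging the sums counts multiples: `∑ ⌊K / d⌋`, at most `K` times a harmonic number. -/
theorem sum_card_divisors_le (K : ℕ) :
    ((∑ u ∈ Finset.Ioc 0 K, u.divisors.card : ℕ) : ℝ) ≤ K * (1 + Real.log K) := by
  have h1 : ∑ u ∈ Finset.Ioc 0 K, u.divisors.card ≤
      ∑ d ∈ Finset.Ioc 0 K, (K / d) := by
    have h2 : ∀ u ∈ Finset.Ioc 0 K, u.divisors.card =
        ((Finset.Ioc 0 K).filter fun d => d ∣ u).card := by
      intro u hu
      congr 1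
      ext d
      simp only [Nat.mem_divisors, Finset.mem_filter, Finset.mem_Ioc] at hu ⊢
      exact ⟨fun h => ⟨⟨Nat.pos_of_dvd_of_pos h.1 hu.1, (Nat.le_of_dvd hu.1 h.1).trans hu.2⟩, h.1⟩,
        fun h => ⟨h.2, hu.1.ne'⟩⟩
    rw [Finset.sum_congr rfl h2]
    simp only [Finset.card_filter]
    rw [Finset.sum_comm]
    refine Finset.sum_le_sum fun d _ => ?_
    rw [← Finset.card_filter, Nat.Ioc_filter_dvd_card_eq_div]
  refine (Nat.cast_le.mpr h1).trans ?_
  push_cast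
  have h3 := harmonic_le_one_add_log K
  have h4 : ((harmonic K : ℚ) : ℝ) = ∑ d ∈ Finset.Ioc 0 K, (d : ℝ)⁻¹ := by
    rw [harmonic_eq_sum_Icc]
    push_cast
    rfl
  rw [h4] at h3
  calc ∑ d ∈ Finset.Ioc 0 K, ((K / d : ℕ) : ℝ) ≤ ∑ d ∈ Finset.Ioc 0 K, (K : ℝ) * (d : ℝ)⁻¹ := by
        refine Finset.sum_le_sum fun d _ => ?_
        rw [← div_eq_mul_inv]
        exact Nat.cast_div_le
    _ = K * ∑ d ∈ Finset.Ioc 0 K, (d : ℝ)⁻¹ := by rw [Finset.mul_sum]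
    _ ≤ _ := by gcongr

theorem card_divisors_mul_le (m n : ℕ) :
    (m * n).divisors.card ≤ m.divisors.card * n.divisors.card := by
  rw [Nat.divisors_mul]
  exact Finset.card_mul_le

/-- Cauchy–Schwarz over the fibres of `g`; the sum of squared fibre sizes counts coincidences, so
few coincidences force many values. -/
theorem card_sq_le_card_image_mul {α β : Type*} [DecidableEq β] (G : Finset α) (g : α → β) :
    G.card ^ 2 ≤ (G.image g).card * ((G ×ˢ G).filter fun q => g q.1 = g q.2).card := by
  rw [Finset.card_eq_sum_card_image g G]
  refine sq_sum_le_card_mul_sum_sq.trans (Nat.mul_le_mul_left _ (le_of_eq ?_))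
  rw [Finset.card_eq_sum_card_fiberwise (f := fun q => g q.1) (t := G.image g)]
  · refine Finset.sum_congr rfl fun v _ => ?_
    rw [sq, ← Finset.card_product]
    congr 1
    ext ⟨x, y⟩
    simp only [Finset.mem_product, Finset.mem_filter]
    constructor
    · rintro ⟨⟨hx, rfl⟩, hy, h⟩
      exact ⟨⟨⟨hx, hy⟩, h.symm⟩, rfl⟩
    · rintro ⟨⟨⟨hx, hy⟩, h⟩, rfl⟩
      exact ⟨⟨hx, rfl⟩, hy, h.symm⟩
  · intro q hq
    simp only [Finset.coe_filter, Finset.mem_product, Set.mem_ofPred_eq] at hq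
    exact Finset.mem_coe.mpr (Finset.mem_image_of_mem g hq.1.1)

/-- The off-diagonal coincidences of the form `t m² + n²`, up to exchanging the two points. -/
def offDiagonalCoincidences (t : ℝ) (M : ℕ) : Finset ((ℕ × ℕ) × (ℕ × ℕ)) :=
  open Classical in
  ((Finset.range M ×ˢ Finset.range M) ×ˢ (Finset.range M ×ˢ Finset.range M)).filter fun q =>
    q.2.1 < q.1.1 ∧ q.1.2 < q.2.2 ∧
      t * (q.1.1 : ℝ) ^ 2 + (q.1.2 : ℝ) ^ 2 = t * (q.2.1 : ℝ) ^ 2 + (q.2.2 : ℝ) ^ 2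

theorem mem_offDiagonalCoincidences {t : ℝ} {M : ℕ} {q : (ℕ × ℕ) × (ℕ × ℕ)} :
    q ∈ offDiagonalCoincidences t M ↔ ((q.1.1 < M ∧ q.1.2 < M) ∧ (q.2.1 < M ∧ q.2.2 < M)) ∧
      q.2.1 < q.1.1 ∧ q.1.2 < q.2.2 ∧
      t * (q.1.1 : ℝ) ^ 2 + (q.1.2 : ℝ) ^ 2 = t * (q.2.1 : ℝ) ^ 2 + (q.2.2 : ℝ) ^ 2 := by
  simp [offDiagonalCoincidences]

/-- For a coincidence put `u = n' - n`, `v = n' + n`, `d = m - m'`. Multiplied by `E₀`, the relation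
reads `D₀ d (m + m') = E₀ u v`, so `d` divides `u v E₀`. The triple `(u, v, d)` determines the four
integers, and submultiplicativity of the divisor function separates the sums over `u` and `v`. -/
theorem card_offDiagonalCoincidences_le {t : ℝ} {D₀ E₀ : ℕ} (hE₀ : 0 < E₀) (hD₀ : 0 < D₀)
    (hDE : (E₀ : ℝ) * t = D₀) (M : ℕ) :
    (offDiagonalCoincidences t M).card ≤
      E₀.divisors.card * (∑ u ∈ Finset.Ioc 0 (2 * M), u.divisors.card) ^ 2 := by
  classical
  set K := 2 * M with hK
  have ht : 0 < t := by
    have h1 : (0 : ℝ) < E₀ := by exact_mod_cast hE₀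
    have h2 : (0 : ℝ) < D₀ := by exact_mod_cast hD₀
    rw [← hDE] at h2
    exact pos_of_mul_pos_right h2 h1.le
  have hcard : (offDiagonalCoincidences t M).card ≤
      ((Finset.Ioc 0 K ×ˢ Finset.Ioc 0 K).sigma fun p => (p.1 * p.2 * E₀).divisors).card := by
    refine Finset.card_le_card_of_injOn
      (fun q => ⟨(q.2.2 - q.1.2, q.2.2 + q.1.2), q.1.1 - q.2.1⟩) ?_ ?_
    · rintro ⟨⟨m, n⟩, m', n'⟩ hq
      obtain ⟨⟨⟨h1, h2⟩, h3, h4⟩, h5, h6, h7⟩ := mem_offDiagonalCoincidences.mp hq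
      simp only at h1 h2 h3 h4 h5 h6 h7
      obtain ⟨d, rfl⟩ := Nat.exists_eq_add_of_lt h5
      obtain ⟨u, rfl⟩ := Nat.exists_eq_add_of_lt h6
      simp only [Finset.coe_sigma, Set.mem_sigma_iff, Finset.mem_coe, Finset.mem_product,
        Finset.mem_Ioc, Nat.mem_divisors]
      refine ⟨⟨⟨by omega, by omega⟩, by omega, by omega⟩, ?_, ?_⟩
      · have h8 : m' + d + 1 - m' = d + 1 := by omega
        have h9 : n + u + 1 - n = u + 1 := by omega
        rw [h8, h9]
        have h10 : (u + 1) * (n + u + 1 + n) * E₀ = (d + 1) * ((2 * m' + d + 1) * D₀) := by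
          have : (((u + 1) * (n + u + 1 + n) * E₀ : ℕ) : ℝ) =
              (((d + 1) * ((2 * m' + d + 1) * D₀) : ℕ) : ℝ) := by
            push_cast at h7 ⊢
            rw [← hDE]
            linear_combination (-(E₀ : ℝ)) * h7
          exact_mod_cast this
        exact ⟨_, h10⟩
      · have : 0 < n + u + 1 - n := by omega
        positivity
    · rintro ⟨⟨m, n⟩, m', n'⟩ hq ⟨⟨k, l⟩, k', l'⟩ hq' heq
      obtain ⟨-, h5, h6, h7⟩ := mem_offDiagonalCoincidences.mp hq
      obtain ⟨-, h5', h6', h7'⟩ := mem_offDiagonalCoincidences.mp hq'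
      simp only [Sigma.mk.injEq, Prod.mk.injEq, heq_eq_eq] at heq h5 h6 h7 h5' h6' h7'
      obtain ⟨⟨e1, e2⟩, e3⟩ := heq
      have hn : n = l := by omega
      have hn' : n' = l' := by omega
      subst hn hn'
      have h8 : (m : ℝ) ^ 2 - (m' : ℝ) ^ 2 = (k : ℝ) ^ 2 - (k' : ℝ) ^ 2 := by
        refine mul_left_cancel₀ ht.ne' ?_
        linear_combination h7 - h7'
      have h9 : (m : ℝ) - m' = (k : ℝ) - k' := by
        rw [← Nat.cast_sub h5.le, ← Nat.cast_sub h5'.le, e3]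
      have h10 : (m : ℝ) - m' ≠ 0 := by
        have : (m' : ℝ) < m := by exact_mod_cast h5
        exact (sub_pos.mpr this).ne'
      have h11 : (m : ℝ) + m' = k + k' := by
        refine mul_left_cancel₀ h10 ?_
        linear_combination h8 - (k + k' : ℝ) * h9
      have hm : (m : ℝ) = k := by linarith
      have hm' : (m' : ℝ) = k' := by linarith
      rw [Nat.cast_injective hm, Nat.cast_injective hm']
  refine hcard.trans ?_
  rw [Finset.card_sigma]
  calc ∑ p ∈ Finset.Ioc 0 K ×ˢ Finset.Ioc 0 K, (p.1 * p.2 * E₀).divisors.card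
      ≤ ∑ p ∈ Finset.Ioc 0 K ×ˢ Finset.Ioc 0 K,
        E₀.divisors.card * (p.1.divisors.card * p.2.divisors.card) := by
        refine Finset.sum_le_sum fun p _ => ?_
        refine (card_divisors_mul_le _ _).trans ?_
        rw [mul_comm]
        exact Nat.mul_le_mul_left _ (card_divisors_mul_le _ _)
    _ = _ := by
        rw [← Finset.mul_sum, sq, Finset.sum_mul_sum, Finset.sum_product]

/-- The form `t m² + n²` takes at least `c M² / log² M` values on `[0, M)²`. -/
theorem exists_card_image_quadratic_ge {t : ℝ} (ht : 0 < t) : ∃ C : ℝ, 0 < C ∧ ∀ M : ℕ, 1 ≤ M →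
    (M : ℝ) ^ 2 ≤ C * (1 + Real.log (2 * M)) ^ 2 *
      (((Finset.range M ×ˢ Finset.range M).image
        fun p : ℕ × ℕ => t * (p.1 : ℝ) ^ 2 + (p.2 : ℝ) ^ 2).card : ℝ) := by
  classical
  obtain ⟨D, hD⟩ : ∃ D : ℕ, ∀ M : ℕ, (offDiagonalCoincidences t M).card ≤
      D * (∑ u ∈ Finset.Ioc 0 (2 * M), u.divisors.card) ^ 2 := by
    -- A single off-diagonal coincidence already makes `t` a ratio of differences of squares; for
    -- irrational `t` there is none and `D = 0` works.
    by_cases h : ∃ D₀ E₀ : ℕ, 0 < E₀ ∧ 0 < D₀ ∧ (E₀ : ℝ) * t = D₀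
    · obtain ⟨D₀, E₀, hE, hD, hDE⟩ := h
      exact ⟨_, card_offDiagonalCoincidences_le hE hD hDE⟩
    · refine ⟨0, fun M => ?_⟩
      rw [zero_mul, Nat.le_zero, Finset.card_eq_zero, Finset.eq_empty_iff_forall_notMem]
      rintro ⟨⟨m, n⟩, m', n'⟩ hq
      obtain ⟨-, h5, h6, h7⟩ := mem_offDiagonalCoincidences.mp hq
      simp only at h5 h6 h7
      refine h ⟨n' ^ 2 - n ^ 2, m ^ 2 - m' ^ 2, Nat.sub_pos_of_lt (Nat.pow_lt_pow_left h5 two_ne_zero),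
        Nat.sub_pos_of_lt (Nat.pow_lt_pow_left h6 two_ne_zero), ?_⟩
      rw [Nat.cast_sub (Nat.pow_le_pow_left h5.le 2), Nat.cast_sub (Nat.pow_le_pow_left h6.le 2)]
      push_cast
      linarith
  -- The diagonal contributes `M²`, the two orders of off-diagonal pairs `2 D (2 M l)² = 8 D l² M²`,
  -- where `l = 1 + log (2M) ≥ 1`.
  refine ⟨1 + 8 * D, by positivity, fun M hM => ?_⟩
  set g : ℕ × ℕ → ℝ := fun p => t * (p.1 : ℝ) ^ 2 + (p.2 : ℝ) ^ 2 with hg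
  set G := Finset.range M ×ˢ Finset.range M with hG
  have hGc : G.card = M ^ 2 := by rw [hG, Finset.card_product, Finset.card_range, sq]
  have h1 := card_sq_le_card_image_mul G g
  have h2 : ((G ×ˢ G).filter fun q => g q.1 = g q.2).card ≤
      M ^ 2 + 2 * (offDiagonalCoincidences t M).card := by
    have hsub : ((G ×ˢ G).filter fun q => g q.1 = g q.2) ⊆
        G.image (fun p => (p, p)) ∪ (offDiagonalCoincidences t M
          ∪ (offDiagonalCoincidences t M).image Prod.swap) := by
      rintro ⟨⟨m, n⟩, m', n'⟩ hq
      simp only [hG, hg, Finset.mem_filter, Finset.mem_product, Finset.mem_range] at hq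
      obtain ⟨⟨⟨h1, h2⟩, h3, h4⟩, h5⟩ := hq
      simp only [Finset.mem_union, Finset.mem_image]
      have hsq : ∀ {x y : ℕ}, x < y → (x : ℝ) ^ 2 < (y : ℝ) ^ 2 := fun h => by
        exact_mod_cast Nat.pow_lt_pow_left h two_ne_zero
      rcases lt_trichotomy m m' with h | rfl | h
      · right; right
        refine ⟨((m', n'), (m, n)), mem_offDiagonalCoincidences.mpr
          ⟨⟨⟨h3, h4⟩, h1, h2⟩, h, ?_, h5.symm⟩, rfl⟩
        by_contra hn
        have h6 : (n' : ℝ) ^ 2 ≥ (n : ℝ) ^ 2 := by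
          have : (n : ℝ) ≤ n' := by exact_mod_cast not_lt.mp hn
          gcongr
        nlinarith [mul_lt_mul_of_pos_left (hsq h) ht]
      · left
        refine ⟨(m, n), by simp [hG, h1, h2], ?_⟩
        have h6 : (n : ℝ) ^ 2 = (n' : ℝ) ^ 2 := by linarith
        have h7 : n ^ 2 = n' ^ 2 := by exact_mod_cast h6
        rw [Nat.pow_left_injective two_ne_zero h7]
      · right; left
        refine mem_offDiagonalCoincidences.mpr ⟨⟨⟨h1, h2⟩, h3, h4⟩, h, ?_, h5⟩
        by_contra hn
        have h6 : (n : ℝ) ^ 2 ≥ (n' : ℝ) ^ 2 := by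
          have : (n' : ℝ) ≤ n := by exact_mod_cast not_lt.mp hn
          gcongr
        nlinarith [mul_lt_mul_of_pos_left (hsq h) ht]
    refine (Finset.card_le_card hsub).trans ((Finset.card_union_le _ _).trans ?_)
    have h3 : (G.image fun p => (p, p)).card ≤ M ^ 2 := hGc ▸ Finset.card_image_le
    have h4 := Finset.card_union_le (offDiagonalCoincidences t M)
      ((offDiagonalCoincidences t M).image Prod.swap)
    have h5 : ((offDiagonalCoincidences t M).image Prod.swap).card ≤
      (offDiagonalCoincidences t M).card := Finset.card_image_le
    omega
  have hMpos : (0 : ℝ) < M := by exact_mod_cast hM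
  set l := 1 + Real.log (2 * M) with hl
  have hl1 : 1 ≤ l := by
    have : (0 : ℝ) ≤ Real.log (2 * M) := Real.log_nonneg (by
      have : (1 : ℝ) ≤ M := by exact_mod_cast hM
      linarith)
    linarith
  have h3 : ((offDiagonalCoincidences t M).card : ℝ) ≤ D * (2 * M * l) ^ 2 := by
    have h4 : ((∑ u ∈ Finset.Ioc 0 (2 * M), u.divisors.card : ℕ) : ℝ) ≤ 2 * M * l := by
      have h := sum_card_divisors_le (2 * M)
      rw [Nat.cast_mul, Nat.cast_ofNat, ← hl] at h
      exact h
    have h5 := hD M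
    generalize (∑ u ∈ Finset.Ioc 0 (2 * M), u.divisors.card) = σ at h4 h5
    calc ((offDiagonalCoincidences t M).card : ℝ) ≤ ((D * σ ^ 2 : ℕ) : ℝ) := Nat.cast_le.mpr h5
      _ = D * (σ : ℝ) ^ 2 := by push_cast; rfl
      _ ≤ _ := mul_le_mul_of_nonneg_left (pow_le_pow_left₀ (Nat.cast_nonneg _) h4 2)
        (Nat.cast_nonneg _)
  have h4 : (((G ×ˢ G).filter fun q => g q.1 = g q.2).card : ℝ) ≤ (1 + 8 * D) * l ^ 2 * M ^ 2 := by
    have h5 : (((G ×ˢ G).filter fun q => g q.1 = g q.2).card : ℝ) ≤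
      (M : ℝ) ^ 2 + 2 * ((offDiagonalCoincidences t M).card : ℝ) := by exact_mod_cast h2
    have h6 : (M : ℝ) ^ 2 ≤ l ^ 2 * M ^ 2 := by
      have : 1 ≤ l ^ 2 := one_le_pow₀ hl1
      nlinarith [sq_nonneg (M : ℝ)]
    calc _ ≤ (M : ℝ) ^ 2 + 2 * (D * (2 * M * l) ^ 2) := by linarith
      _ ≤ l ^ 2 * M ^ 2 + 2 * (D * (2 * M * l) ^ 2) := by linarith
      _ = _ := by ring
  have h5 : ((M : ℝ) ^ 2) ^ 2 ≤ ((G.image g).card : ℝ) *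
      (((G ×ˢ G).filter fun q => g q.1 = g q.2).card : ℝ) := by
    rw [hGc] at h1
    exact_mod_cast h1
  have h6 : ((M : ℝ) ^ 2) * M ^ 2 ≤ ((1 + 8 * D) * l ^ 2 * ((G.image g).card : ℝ)) * M ^ 2 := by
    calc ((M : ℝ) ^ 2) * M ^ 2 = ((M : ℝ) ^ 2) ^ 2 := by ring
      _ ≤ _ := h5
      _ ≤ ((G.image g).card : ℝ) * ((1 + 8 * D) * l ^ 2 * M ^ 2) := by gcongr
      _ = _ := by ring
  exact le_of_mul_le_mul_right h6 (by positivity)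

/-- Scaled by `a²`, the norms are the values of `a⁴ m² + n²`, and the square `0 ≤ m, n < M` with `M`
of order `√X` stays below level `X`. The squared logarithm lost is absorbed by `X ^ ε`, `ε = 1 - s`.
-/
theorem exists_rpow_le_ncard_norms {a : ℝ} (ha : 0 < a) {s : ℝ} (hs : s < 1) :
    ∃ c : ℝ, 0 < c ∧ ∀ᶠ X : ℝ in atTop, c * X ^ s ≤ ((norms a ∩ Set.Iic X).ncard : ℝ) := by
  classical
  set κ : ℝ := a ^ 2 + 1 / a ^ 2 with hκ
  have hκ0 : 0 < κ := by positivity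
  set ε : ℝ := 1 - s with hε
  have hε0 : 0 < ε := by linarith
  obtain ⟨C, hC0, hC⟩ := exists_card_image_quadratic_ge (t := a ^ 4) (by positivity)
  set D : ℝ := 4 * κ * (C * ((1 + 1 / ε) ^ 2 * (4 / κ) ^ ε)) with hD
  have hD0 : 0 < D := by positivity
  refine ⟨1 / D, by positivity, ?_⟩
  -- `X ≥ 4κ` gives `r ≥ 2`, so rounding `r` down to `M` costs at most a factor two.
  filter_upwards [eventually_ge_atTop (4 * κ), eventually_gt_atTop 0] with X hX hX0
  set r : ℝ := √(X / κ) with hr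
  have hr2 : r ^ 2 = X / κ := Real.sq_sqrt (by positivity)
  have hr_two : 2 ≤ r := by
    refine Real.le_sqrt_of_sq_le ?_
    rw [le_div_iff₀ hκ0]; linarith
  set M : ℕ := ⌊r⌋₊ with hM
  have hMr : (M : ℝ) ≤ r := Nat.floor_le (by linarith)
  have hMr' : r < M + 1 := Nat.lt_floor_add_one r
  have hM1 : (1 : ℝ) < M := by linarith
  have hM1' : 1 ≤ M := by exact_mod_cast hM1.le
  have hM2 : X ≤ 4 * κ * M ^ 2 := by
    have h1 : r ≤ 2 * M := by linarith
    have h2 : r ^ 2 ≤ (2 * M) ^ 2 := by gcongr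
    rw [hr2, div_le_iff₀ hκ0] at h2
    linarith
  have hcard : ((Finset.range M ×ˢ Finset.range M).image
        fun p : ℕ × ℕ => a ^ 4 * (p.1 : ℝ) ^ 2 + (p.2 : ℝ) ^ 2).card ≤
      (norms a ∩ Set.Iic X).ncard := by
    rw [← Set.ncard_coe_finset]
    refine Set.ncard_le_ncard_of_injOn (fun v => v / a ^ 2) ?_ ?_ (finite_norms_inter_Iic ha X)
    · intro v hv
      simp only [Finset.coe_image, Set.mem_image, Finset.mem_coe, Finset.mem_product,
        Finset.mem_range] at hv
      obtain ⟨⟨m, n⟩, ⟨hm, hn⟩, rfl⟩ := hv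
      simp only at hm hn ⊢
      have h1 : (a ^ 4 * (m : ℝ) ^ 2 + (n : ℝ) ^ 2) / a ^ 2 = ‖latVec a ![(m : ℤ), (n : ℤ)]‖ ^ 2 := by
        rw [norm_sq_latVec]
        simp only [Matrix.cons_val_zero, Matrix.cons_val_one, Int.cast_natCast]
        field_simp
      refine ⟨mem_norms_iff.mpr ⟨_, h1.symm⟩, ?_⟩
      have h2 : (m : ℝ) ≤ r := (Nat.cast_le.mpr hm.le).trans hMr
      have h3 : (n : ℝ) ≤ r := (Nat.cast_le.mpr hn.le).trans hMr
      have h4 : (m : ℝ) ^ 2 ≤ r ^ 2 := by gcongr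
      have h5 : (n : ℝ) ^ 2 ≤ r ^ 2 := by gcongr
      change (a ^ 4 * (m : ℝ) ^ 2 + (n : ℝ) ^ 2) / a ^ 2 ≤ X
      have h6 : X = r ^ 2 * κ := by rw [hr2]; field_simp
      rw [h6, hκ]
      calc (a ^ 4 * (m : ℝ) ^ 2 + (n : ℝ) ^ 2) / a ^ 2
          ≤ (a ^ 4 * r ^ 2 + r ^ 2) / a ^ 2 := by gcongr
        _ = _ := by field_simp
    · intro v _ w _ hvw
      exact (div_left_inj' (by positivity : a ^ 2 ≠ 0)).mp hvw
  set cnt : ℝ := ((norms a ∩ Set.Iic X).ncard : ℝ) with hcnt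
  have hcnt0 : 0 ≤ cnt := Nat.cast_nonneg _
  have h1 := hC M hM1'
  have hlog : 1 + Real.log (2 * M) ≤ (1 + 1 / ε) * (2 * r) ^ ε := by
    have h2 : Real.log (2 * M) ≤ (2 * M) ^ ε / ε := Real.log_le_rpow_div (by positivity) hε0
    have h3 : ((2 * M : ℝ)) ^ ε ≤ (2 * r) ^ ε :=
      Real.rpow_le_rpow (by positivity) (by linarith) hε0.le
    have h4 : 1 ≤ (2 * r) ^ ε := Real.one_le_rpow (by linarith) hε0.le
    have h5 : (2 * M : ℝ) ^ ε / ε ≤ (2 * r) ^ ε / ε := by gcongr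
    calc 1 + Real.log (2 * M) ≤ (2 * r) ^ ε + (2 * r) ^ ε / ε := by linarith
      _ = _ := by ring
  have hlog0 : 0 ≤ 1 + Real.log (2 * M) := by
    have : 0 ≤ Real.log (2 * M) := Real.log_nonneg (by linarith)
    linarith
  have hlog2 : (1 + Real.log (2 * M)) ^ 2 ≤ (1 + 1 / ε) ^ 2 * (4 / κ) ^ ε * X ^ ε := by
    calc (1 + Real.log (2 * M)) ^ 2 ≤ ((1 + 1 / ε) * (2 * r) ^ ε) ^ 2 := by gcongr
      _ = (1 + 1 / ε) ^ 2 * ((2 * r) ^ 2) ^ ε := by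
          rw [mul_pow, ← Real.rpow_natCast ((2 * r) ^ ε), ← Real.rpow_natCast (2 * r),
            ← Real.rpow_mul (by positivity), ← Real.rpow_mul (by positivity), mul_comm ε]
      _ = (1 + 1 / ε) ^ 2 * (4 / κ * X) ^ ε := by
          rw [mul_pow, hr2]; ring_nf
      _ = _ := by rw [Real.mul_rpow (by positivity) hX0.le]; ring
  have hfin : X ≤ D * X ^ ε * cnt := by
    calc X ≤ 4 * κ * M ^ 2 := hM2
      _ ≤ 4 * κ * (C * (1 + Real.log (2 * M)) ^ 2 * cnt) := by
          gcongr
          exact h1.trans (mul_le_mul_of_nonneg_left (Nat.cast_le.mpr hcard) (by positivity))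
      _ ≤ 4 * κ * (C * ((1 + 1 / ε) ^ 2 * (4 / κ) ^ ε * X ^ ε) * cnt) := by gcongr
      _ = _ := by rw [hD]; ring
  have hXs : X ^ s * X ^ ε = X := by
    rw [← Real.rpow_add hX0, hε]; simp
  have hXε : 0 < X ^ ε := Real.rpow_pos_of_pos hX0 _
  have h7 : X ^ s ≤ D * cnt := by
    refine le_of_mul_le_mul_right ?_ hXε
    rw [hXs]
    linarith
  rw [one_div, inv_mul_le_iff₀ hD0]
  exact h7

/-! ### Lattice points and eigenvalues in short windows -/

theorem finite_dualLattice_le {a : ℝ} (ha : 0 < a) (x : ℝ) :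
    {ξ ∈ dualLattice a | ‖ξ‖ ^ 2 ≤ x}.Finite := by
  refine ((finite_setOf_norm_latVec_le ha x).image (latVec a)).subset ?_
  rintro ξ ⟨⟨n, rfl⟩, h⟩
  exact ⟨n, h, rfl⟩

theorem ncard_norms_Ioo_le {a : ℝ} (ha : 0 < a) {u v : ℝ} (huv : u ≤ v) :
    ((norms a ∩ Set.Ioo u v).ncard : ℝ) ≤ latticeCount a v - latticeCount a u := by
  have hsub : {ξ ∈ dualLattice a | ‖ξ‖ ^ 2 ≤ u} ⊆ {ξ ∈ dualLattice a | ‖ξ‖ ^ 2 ≤ v} :=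
    fun ξ h => ⟨h.1, h.2.trans huv⟩
  have h1 := Set.ncard_sdiff_add_ncard_of_subset hsub (finite_dualLattice_le ha v)
  have h2 : norms a ∩ Set.Ioo u v ⊆ (fun ξ : Plane => ‖ξ‖ ^ 2) ''
      ({ξ ∈ dualLattice a | ‖ξ‖ ^ 2 ≤ v} \ {ξ ∈ dualLattice a | ‖ξ‖ ^ 2 ≤ u}) := by
    rintro x ⟨⟨ξ, hξ, rfl⟩, hu, hv⟩
    exact ⟨ξ, ⟨⟨hξ, hv.le⟩, fun h => absurd h.2 (not_le.mpr hu)⟩, rfl⟩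
  have hf : ({ξ ∈ dualLattice a | ‖ξ‖ ^ 2 ≤ v} \ {ξ ∈ dualLattice a | ‖ξ‖ ^ 2 ≤ u}).Finite :=
    (finite_dualLattice_le ha v).subset Set.sdiff_subset
  have h3 := (Set.ncard_le_ncard h2 (hf.image _)).trans (Set.ncard_image_le hf)
  have h4 : (norms a ∩ Set.Ioo u v).ncard + latticeCount a u ≤ latticeCount a v := by
    unfold latticeCount
    omega
  have h5 : ((norms a ∩ Set.Ioo u v).ncard : ℝ) + latticeCount a u ≤ latticeCount a v := by
    exact_mod_cast h4
  linarith

/-- Weyl's law at the two ends of the window: the main terms differ by `2π X ^ δ`, which `δ ≤ θ`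
puts below the remainder `O(X ^ θ)`. -/
theorem exists_ncard_norms_window_le {a θ δ : ℝ} (ha : 0 < a) (hθ : IsWeylExponent a θ)
    (hθ0 : 0 < θ) (hθ1 : θ ≤ 1) (hδθ : δ ≤ θ) : ∃ C : ℝ, 0 ≤ C ∧ ∀ᶠ X : ℝ in atTop,
    ∀ y ≤ 2 * X, ((norms a ∩ Set.Ioo (y - X ^ δ) (y + X ^ δ)).ncard : ℝ) ≤ C * X ^ θ := by
  obtain ⟨K, hK0, hK⟩ := hθ.exists_pos
  rw [Asymptotics.isBigOWith_iff, eventually_atTop] at hK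
  obtain ⟨x₁, hx₁⟩ := hK
  set x₂ := max x₁ 1 with hx₂
  have hx₂1 : 1 ≤ x₂ := le_max_right _ _
  have hw : ∀ x, x₂ ≤ x → |(latticeCount a x : ℝ) - Real.pi * x| ≤ K * x ^ θ := by
    intro x hx
    have h1 := hx₁ x ((le_max_left _ _).trans hx)
    rwa [Real.norm_eq_abs, Real.norm_of_nonneg (Real.rpow_nonneg (by linarith) _)] at h1
  -- Both ends are at most `3X`, whence two remainders `K (3X) ^ θ`; `3π` covers the main term also
  -- in the case of windows near the origin.
  refine ⟨3 * Real.pi + 2 * (K * 3 ^ θ), by positivity, ?_⟩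
  filter_upwards [eventually_ge_atTop (max x₂ 1), (tendsto_rpow_atTop hθ0).eventually_ge_atTop x₂]
    with X hX hXθ y hy
  have hX1 : 1 ≤ X := (le_max_right _ _).trans hX
  have hX0 : 0 < X := by linarith
  have hL1 : X ^ δ ≤ X ^ θ := Real.rpow_le_rpow_of_exponent_le hX1 hδθ
  have hL2 : X ^ θ ≤ X := by
    simpa using Real.rpow_le_rpow_of_exponent_le hX1 hθ1
  have hL0 : 0 < X ^ δ := Real.rpow_pos_of_pos hX0 _
  set L := X ^ δ with hL
  have h3 : ∀ z, x₂ ≤ z → z ≤ 3 * X → K * z ^ θ ≤ K * 3 ^ θ * X ^ θ := by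
    intro z hz hz3
    rw [mul_assoc, ← Real.mul_rpow (by norm_num) hX0.le]
    gcongr
    linarith
  have h4 : 0 ≤ K * 3 ^ θ * X ^ θ := by positivity
  have hpi := Real.pi_pos
  by_cases hcase : x₂ ≤ y - L
  · refine (ncard_norms_Ioo_le ha (by linarith)).trans ?_
    have h5 := abs_le.mp ((hw (y + L) (by linarith)).trans (h3 _ (by linarith) (by linarith)))
    have h6 := abs_le.mp ((hw (y - L) hcase).trans (h3 _ hcase (by linarith)))
    have h7 : Real.pi * L ≤ Real.pi * X ^ θ := by gcongr
    have h8 : 0 ≤ Real.pi * X ^ θ := by positivity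
    nlinarith
  · push Not at hcase
    -- Here the lower end is too small for Weyl's law, so the window is enlarged to reach below all
    -- norms. The end `-1` keeps the norm `0` inside the open interval.
    have hsub : norms a ∩ Set.Ioo (y - L) (y + L) ⊆ norms a ∩ Set.Ioo (-1) (x₂ + 2 * L) := by
      rintro x ⟨hx, hx1, hx2⟩
      refine ⟨hx, ?_, by linarith⟩
      obtain ⟨n, rfl⟩ := mem_norms_iff.mp hx
      have : 0 ≤ ‖latVec a n‖ ^ 2 := by positivity
      linarith
    have hfin : (norms a ∩ Set.Ioo (-1) (x₂ + 2 * L)).Finite :=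
      (finite_norms_inter_Iic ha (x₂ + 2 * L)).subset fun x hx => ⟨hx.1, hx.2.2.le⟩
    have h5 : ((norms a ∩ Set.Ioo (y - L) (y + L)).ncard : ℝ) ≤
        ((norms a ∩ Set.Ioo (-1) (x₂ + 2 * L)).ncard : ℝ) :=
      Nat.cast_le.mpr (Set.ncard_le_ncard hsub hfin)
    have h6 := ncard_norms_Ioo_le ha (u := -1) (v := x₂ + 2 * L) (by linarith)
    have h7 : (0 : ℝ) ≤ latticeCount a (-1) := Nat.cast_nonneg _
    have h8 := abs_le.mp ((hw (x₂ + 2 * L) (by linarith)).trans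
      (h3 _ (by linarith) (by linarith [(le_max_left x₂ 1).trans hX])))
    have h9 : Real.pi * (x₂ + 2 * L) ≤ Real.pi * (3 * X ^ θ) := by
      gcongr
      linarith
    nlinarith

/-! ### Lattice points in a strip -/

theorem card_int_le_of_mem_Icc {T : Finset ℤ} {u v : ℝ} (huv : u ≤ v)
    (hT : ∀ k ∈ T, u ≤ k ∧ (k : ℝ) ≤ v) : (T.card : ℝ) ≤ v - u + 1 := by
  have hsub : T ⊆ Finset.Icc ⌈u⌉ ⌊v⌋ := fun k hk =>
    Finset.mem_Icc.mpr ⟨Int.ceil_le.mpr (hT k hk).1, Int.le_floor.mpr (hT k hk).2⟩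
  have h1 := Finset.card_le_card hsub
  rw [Int.card_Icc] at h1
  have h2 : ((⌊v⌋ + 1 - ⌈u⌉).toNat : ℝ) ≤ v - u + 1 := by
    rcases le_total 0 (⌊v⌋ + 1 - ⌈u⌉) with h | h
    · have : ((⌊v⌋ + 1 - ⌈u⌉).toNat : ℝ) = ((⌊v⌋ + 1 - ⌈u⌉ : ℤ) : ℝ) := by
        exact_mod_cast Int.toNat_of_nonneg h
      rw [this]
      push_cast
      linarith [Int.floor_le v, Int.le_ceil u]
    · rw [Int.toNat_of_nonpos h]
      simp only [Nat.cast_zero]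
      linarith
  exact (Nat.cast_le.mpr h1).trans h2

/-- On each line where the second coordinate is fixed, the strip cuts out an interval of length `2Y
/ |b|` for the first. -/
theorem card_int_strip_le {S : Finset (ℤ × ℤ)} {A Y b c : ℝ} (hA : 0 ≤ A) (hY : 0 ≤ Y) (hb : b ≠ 0)
    (hS : ∀ p ∈ S, |(p.2 : ℝ)| ≤ A ∧ |p.1 * b + p.2 * c| ≤ Y) :
    (S.card : ℝ) ≤ (2 * Y / |b| + 1) * (2 * A + 1) := by
  classical
  have hfib : ∀ k ∈ S.image Prod.snd, (S.filter fun p => p.2 = k).card ≤ ⌊2 * Y / |b| + 1⌋₊ := by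
    intro k _
    refine Nat.le_floor ?_
    have hinj : Set.InjOn Prod.fst ((S.filter fun p => p.2 = k : Finset (ℤ × ℤ)) : Set (ℤ × ℤ)) := by
      intro p hp q hq h
      simp only [Finset.coe_filter, Set.mem_ofPred_eq] at hp hq
      exact Prod.ext h (hp.2.trans hq.2.symm)
    rw [← Finset.card_image_of_injOn hinj]
    have hbp : 0 < |b| := abs_pos.mpr hb
    have h1 := card_int_le_of_mem_Icc (T := (S.filter fun p => p.2 = k).image Prod.fst)
      (u := -(k * c / b) - Y / |b|) (v := -(k * c / b) + Y / |b|)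
      (by have : 0 ≤ Y / |b| := by positivity
          linarith) (by
        intro m hm
        obtain ⟨p, hp, rfl⟩ := Finset.mem_image.mp hm
        obtain ⟨hpS, hpk⟩ := Finset.mem_filter.mp hp
        have h2 := (hS p hpS).2
        rw [hpk] at h2
        have h3 : (p.1 : ℝ) * b + k * c = (p.1 + k * c / b) * b := by field_simp
        rw [h3, abs_mul, ← le_div_iff₀ hbp, abs_le] at h2
        constructor <;> linarith [h2.1, h2.2])
    refine h1.trans (le_of_eq ?_)
    ring
  have h1 := Finset.card_le_mul_card_image S _ hfib
  have h2 : ((S.image Prod.snd).card : ℝ) ≤ 2 * A + 1 := by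
    have := card_int_le_of_mem_Icc (T := S.image Prod.snd) (u := -A) (v := A) (by linarith) (by
      intro m hm
      obtain ⟨p, hp, rfl⟩ := Finset.mem_image.mp hm
      exact abs_le.mp (hS p hp).1)
    linarith
  have h3 : (⌊2 * Y / |b| + 1⌋₊ : ℝ) ≤ 2 * Y / |b| + 1 := Nat.floor_le (by positivity)
  calc (S.card : ℝ) ≤ ((⌊2 * Y / |b| + 1⌋₊ * (S.image Prod.snd).card : ℕ) : ℝ) := Nat.cast_le.mpr h1
    _ = (⌊2 * Y / |b| + 1⌋₊ : ℝ) * ((S.image Prod.snd).card : ℝ) := by push_cast; rfl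
    _ ≤ _ := by gcongr

theorem ncard_le_of_strip {a : ℝ} {T : Set (Fin 2 → ℤ)} (hT : T.Finite) {i j : Fin 2} (hij : i ≠ j)
    {A Y b c : ℝ} (hA : 0 ≤ A) (hY : 0 ≤ Y) (hb : b ≠ 0)
    (h : ∀ n ∈ T, |(n j : ℝ)| ≤ A ∧ |n i * b + n j * c| ≤ Y) :
    ((latVec a '' T).ncard : ℝ) ≤ (2 * Y / |b| + 1) * (2 * A + 1) := by
  classical
  have h1 : (latVec a '' T).ncard ≤ (hT.toFinset.image fun n => (n i, n j)).card := by
    refine (Set.ncard_image_le hT).trans (le_of_eq ?_)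
    rw [Set.ncard_eq_toFinset_card _ hT, Finset.card_image_of_injective]
    intro n m hnm
    simp only [Prod.mk.injEq] at hnm
    funext k
    obtain rfl | rfl : k = i ∨ k = j := by omega
    · exact hnm.1
    · exact hnm.2
  refine (Nat.cast_le.mpr h1).trans (card_int_strip_le hA hY hb (c := c) fun p hp => ?_)
  obtain ⟨n, hn, rfl⟩ := Finset.mem_image.mp hp
  exact h n (hT.mem_toFinset.mp hn)

/-- The number of lattice points in a disc and in a strip orthogonal to `ζ`. -/
theorem ncard_strip_le {a : ℝ} (ha : 0 < a) {ζ : Plane} (hζ : ζ ≠ 0) {R Y : ℝ}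
    (hRa : a ≤ R) (hRa' : 1 / a ≤ R) (hY : ‖ζ‖ * (a + 1 / a) ≤ Y) :
    ({η ∈ dualLattice a | ‖η‖ ^ 2 ≤ R ^ 2 ∧ |⟪η, ζ⟫_ℝ| ≤ Y}.ncard : ℝ) ≤
      15 * (a + 1 / a) ^ 2 * (R * (Y / ‖ζ‖)) := by
  have hz : 0 < ‖ζ‖ := norm_pos_iff.mpr hζ
  have hR : 0 < R := ha.trans_le hRa
  have hai : 0 < 1 / a := by positivity
  set k : ℝ := a + 1 / a with hk
  have hk0 : 0 < k := by positivity
  have hY0 : 0 ≤ Y := le_trans (by positivity) hY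
  set q : ℝ := Y / ‖ζ‖ with hq
  have hqk : k ≤ q := by rw [hq, le_div_iff₀ hz]; linarith
  have haa : a * (1 / a) = 1 := by field_simp
  -- The lower bounds on `k`, `R` and `q` serve to absorb the `+ 1` in both counting factors.
  have hk1 : 1 ≤ k := by nlinarith [sq_nonneg (a - 1 / a)]
  have hR1 : 1 ≤ R := by
    by_contra h
    push Not at h
    nlinarith
  have hkq : 1 ≤ k * q := by nlinarith
  have hkR : 1 ≤ k * R := by nlinarith
  set T : Set (Fin 2 → ℤ) := {n | ‖latVec a n‖ ^ 2 ≤ R ^ 2 ∧ |⟪latVec a n, ζ⟫_ℝ| ≤ Y} with hT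
  have hTfin : T.Finite := (finite_setOf_norm_latVec_le ha (R ^ 2)).subset fun n hn => hn.1
  have hset : {η ∈ dualLattice a | ‖η‖ ^ 2 ≤ R ^ 2 ∧ |⟪η, ζ⟫_ℝ| ≤ Y} = latVec a '' T := by
    ext η
    constructor
    · rintro ⟨⟨n, rfl⟩, h⟩
      exact ⟨n, h, rfl⟩
    · rintro ⟨n, h, rfl⟩
      exact ⟨⟨n, rfl⟩, h⟩
  have hinner : ∀ n, ⟪latVec a n, ζ⟫_ℝ = n 0 * (a * ζ 0) + n 1 * (1 / a * ζ 1) := by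
    intro n
    simp [latVec, PiLp.inner_apply, Fin.sum_univ_two]
    ring
  have hnorm : ‖ζ‖ ^ 2 = ζ 0 ^ 2 + ζ 1 ^ 2 := by
    simp [EuclideanSpace.norm_sq_eq, Fin.sum_univ_two]
  have hcoord : ∀ n ∈ T, |(n 0 : ℝ)| ≤ 1 / a * R ∧ |(n 1 : ℝ)| ≤ a * R := by
    intro n hn
    have h1 := hn.1
    rw [norm_sq_latVec] at h1
    have h2 : |(n 0 : ℝ) * a| ≤ R := abs_le_of_sq_le_sq (by nlinarith [sq_nonneg ((n 1 : ℝ) / a)]) hR.le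
    have h3 : |(n 1 : ℝ) / a| ≤ R := abs_le_of_sq_le_sq (by nlinarith [sq_nonneg ((n 0 : ℝ) * a)]) hR.le
    rw [abs_mul, abs_of_pos ha] at h2
    rw [abs_div, abs_of_pos ha, div_le_iff₀ ha] at h3
    constructor
    · rw [one_div, ← div_eq_inv_mul, le_div_iff₀ ha]; exact h2
    · linarith
  rw [hset]
  -- Common estimate for the two cases below: `y` is the larger coordinate of `ζ`, so `‖ζ‖ ≤ 2 |y|`,
  -- and `x` undoes the scaling in `b`. The constant `15` is `5 · 3`, one factor for each side of
  -- the box.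
  have hfinal : ∀ {w x y : ℝ}, 0 ≤ x → x ≤ k → 0 ≤ w → w ≤ k → ‖ζ‖ ≤ 2 * |y| → 0 < |y| →
      ∀ {b : ℝ}, |b| * x = |y| → 0 < |b| →
      (2 * Y / |b| + 1) * (2 * (w * R) + 1) ≤ 15 * k ^ 2 * (R * q) := by
    intro w x y hx hxk hw hwk hy hy0 b hb hb0
    have h1 : 2 * Y / |b| ≤ 4 * (k * q) := by
      rw [div_le_iff₀ hb0]
      have h2 : Y = q * ‖ζ‖ := by rw [hq]; field_simp
      have hq0 : 0 ≤ q := hk0.le.trans hqk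
      calc 2 * Y ≤ 2 * (q * (2 * |y|)) := by rw [h2]; gcongr
        _ = 4 * (x * q) * |b| := by rw [← hb]; ring
        _ ≤ 4 * (k * q) * |b| := by gcongr
    have h3 : 2 * (w * R) ≤ 2 * (k * R) := by gcongr
    calc (2 * Y / |b| + 1) * (2 * (w * R) + 1) ≤ (5 * (k * q)) * (3 * (k * R)) := by
          gcongr
          · linarith
          · linarith
      _ = _ := by ring
  rcases le_total (ζ 1 ^ 2) (ζ 0 ^ 2) with hle | hle
  · have h0 : ‖ζ‖ ≤ 2 * |ζ 0| := by
      refine abs_le_of_sq_le_sq' ?_ (by positivity) |>.2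
      rw [mul_pow, sq_abs]; nlinarith [sq_nonneg (ζ 0)]
    have h00 : 0 < |ζ 0| := by linarith
    have hb0 : 0 < |a * ζ 0| := by rw [abs_mul]; positivity
    refine (ncard_le_of_strip hTfin (i := 0) (j := 1) (by decide) (A := a * R) (Y := Y)
      (b := a * ζ 0) (c := 1 / a * ζ 1) (by positivity) hY0 (abs_pos.mp hb0) fun n hn =>
        ⟨(hcoord n hn).2, hinner n ▸ hn.2⟩).trans ?_
    refine hfinal (x := 1 / a) (y := ζ 0) hai.le (by linarith) ha.le (by linarith) h0 h00 ?_ hb0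
    rw [abs_mul, abs_of_pos ha]
    field_simp
  · have h0 : ‖ζ‖ ≤ 2 * |ζ 1| := by
      refine abs_le_of_sq_le_sq' ?_ (by positivity) |>.2
      rw [mul_pow, sq_abs]; nlinarith [sq_nonneg (ζ 1)]
    have h00 : 0 < |ζ 1| := by linarith
    have hb0 : 0 < |1 / a * ζ 1| := by rw [abs_mul]; positivity
    refine (ncard_le_of_strip hTfin (i := 1) (j := 0) (by decide) (A := 1 / a * R) (Y := Y)
      (b := 1 / a * ζ 1) (c := a * ζ 0) (by positivity) hY0 (abs_pos.mp hb0) fun n hn =>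
        ⟨(hcoord n hn).1, by rw [add_comm]; exact hinner n ▸ hn.2⟩).trans ?_
    refine hfinal (x := a) (y := ζ 1) ha.le (by linarith) hai.le (by linarith) h0 h00 ?_ hb0
    rw [abs_mul, abs_of_pos hai]
    field_simp

/-! ### Exceptional eigenvalues -/

/-- Exceptional eigenvalues are covered by windows centred at `|η|²`, with `η` in a strip inside a
disc: number of centres times eigenvalues per window. The dependence on `ζ` beyond the factor `1 /
‖ζ‖` enters only through how large `X` must be. -/
theorem exists_ncard_exceptionalEigenvalues_le {a : ℝ} (ha : 0 < a) (x₀ : Torus) {φ θ δ : ℝ}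
    (hφ : φ ∈ Set.Ioo (-Real.pi) Real.pi) (hθ : IsWeylExponent a θ) (hθ0 : 0 < θ) (hθ1 : θ ≤ 1)
    (hδ0 : 0 < δ) (hδθ : δ ≤ θ) : ∃ C : ℝ, ∀ ζ : Plane, ζ ≠ 0 → ∀ᶠ X : ℝ in atTop,
      ((exceptionalEigenvalues ha x₀ φ δ ζ ∩ Set.Iic X).ncard : ℝ)
        ≤ C * (X ^ (1 / 2 + δ + θ) / ‖ζ‖) := by
  classical
  obtain ⟨C, hC0, hC⟩ := exists_ncard_norms_window_le ha hθ hθ0 hθ1 hδθ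
  refine ⟨15 * (a + 1 / a) ^ 2 * 4 * (C + 1), fun ζ hζ => ?_⟩
  have hz : 0 < ‖ζ‖ := norm_pos_iff.mpr hζ
  have hΛ0 := finite_perturbedEigenvalues_inter ha x₀ hφ Set.ordConnected_Iic
    (finite_norms_inter_Iic ha 0)
  -- A lower bound for the nonpositive new eigenvalues, so that `λ ≤ X` implies `|λ| ≤ X` once `X ≥
  -- -B`.
  obtain ⟨B, hB⟩ := hΛ0.bddBelow
  have hR := (Real.tendsto_sqrt_atTop.comp (tendsto_id.const_mul_atTop (two_pos (α := ℝ))))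
  filter_upwards [hC, eventually_ge_atTop 1, eventually_ge_atTop (-B),
    hR.eventually_ge_atTop a, hR.eventually_ge_atTop (1 / a),
    (tendsto_rpow_atTop hδ0).eventually_ge_atTop (‖ζ‖ * (a + 1 / a))]
    with X hCX hX1 hXB hRa hRa' hY
  simp only [Function.comp, id] at hRa hRa'
  have hX : 0 < X := by linarith
  set L := X ^ δ with hL
  have hL0 : 0 < L := Real.rpow_pos_of_pos hX _
  have hLX : L ≤ X := by
    simpa using Real.rpow_le_rpow_of_exponent_le hX1 (hδθ.trans hθ1)
  have hsq : √(2 * X) ^ 2 = 2 * X := Real.sq_sqrt (by positivity)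
  have hS := ncard_strip_le ha hζ hRa hRa' (Y := 2 * L) (by linarith)
  set S : Set Plane := {η ∈ dualLattice a | ‖η‖ ^ 2 ≤ √(2 * X) ^ 2 ∧ |⟪η, ζ⟫_ℝ| ≤ 2 * L} with hSdef
  have hSfin : S.Finite := (finite_dualLattice_le ha (√(2 * X) ^ 2)).subset fun η h => ⟨h.1, h.2.1⟩
  have hwfin : ∀ y, (perturbedEigenvalues ha x₀ φ ∩ Set.Ioo (y - L) (y + L)).Finite := fun y =>
    finite_perturbedEigenvalues_inter ha x₀ hφ Set.ordConnected_Ioo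
      ((finite_norms_inter_Iic ha (y + L)).subset fun x hx => ⟨hx.1, hx.2.2.le⟩)
  have hw : ∀ y ≤ 2 * X, (perturbedEigenvalues ha x₀ φ ∩ Set.Ioo (y - L) (y + L)).ncard ≤
      ⌊(C + 1) * X ^ θ⌋₊ := by
    intro y hy
    refine Nat.le_floor ?_
    have h1 := ncard_perturbedEigenvalues_le ha x₀ hφ (I := Set.Ioo (y - L) (y + L))
      Set.ordConnected_Ioo
      ((finite_norms_inter_Iic ha (y + L)).subset fun x hx => ⟨hx.1, hx.2.2.le⟩)
    have h2 : ((perturbedEigenvalues ha x₀ φ ∩ Set.Ioo (y - L) (y + L)).ncard : ℝ) ≤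
      ((norms a ∩ Set.Ioo (y - L) (y + L)).ncard : ℝ) + 1 := by exact_mod_cast h1
    have h3 := hCX y hy
    have h4 : 1 ≤ X ^ θ := Real.one_le_rpow hX1 hθ0.le
    linarith
  have hsub : exceptionalEigenvalues ha x₀ φ δ ζ ∩ Set.Iic X ⊆
      ((hSfin.toFinset.biUnion fun η => (hwfin (‖η‖ ^ 2)).toFinset : Finset ℝ) : Set ℝ) := by
    rintro lam ⟨⟨hlam, hbad⟩, hlamX⟩
    have hlamX' : lam ≤ X := hlamX
    have hne : (annulus a lam (|lam| ^ δ) ∩ diophantineSet a δ ζ).Nonempty := by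
      rw [Set.nonempty_iff_ne_empty]
      exact fun h => hbad ⟨hlam, h⟩
    obtain ⟨η, ⟨hη, hηl⟩, -, hηζ⟩ := hne
    have habs : |lam| ≤ X := by
      rw [abs_le]
      refine ⟨?_, hlamX'⟩
      rcases le_total lam 0 with h | h
      · linarith [hB ⟨hlam, h⟩]
      · linarith
    have hlL : |lam| ^ δ ≤ L := Real.rpow_le_rpow (abs_nonneg _) habs hδ0.le
    have hηl' := abs_lt.mp (hηl.trans_le hlL)
    have hη2 : ‖η‖ ^ 2 ≤ 2 * X := by linarith [hηl'.2]
    have hηS : η ∈ S := by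
      refine ⟨hη, by rw [hsq]; exact hη2, hηζ.trans ?_⟩
      -- The width of the strip: `|η|² ≤ 2X` and `2 ^ δ ≤ 2`.
      calc ‖η‖ ^ (2 * δ) = (‖η‖ ^ 2) ^ δ := by
            rw [Real.rpow_mul (norm_nonneg _)]; norm_cast
        _ ≤ (2 * X) ^ δ := Real.rpow_le_rpow (by positivity) hη2 hδ0.le
        _ = 2 ^ δ * L := Real.mul_rpow two_pos.le hX.le
        _ ≤ 2 * L := by
            gcongr
            simpa using Real.rpow_le_rpow_of_exponent_le (one_le_two (α := ℝ)) (hδθ.trans hθ1)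
    rw [Finset.mem_coe, Finset.mem_biUnion]
    refine ⟨η, hSfin.mem_toFinset.mpr hηS, (hwfin _).mem_toFinset.mpr ⟨hlam, ?_, ?_⟩⟩
    · linarith [hηl'.2]
    · linarith [hηl'.1]
  have hcard : (exceptionalEigenvalues ha x₀ φ δ ζ ∩ Set.Iic X).ncard ≤
      S.ncard * ⌊(C + 1) * X ^ θ⌋₊ := by
    refine (Set.ncard_le_ncard hsub (Finset.finite_toSet _)).trans ?_
    rw [Set.ncard_coe_finset, Set.ncard_eq_toFinset_card _ hSfin]
    refine Finset.card_biUnion_le_card_mul _ _ _ fun η hη => ?_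
    rw [← Set.ncard_eq_toFinset_card _ (hwfin _)]
    refine hw _ ?_
    rw [← hsq]
    exact (hSfin.mem_toFinset.mp hη).2.1
  have hCX0 : 0 ≤ (C + 1) * X ^ θ := by positivity
  have hsqrt : √(2 * X) ≤ 2 * X ^ (1 / 2 : ℝ) := by
    rw [← Real.sqrt_eq_rpow]
    refine Real.sqrt_le_iff.mpr ⟨by positivity, ?_⟩
    rw [mul_pow, Real.sq_sqrt hX.le]
    linarith
  calc ((exceptionalEigenvalues ha x₀ φ δ ζ ∩ Set.Iic X).ncard : ℝ)
      ≤ ((S.ncard * ⌊(C + 1) * X ^ θ⌋₊ : ℕ) : ℝ) := Nat.cast_le.mpr hcard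
    _ = (S.ncard : ℝ) * (⌊(C + 1) * X ^ θ⌋₊ : ℝ) := by push_cast; rfl
    _ ≤ (15 * (a + 1 / a) ^ 2 * (2 * X ^ (1 / 2 : ℝ) * (2 * L / ‖ζ‖))) * ((C + 1) * X ^ θ) := by
        refine mul_le_mul (hS.trans ?_) (Nat.floor_le hCX0) (Nat.cast_nonneg _) (by positivity)
        gcongr
    _ = 15 * (a + 1 / a) ^ 2 * 4 * (C + 1) * ((X ^ (1 / 2 : ℝ) * L * X ^ θ) / ‖ζ‖) := by ring
    _ = _ := by rw [hL, ← Real.rpow_add hX, ← Real.rpow_add hX]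

/-! ### From counting bounds to densities -/

theorem hasDensityIn_zero_of_le {S T : Set ℝ} {s r c C : ℝ} (hST : S ⊆ T)
    (hT : ∀ X : ℝ, (T ∩ Set.Iic X).Finite) (hsr : s < r) (hc : 0 < c)
    (h1 : ∀ᶠ X : ℝ in atTop, ((S ∩ Set.Iic X).ncard : ℝ) ≤ C * X ^ s)
    (h2 : ∀ᶠ X : ℝ in atTop, c * X ^ r ≤ ((T ∩ Set.Iic X).ncard : ℝ)) : HasDensityIn S T 0 := by
  refine ⟨hST, hT, ?_⟩
  have hlim : Tendsto (fun X : ℝ => C / c * X ^ (-(r - s))) atTop (𝓝 0) := by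
    simpa using (tendsto_rpow_neg_atTop (sub_pos.mpr hsr)).const_mul (C / c)
  refine squeeze_zero' (Eventually.of_forall fun X => by positivity) ?_ hlim
  filter_upwards [h1, h2, eventually_gt_atTop 0] with X hS hT hX
  have hr : 0 < X ^ r := Real.rpow_pos_of_pos hX _
  calc _ ≤ C * X ^ s / (c * X ^ r) :=
        div_le_div₀ ((Nat.cast_nonneg _).trans hS) hS (by positivity) hT
    _ = C / c * (X ^ s / X ^ r) := by ring
    _ = _ := by rw [← Real.rpow_sub hX, neg_sub]

theorem HasDensityIn.one_of_sdiff {S T : Set ℝ} (hST : S ⊆ T) (h : HasDensityIn (T \ S) T 0)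
    (hne : ∀ᶠ X : ℝ in atTop, 0 < (T ∩ Set.Iic X).ncard) : HasDensityIn S T 1 := by
  refine ⟨hST, h.2.1, ?_⟩
  have h1 := h.2.2.const_sub 1
  rw [sub_zero] at h1
  refine h1.congr' ?_
  filter_upwards [hne] with X hX
  have hX' : ((T ∩ Set.Iic X).ncard : ℝ) ≠ 0 := by exact_mod_cast hX.ne'
  have hsub : S ∩ Set.Iic X ⊆ T ∩ Set.Iic X := fun x hx => ⟨hST hx.1, hx.2⟩
  have h2 := Set.ncard_sdiff_add_ncard_of_subset hsub (h.2.1 X)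
  have h3 : (T ∩ Set.Iic X) \ (S ∩ Set.Iic X) = (T \ S) ∩ Set.Iic X := by
    ext x
    simp only [Set.mem_sdiff, Set.mem_inter_iff]
    tauto
  rw [h3] at h2
  rw [eq_div_iff hX', sub_mul, div_mul_cancel₀ _ hX', one_mul, ← h2]
  push_cast
  ring

theorem exists_rpow_le_ncard_perturbedEigenvalues {a : ℝ} (ha : 0 < a) (x₀ : Torus) {φ : ℝ}
    (hφ : φ ∈ Set.Ioo (-Real.pi) Real.pi) {s : ℝ} (hs0 : 0 < s) (hs : s < 1) :
    ∃ c : ℝ, 0 < c ∧ ∀ᶠ X : ℝ in atTop,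
      c * X ^ s ≤ ((perturbedEigenvalues ha x₀ φ ∩ Set.Iic X).ncard : ℝ) := by
  obtain ⟨c, hc, h⟩ := exists_rpow_le_ncard_norms ha hs
  refine ⟨c / 2, by positivity, ?_⟩
  -- Once `c X ^ s ≥ 2`, halving `c` pays for the `1` lost in interlacing.
  filter_upwards [h, ((tendsto_rpow_atTop hs0).const_mul_atTop hc).eventually_ge_atTop 2]
    with X h1 h2
  have h3 : ((norms a ∩ Set.Iic X).ncard : ℝ) ≤
    ((perturbedEigenvalues ha x₀ φ ∩ Set.Iic X).ncard : ℝ) + 1 := by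
    exact_mod_cast ncard_norms_le ha x₀ hφ X
  linarith

end PointScatterer

end

/-! ### Choice of exponents and conclusion -/

theorem mainTheorem2 (a : ℝ) (ha : 0 < a) (x₀ : PointScatterer.Torus)
    (φ : ℝ) (hφ : φ ∈ Set.Ioo (-Real.pi) Real.pi)
    (θ : ℝ) (hθ : PointScatterer.IsWeylExponent a θ) (hθ' : 1 / 4 ≤ θ)
    (δ : ℝ) (hδ : δ ∈ Set.Ioo (θ / 2) (1 / 2 - θ)) :
    (∀ ζ ∈ PointScatterer.dualLattice a, ζ ≠ 0 →
      PointScatterer.HasDensityIn (PointScatterer.goodEigenvalues ha x₀ φ δ ζ)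
        (PointScatterer.perturbedEigenvalues ha x₀ φ) 1 ∧
      PointScatterer.HasDensityIn (PointScatterer.exceptionalEigenvalues ha x₀ φ δ ζ)
        (PointScatterer.perturbedEigenvalues ha x₀ φ) 0) ∧
    ∃ C : ℝ, ∀ ζ ∈ PointScatterer.dualLattice a, ζ ≠ 0 →
      ∀ᶠ X : ℝ in atTop,
        ((PointScatterer.exceptionalEigenvalues ha x₀ φ δ ζ ∩ Set.Iic X).ncard : ℝ)
          ≤ C * (X ^ (1 - (1 / 2 - θ - δ)) / ‖ζ‖) := by
  obtain ⟨hδ1, hδ2⟩ := hδ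
  -- The role of `θ ≥ 1/4` is `δ < 1/2 - θ ≤ 1/4 ≤ θ`, so that windows of radius `X ^ δ` are no
  -- wider than the Weyl remainder resolves. Nonemptiness of the range for `δ` gives `θ < 1/3`.
  obtain ⟨C, hC⟩ := PointScatterer.exists_ncard_exceptionalEigenvalues_le ha x₀ hφ hθ
    (by linarith) (by linarith) (δ := δ) (by linarith) (by linarith)
  have hexp : 1 / 2 + δ + θ = 1 - (1 / 2 - θ - δ) := by ring
  rw [hexp] at hC
  refine ⟨fun ζ _ hζ => ?_, C, fun ζ _ hζ => hC ζ hζ⟩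
  set s : ℝ := 1 - (1 / 2 - θ - δ) with hs
  -- The upper exponent satisfies `s < 1`; the midpoint `(s + 1) / 2` leaves room on both sides,
  -- below the full order `1` and above `s`.
  obtain ⟨c, hc, hlow⟩ := PointScatterer.exists_rpow_le_ncard_perturbedEigenvalues ha x₀ hφ
    (s := (s + 1) / 2) (by linarith) (by linarith)
  have hbad : PointScatterer.HasDensityIn (PointScatterer.exceptionalEigenvalues ha x₀ φ δ ζ)
      (PointScatterer.perturbedEigenvalues ha x₀ φ) 0 := by
    refine PointScatterer.hasDensityIn_zero_of_le (s := s) (r := (s + 1) / 2) (C := C / ‖ζ‖)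
      Set.sdiff_subset (fun X => PointScatterer.finite_perturbedEigenvalues_inter ha x₀ hφ
        Set.ordConnected_Iic (PointScatterer.finite_norms_inter_Iic ha X)) (by linarith) hc ?_ hlow
    filter_upwards [hC ζ hζ] with X hX
    exact hX.trans (le_of_eq (by ring))
  refine ⟨PointScatterer.HasDensityIn.one_of_sdiff (fun x hx => hx.1) hbad ?_, hbad⟩
  filter_upwards [hlow, eventually_gt_atTop 0] with X hX hX0
  have h1 : (0 : ℝ) < c * X ^ ((s + 1) / 2) := by positivity
  exact_mod_cast h1.trans_le hX
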